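/- Let $l$ be an odd prime and let $G$ be a pro-$l$ group having a finite normal $l$-subgroup $H$ with $G/H\cong\mathbb{Z}_l$; for example, $G=\mathrm{Gal}(K/k)$ pro-$l$, where $K/k$ is a Galois extension of totally real number fields with $k/\mathbb{Q}$ and $K/k_\infty$ finite, $k_\infty$ is the cyclotomic $\mathbb{Z}_l$-extension of $k$ and $H=\mathrm{Gal}(K/k_\infty)$. Let $\mathcal{Q}G$ be the total ring of fractions of the Iwasawa algebra $\mathbb{Z}_l[[G]]$ with respect to all central non-zero-divisors, let $A\cong D_{n\times n}$ be a Wedderburn component of $\mathcal{Q}G$ with underlying skew field $D$, and let $s_D$ be the Schur index of $D$, i.e. $[D:Z(D)]=s_D^2$. Let $R$ be the integral closure in $Z(D)$ of the image of the centre of $\mathbb{Z}_l[[G]]$ (if $Z(D)$ is identified with $\mathrm{Quot}(\mathfrak{o}_L[[T]])$, then $R=\mathfrak{o}_L[[T]]$), and let $\mathfrak{p}=(\ell)$ be the prime ideal of height one of $R$ containing $l$. Then $R_{\mathfrak p}$ is a valuation ring of $Z(D)$, the valuation ring of the $\mathfrak{p}$-adic valuation. Let $Z(D)_\wedge$ be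 the completion of $Z(D)$ with respect to it, let $v$ be the valuation of $Z(D)_\wedge$, and put $D_\wedge=Z(D)_\wedge\otimes_{Z(D)}D$. Then $D_\wedge$ is a skew field, and its Schur index $s_{D_\wedge}$, defined by $[D_\wedge:Z(D_\wedge)]=s_{D_\wedge}^2$, is equal to $s_D$. Moreover, $w(d)=\frac{1}{s_{D_\wedge}}v(\mathrm{nr}_{D_\wedge/Z(D)_\wedge}(d))$ is a valuation of $D_\wedge$ extending $v$, and its residue skew field $\overline{D_\wedge}=\{w\ge 0\}/\{w>0\}$ is commutative. -/

import Mathlib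

open scoped TensorProduct

noncomputable section

namespace Iwasawa

/-! ### The Iwasawa algebra and its total ring of fractions -/

section IwasawaAlgebra

variable (l : ℕ) [Fact l.Prime] (G : Type*) [Group G] [TopologicalSpace G]

/-- The projection `ℤ_l[G/U] → ℤ_l[G/V]` for open normal subgroups `U ≤ V` of `G`. -/
def transition {U V : OpenNormalSubgroup G} (h : U.toSubgroup ≤ V.toSubgroup) :
    MonoidAlgebra ℤ_[l] (G ⧸ U.toSubgroup) →+* MonoidAlgebra ℤ_[l] (G ⧸ V.toSubgroup) :=
  MonoidAlgebra.mapDomainRingHom ℤ_[l]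
    (QuotientGroup.map U.toSubgroup V.toSubgroup (MonoidHom.id G) h)

/-- The Iwasawa algebra (completed group ring) `ΛG = ℤ_l[[G]]`: the inverse limit of the group
rings `ℤ_l[G/U]` over the open normal subgroups `U` of `G`, as the ring of compatible families. -/
def iwasawaAlgebra : Subring (∀ U : OpenNormalSubgroup G,
    MonoidAlgebra ℤ_[l] (G ⧸ U.toSubgroup)) where
  carrier := {x | ∀ (U V : OpenNormalSubgroup G) (h : U.toSubgroup ≤ V.toSubgroup),
    transition l G h (x U) = x V}
  zero_mem' := fun _ _ _ => map_zero _
  one_mem' := fun _ _ _ => map_one _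
  add_mem' := fun {x y} hx hy U V h => by
    simp only [Pi.add_apply, map_add, hx U V h, hy U V h]
  mul_mem' := fun {x y} hx hy U V h => by
    simp only [Pi.mul_apply, map_mul, hx U V h, hy U V h]
  neg_mem' := fun {x} hx U V h => by
    simp only [Pi.neg_apply, map_neg, hx U V h]

end IwasawaAlgebra

section Fractions

variable (R : Type*) [Ring R]

/-- The multiplicative set of central non-zero-divisors of a ring. -/
def centralRegular : Submonoid R := Submonoid.center R ⊓ nonZeroDivisors R

instance : OreLocalization.OreSet (centralRegular R) where
  ore_right_cancel r₁ r₂ s h := ⟨s, by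
    rw [← Submonoid.mem_center_iff.1 s.2.1 r₁, ← Submonoid.mem_center_iff.1 s.2.1 r₂, h]⟩
  oreNum r _ := r
  oreDenom _ s := s
  ore_eq r s := (Submonoid.mem_center_iff.1 s.2.1 r).symm

/-- The total ring of fractions of `R` with respect to all central non-zero-divisors. -/
abbrev TotalFractions : Type _ := OreLocalization (centralRegular R) R

end Fractions

/-- `𝒬G = Quot(ℤ_l[[G]])`. -/
abbrev QuotIwasawa (l : ℕ) [Fact l.Prime] (G : Type*) [Group G] [TopologicalSpace G] : Type _ :=
  TotalFractions (iwasawaAlgebra l G)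

/-! ### Wedderburn components and the underlying skew fields -/

/-- `e` is a primitive central idempotent of `Q`. -/
structure IsPrimitiveCentralIdempotent {Q : Type*} [Ring Q] (e : Q) : Prop where
  ne_zero : e ≠ 0
  idem : IsIdempotentElem e
  central : e ∈ Subring.center Q
  primitive : ∀ f : Q, IsIdempotentElem f → f ∈ Subring.center Q → f * e = f → f = 0 ∨ f = e

section Component

variable {R : Type*} [Ring R] {e : TotalFractions R} (he : IsPrimitiveCentralIdempotent e)

/-- The component `A = eQe = Qe` of `Q = TotalFractions R` cut out by the primitive central
idempotent `e`. -/
abbrev Component : Type _ := he.idem.Corner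

/-- Elements coming from the centre of `R` are central in `TotalFractions R`. -/
theorem numerator_comm (c : Subring.center R) (q : TotalFractions R) :
    q * OreLocalization.numeratorRingHom (c : R) =
      OreLocalization.numeratorRingHom (c : R) * q := by
  have hc : ∀ r : R, r * (c : R) = c * r := Subring.mem_center_iff.1 c.2
  obtain ⟨r, s, rfl⟩ : ∃ (r : R) (s : centralRegular R), q = r /ₒ s := by
    induction q using OreLocalization.ind with
    | _ r s => exact ⟨r, s, rfl⟩
  change (r /ₒ s) * ((c : R) /ₒ (1 : centralRegular R)) =
    ((c : R) /ₒ (1 : centralRegular R)) * (r /ₒ s)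
  rw [OreLocalization.oreDiv_mul_char r c s 1 r 1 (by simp),
    OreLocalization.oreDiv_mul_char (c : R) r 1 s c s (by simp [hc])]
  simp [hc]

/-- The homomorphism `c ↦ ec` from the centre of `R` to the centre of the component `A`. -/
def centerToComponent : Subring.center R →+* Subring.center (Component he) where
  toFun c := ⟨⟨e * OreLocalization.numeratorRingHom (c : R), by
      refine (Subsemigroup.mem_corner_iff he.idem).2 ⟨?_, ?_⟩
      · rw [← mul_assoc, he.idem.eq]
      · rw [mul_assoc, ← numerator_comm, ← mul_assoc, he.idem.eq]⟩, by
    refine Subring.mem_center_iff.2 fun a => Subtype.ext ?_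
    change a.1 * (e * OreLocalization.numeratorRingHom (c : R)) =
      e * OreLocalization.numeratorRingHom (c : R) * a.1
    rw [← mul_assoc, mul_assoc e, ← numerator_comm, ← mul_assoc,
      ← Subring.mem_center_iff.1 he.central]⟩
  map_one' := Subtype.ext <| Subtype.ext <| by
    change e * OreLocalization.numeratorRingHom (1 : R) = e
    rw [map_one, mul_one]
  map_zero' := Subtype.ext <| Subtype.ext <| by
    change e * OreLocalization.numeratorRingHom (0 : R) = 0
    rw [map_zero, mul_zero]
  map_add' c d := Subtype.ext <| Subtype.ext <| by
    change e * OreLocalization.numeratorRingHom ((c : R) + d) = e * _ + e * _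
    rw [map_add, mul_add]
  map_mul' c d := Subtype.ext <| Subtype.ext <| by
    change e * OreLocalization.numeratorRingHom ((c : R) * d) = e * _ * (e * _)
    rw [map_mul, ← mul_assoc (e * _) e, mul_assoc e _ e, ← numerator_comm c e, ← mul_assoc e e,
      he.idem.eq, mul_assoc]

variable {D : Type*} [DivisionRing D] {n : ℕ}
  (f : Component he ≃+* Matrix (Fin n) (Fin n) D)

/-- The homomorphism `Z(D) → Z(Mₙ(D))` sending `z` to the corresponding scalar matrix. -/
def centerToScalar (n : ℕ) (D : Type*) [DivisionRing D] :
    Subring.center D →+* Subring.center (Matrix (Fin n) (Fin n) D) :=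
  ((Matrix.scalar (Fin n)).comp (Subring.center D).subtype).codRestrict _ fun z => by
    refine Subring.mem_center_iff.2 fun M => Matrix.ext fun i j => ?_
    have hz : ∀ d : D, d * (z : D) = z * d := Subring.mem_center_iff.1 z.2
    simp [hz]

/-- The integral closure of (the image of) the centre of `R` in `Z(D)`, where `D` is the skew field
underlying the component `A ≅ Mₙ(D)` and `Z(D)` is identified with `Z(A)` by scalar matrices.
For `R = ℤ_l[[G]]` and `Z(D) = Quot(𝔬_L[[T]])` this is the power series ring `𝔬_L[[T]]`. -/
def integralCentre : Subring (Subring.center D) :=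
  (integralClosure (centerToComponent he).range
    (Subring.center (Component he))).toSubring.comap
      ((Subring.centerCongr f.symm).toRingHom.comp (centerToScalar n D))

end Component

/-! ### Completion of a skew field with respect to a valuation of its centre -/

section Completion

variable {D : Type*} [DivisionRing D] (𝒪 : ValuationSubring (Subring.center D))

/-- Scalar multiplications are uniformly continuous, so that the completion of `Z(D)` becomes a
`Z(D)`-algebra. -/
instance : UniformContinuousConstSMul (Subring.center D) (WithVal 𝒪.valuation) where
  uniformContinuous_const_smul c := by
    have h : UniformContinuous fun x : WithVal 𝒪.valuation =>
        (WithVal.toVal 𝒪.valuation c) • x := uniformContinuous_const_smul _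
    exact h

/-- `Z(D)_∧`: the completion of `Z(D)` with respect to the valuation with valuation ring `𝒪`. -/
abbrev CentreCompletion : Type _ := 𝒪.valuation.Completion

/-- `D_∧ = Z(D)_∧ ⊗_{Z(D)} D`. -/
abbrev SkewCompletion : Type _ := CentreCompletion 𝒪 ⊗[Subring.center D] D

end Completion

/-- The ring `B` is a skew field. -/
def IsSkewField (B : Type*) [Ring B] : Prop :=
  Nontrivial B ∧ ∀ x : B, x ≠ 0 → IsUnit x

/-- `s` is the Schur index of the skew field `B`, i.e. `B` has dimension `s ^ 2 < ∞` over its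
centre. -/
def IsSchurIndex (B : Type*) [Ring B] (s : ℕ) : Prop :=
  0 < s ∧ Module.finrank (Subring.center B) B = s ^ 2

/-! ### Residue rings of valuations on skew fields -/

section Residue

variable {B : Type*} [Ring B] {Γ : Type*} [LinearOrderedCommGroupWithZero Γ] (w : Valuation B Γ)

/-- The two-sided ideal of elements of value `< 1` in the valuation ring of `w`
(values are written multiplicatively). -/
def valuationIdeal : TwoSidedIdeal w.integer :=
  TwoSidedIdeal.mk' {x | w (x : B) < 1}
    (by simp)
    (fun {x y} hx hy => w.map_add_lt hx hy)
    (fun {x} hx => by simpa [Valuation.map_neg] using hx)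
    (fun {x y} hy => by
      change w ((x : B) * y) < 1
      rw [map_mul]
      exact (mul_le_of_le_one_left' x.2).trans_lt hy)
    (fun {x y} hx => by
      change w ((x : B) * y) < 1
      rw [map_mul]
      exact (mul_le_of_le_one_right' y.2).trans_lt hx)

/-- The residue ring of `w`: the valuation ring modulo the ideal of elements of value `< 1`. -/
abbrev ResidueRing : Type _ := (valuationIdeal w).ringCon.Quotient

end Residue

end Iwasawa

end

/-! Let Λ = ℤ_l[[X]]. Some lift γ of a topological generator of G/H has a central power γ^(l^m), and
X ↦ γ^(l^m) - 1 makes ℤ_l[[G]] free over Λ on the elements hγ^a with h ∈ H and a < l^m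
(`exists_isIwasawaTower`, `exists_sum_powerSeriesHom`). Hence A ≅ Mₙ(D) is spanned over F = Quot(Λ)
by the image of the abstract group ⟨γ⟩H.

Clifford theory then makes D explicit. Among the idempotents ε whose corner εAε is spanned by a
subgroup S commuting with ε, take one of minimal rank. Every finite commutative normal subgroup of
the image of S spans a field, otherwise a smaller corner exists, so it is cyclic. As l is odd, a
finite normal l-subgroup all of whose commutative normal subgroups are cyclic is itself cyclic; so H
∩ S acts through one element ζ of l-power order (`isCyclic_of_forall_normal_isCyclic`,
`exists_isCornerPair_cyclic`).

Let W be the order spanned by S over Λ localized at (l). The element π = ζ - 1, or π = l if ζ = 1,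
is normal in W and some power of it is divisible by l. Modulo π the group H ∩ S becomes trivial, and
W/πW is generated over 𝔽_l((T)) by one element x with x^(l^j) = 1 + T, that is, by an l^j-th root x
- 1 of T. So W/πW is a commutative field, W is a noncommutative discrete valuation ring, and the
corner is a skew field (`exists_valuation_of_span`). A corner of Mₙ(D) which is a skew field is
isomorphic to D (`exists_algEquiv_corner`), so D carries a discrete valuation with commutative
residue field whose ring is finite over the valuation ring of the centre.

Finiteness carries this over to the completion. The valuation ring of D is a free lattice, and every
nonzero x ∈ D_∧ can be written d(1 + lz) with 0 ≠ d ∈ D and z in the completed lattice. Norms of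
elements 1 + lz are units, so no nonzero x has norm zero, and the elements of integral norm are
exactly the lattice (`isSkewField_and_exists_valuation`). The norm used is that of the regular
representation, the s-th power of the reduced norm; the resulting valuation is equivalent to the
normalized one. Equality of Schur indices holds because base change preserves dimension and turns
the centre into Z(D)_∧. Finally, going-down identifies the valuation ring of Z(D) with R_𝔭
(`toSubring_eq_ofPrime`). -/

namespace Iwasawa

/-! ### Finite normal l-subgroups with cyclic commutative normal subgroups -/

section PGroup

variable {p : ℕ} [hp : Fact p.Prime] {P : Type*} [Group P]

/-- A nontrivial finite normal `p`-subgroup contains a central element of order `p`, if the ambient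
group is a `p`-group modulo its centre. -/
theorem exists_mem_center_of_normal_pGroup (N : Subgroup P) [N.Normal] [Finite N]
    (hN : IsPGroup p N) (hP : ∀ g : P, ∃ k : ℕ, g ^ p ^ k ∈ Subgroup.center P) (hne : N ≠ ⊥) :
    ∃ x ∈ N, x ≠ 1 ∧ x ^ p = 1 ∧ x ∈ Subgroup.center P := by
  let Q : Subgroup (MulAut N) := (MulAut.conjNormal : P →* MulAut N).range
  -- Central elements act trivially by conjugation, so the acting group is a `p`-group although the
  -- ambient group need not be; the fixed point count modulo `p` then applies.
  have hQ : IsPGroup p Q := by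
    rintro ⟨_, g, rfl⟩
    obtain ⟨k, hk⟩ := hP g
    refine ⟨k, Subtype.ext ?_⟩
    change MulAut.conjNormal g ^ p ^ k = 1
    rw [← map_pow]
    ext n
    rw [MulAut.conjNormal_apply, ← Subgroup.mem_center_iff.1 hk, mul_inv_cancel_right]
    rfl
  have hcard : p ∣ Nat.card N := by
    rcases hN.card_eq_or_dvd with h | h
    · exact absurd (Subgroup.card_eq_one.1 h) hne
    · exact h
  have h1 : (1 : N) ∈ MulAction.fixedPoints Q N := fun q => map_one q.1
  obtain ⟨x, hx, hx1⟩ := hQ.exists_fixed_point_of_prime_dvd_card_of_fixed_point N hcard h1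
  have hxc : (x : P) ∈ Subgroup.center P := by
    refine Subgroup.mem_center_iff.2 fun g => ?_
    have := congrArg (Subtype.val) (hx ⟨MulAut.conjNormal g, g, rfl⟩)
    change ((MulAut.conjNormal g x : N) : P) = x at this
    rw [MulAut.conjNormal_apply] at this
    exact mul_inv_eq_iff_eq_mul.1 this
  obtain ⟨k, hk⟩ := IsPGroup.iff_orderOf.1 hN x
  rcases k with _ | k
  · rw [pow_zero, orderOf_eq_one_iff] at hk
    exact absurd hk.symm hx1
  · refine ⟨(x : P) ^ p ^ k, pow_mem x.2 _, fun h => ?_, ?_, pow_mem hxc _⟩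
    · have : x ^ p ^ k = 1 := Subtype.ext h
      have h2 := orderOf_dvd_of_pow_eq_one this
      rw [hk] at h2
      exact absurd (Nat.le_of_dvd (pow_pos hp.1.pos _) h2)
        (not_le.2 (Nat.pow_lt_pow_right hp.1.one_lt (Nat.lt_succ_self k)))
    · rw [← pow_mul, ← pow_succ, ← hk]
      exact_mod_cast congrArg Subtype.val (pow_orderOf_eq_one x)

/-- If `b * x = t * (x * b)` with `t` commuting with `x` and `b`, then
`(x * b) ^ n = x ^ n * b ^ n * t ^ (n choose 2)`. -/
theorem mul_pow_of_commutator {x b t : P} (h : b * x = t * (x * b)) (hx : Commute t x)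
    (hb : Commute t b) (n : ℕ) : (x * b) ^ n = x ^ n * b ^ n * t ^ n.choose 2 := by
  have key : ∀ n : ℕ, b ^ n * x = t ^ n * (x * b ^ n) := by
    intro n
    induction n with
    | zero => simp
    | succ n ih =>
      calc b ^ (n + 1) * x = b ^ n * (b * x) := by rw [pow_succ, mul_assoc]
        _ = b ^ n * t * (x * b) := by rw [h, mul_assoc]
        _ = t * (b ^ n * x) * b := by rw [(hb.pow_right n).eq.symm]; simp only [mul_assoc]
        _ = t ^ (n + 1) * (x * b ^ (n + 1)) := by
          rw [ih, pow_succ' t, pow_succ b]; simp only [mul_assoc]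
  induction n with
  | zero => simp
  | succ n ih =>
    have c1 : Commute (t ^ n.choose 2) (x * b) := (hx.mul_right hb).pow_left _
    calc (x * b) ^ (n + 1) = x ^ n * b ^ n * t ^ n.choose 2 * (x * b) := by rw [pow_succ, ih]
      _ = x ^ n * (b ^ n * x) * b * t ^ n.choose 2 := by
        rw [mul_assoc _ _ (x * b), c1.eq]; simp only [mul_assoc]
      _ = x ^ n * (t ^ n * (x * b ^ n)) * b * t ^ n.choose 2 := by rw [key]
      _ = x ^ n * (x * b ^ n * t ^ n) * b * t ^ n.choose 2 := by
        rw [((hx.mul_right (hb.pow_right n)).pow_left n).eq]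
      _ = x ^ n * x * b ^ n * (t ^ n * b) * t ^ n.choose 2 := by simp only [mul_assoc]
      _ = x ^ (n + 1) * b ^ (n + 1) * t ^ (n + 1).choose 2 := by
        rw [(hb.pow_left n).eq, Nat.choose_succ_succ n 1, Nat.succ_eq_add_one, Nat.choose_one_right, pow_add t,
          pow_succ x n, pow_succ b n]
        simp only [mul_assoc, Nat.reduceAdd]

/-- In the quotient by a normal subgroup `M`, a normal finite `p`-subgroup not contained in `M`
has a nontrivial central element of order `p`. -/
theorem exists_mem_center_quotient (M : Subgroup P) [M.Normal] (C : Subgroup P) [C.Normal]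
    [Finite C] (hC : IsPGroup p C) (hP : ∀ g : P, ∃ k : ℕ, g ^ p ^ k ∈ Subgroup.center P)
    (hCM : ¬ C ≤ M) :
    ∃ x ∈ C, x ∉ M ∧ x ^ p ∈ M ∧ ∀ g : P, x⁻¹ * (g * x * g⁻¹) ∈ M := by
  have hn : (C.map (QuotientGroup.mk' M)).Normal :=
    Subgroup.Normal.map inferInstance _ (QuotientGroup.mk'_surjective M)
  have hf : Finite (C.map (QuotientGroup.mk' M)) :=
    Set.Finite.image _ (Set.toFinite (C : Set P))
  obtain ⟨y, ⟨x, hx, rfl⟩, h1, h2, h3⟩ :=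
    exists_mem_center_of_normal_pGroup (C.map (QuotientGroup.mk' M)) (hC.map _)
      (fun g => by
        obtain ⟨g, rfl⟩ := QuotientGroup.mk'_surjective M g
        obtain ⟨k, hk⟩ := hP g
        refine ⟨k, Subgroup.mem_center_iff.2 fun q => ?_⟩
        obtain ⟨q, rfl⟩ := QuotientGroup.mk'_surjective M q
        rw [← map_pow, ← map_mul, ← map_mul, Subgroup.mem_center_iff.1 hk])
      (fun h => hCM fun c hc => by
        have : QuotientGroup.mk' M c ∈ C.map (QuotientGroup.mk' M) := ⟨c, hc, rfl⟩
        rw [h, Subgroup.mem_bot] at this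
        exact (QuotientGroup.eq_one_iff c).1 this)
  refine ⟨x, hx, fun h => h1 ((QuotientGroup.eq_one_iff x).2 h),
    (QuotientGroup.eq_one_iff _).1 (by rw [← h2]; rfl), fun g => (QuotientGroup.eq_one_iff _).1 ?_⟩
  have := Subgroup.mem_center_iff.1 h3 (QuotientGroup.mk' M g)
  change (QuotientGroup.mk' M) (x⁻¹ * (g * x * g⁻¹)) = 1
  rw [map_mul, map_mul, map_mul, map_inv, map_inv, this]
  group

/-- A cyclic subgroup has at most one subgroup of order `p`. -/
theorem mem_zpowers_of_isCyclic (E : Subgroup P) [Finite E] [IsCyclic E] {ω y : P} (hω : ω ∈ E)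
    (hωp : orderOf ω = p) (hy : y ∈ E) (hyp : y ^ p = 1) : y ∈ Subgroup.zpowers ω := by
  classical
  have := Fintype.ofFinite E
  let ω' : E := ⟨ω, hω⟩
  have hω' : orderOf ω' = p := by rw [← hωp, ← Subgroup.orderOf_coe]
  let S : Finset E := Finset.univ.filter fun z : E => z ^ p = 1
  -- The equation `z ^ p = 1` has at most `p` solutions in a cyclic group, and the powers of `ω`
  -- already supply `p` of them.
  have hS : S.card ≤ p := IsCyclic.card_pow_eq_one_le hp.1.pos
  have hsub : (Finset.univ.filter fun z : E => z ∈ Subgroup.zpowers ω') ⊆ S := by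
    intro z hz
    obtain ⟨i, rfl⟩ := Subgroup.mem_zpowers_iff.1 (Finset.mem_filter.1 hz).2
    refine Finset.mem_filter.2 ⟨Finset.mem_univ _, ?_⟩
    rw [← zpow_natCast, ← zpow_mul, mul_comm, zpow_mul, zpow_natCast, ← hω', pow_orderOf_eq_one,
      one_zpow]
  have hcard : (Finset.univ.filter fun z : E => z ∈ Subgroup.zpowers ω').card = p := by
    rw [← hω', ← Nat.card_zpowers, Nat.card_eq_fintype_card, Fintype.card_subtype]
  have heq := Finset.eq_of_subset_of_card_le hsub (by rw [hcard]; exact hS)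
  have hyS : (⟨y, hy⟩ : E) ∈ S :=
    Finset.mem_filter.2 ⟨Finset.mem_univ _, Subtype.ext (by simpa using hyp)⟩
  rw [← heq] at hyS
  obtain ⟨i, hi⟩ := Subgroup.mem_zpowers_iff.1 (Finset.mem_filter.1 hyS).2
  exact Subgroup.mem_zpowers_iff.2 ⟨i, by simpa [ω'] using congrArg Subtype.val hi⟩

/-- Fermat gives the first divisibility; then, for odd `p`, lifting the exponent says that raising
`r` to the `p`-th power adds exactly one to the `p`-adic valuation of `r - 1`. For `p = 2`, `r =
-1`, `k = 3` this fails. It controls an automorphism `a ↦ a ^ r` of order dividing `p` of a cyclic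
`p`-group. -/
theorem dvd_mul_sub_one_of_dvd_pow_sub_one (hp2 : p ≠ 2) {r : ℤ} {k : ℕ} (hk : k ≠ 0)
    (h : (p : ℤ) ^ k ∣ r ^ p - 1) : (p : ℤ) ∣ r - 1 ∧ (p : ℤ) ^ k ∣ p * (r - 1) := by
  have hpp : Prime (p : ℤ) := Nat.prime_iff_prime_int.1 hp.1
  have h1 : (p : ℤ) ∣ r - 1 := by
    have h2 : (p : ℤ) ∣ r ^ p - 1 := (dvd_pow_self _ hk).trans h
    rw [← ZMod.intCast_zmod_eq_zero_iff_dvd] at h2 ⊢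
    push_cast at h2 ⊢
    rwa [ZMod.pow_card] at h2
  refine ⟨h1, ?_⟩
  have hr : ¬ (p : ℤ) ∣ r := fun h2 =>
    hpp.not_isUnit (isUnit_of_dvd_one (by simpa using dvd_sub h2 h1))
  have h3 := Int.emultiplicity_pow_sub_pow hp.1 (hp.1.odd_of_ne_two hp2) h1 hr p
  rw [one_pow] at h3
  refine pow_dvd_of_le_emultiplicity ?_
  rw [emultiplicity_mul hpp, add_comm, Int.natCast_emultiplicity p p, ← h3]
  exact le_emultiplicity_of_pow_dvd h

/-- Let `p` be an odd prime and `N` a finite normal `p`-subgroup of a group `P` which is a `p`-group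
modulo its centre. If all commutative normal subgroups of `P` contained in `N` are cyclic, then `N`
is cyclic. -/
theorem isCyclic_of_forall_normal_isCyclic (hp2 : p ≠ 2) (N : Subgroup P) [N.Normal] [Finite N]
    (hN : IsPGroup p N) (hP : ∀ g : P, ∃ k : ℕ, g ^ p ^ k ∈ Subgroup.center P)
    (hcyc : ∀ M : Subgroup P, M ≤ N → M.Normal → (∀ a ∈ M, ∀ b ∈ M, a * b = b * a) → IsCyclic M) :
    IsCyclic N := by
  have hfin : {M : Subgroup P | M ≤ N ∧ M.Normal ∧ ∀ a ∈ M, ∀ b ∈ M, a * b = b * a}.Finite := by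
    refine Set.Finite.subset ((Set.toFinite (N : Set P)).finite_subsets.preimage
      (SetLike.coe_injective.injOn (f := fun M : Subgroup P => (M : Set P)))) fun M hM => hM.1
  -- A maximal commutative normal subgroup `M` inside `N` is cyclic. If `N` were larger, a normal
  -- subgroup of type (p, p) could be built in `N`, against `hcyc`.
  obtain ⟨M, hM⟩ := hfin.exists_maximal ⟨⊥, bot_le, inferInstance, by simp⟩
  obtain ⟨⟨hMN, hMn, hMc⟩, hmax⟩ := hM
  have hMcyc := hcyc M hMN hMn hMc
  have hMfin : Finite M := Set.Finite.subset (Set.toFinite (N : Set P)) hMN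
  by_cases hNM : N ≤ M
  · rwa [le_antisymm hNM hMN]
  exfalso
  -- `M` is self-centralizing in `N`: otherwise an element centralizing `M`, outside `M` and central
  -- modulo `M`, could be adjoined to `M`.
  have hCM : N ⊓ Subgroup.centralizer (M : Set P) ≤ M := by
    by_contra hCM
    have : Finite (N ⊓ Subgroup.centralizer (M : Set P) : Subgroup P) :=
      Set.Finite.subset (Set.toFinite (N : Set P)) inf_le_left
    obtain ⟨x, ⟨hxN, hxC⟩, hxM, -, hxc⟩ := exists_mem_center_quotient M
      (N ⊓ Subgroup.centralizer (M : Set P)) (hN.to_le inf_le_left) hP hCM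
    have hxC : ∀ m ∈ M, Commute m x := fun m hm => Subgroup.mem_centralizer_iff.1 hxC m hm
    have hmem : ∀ {z}, z ∈ M ⊔ Subgroup.zpowers x ↔ ∃ m ∈ M, ∃ i : ℤ, m * x ^ i = z := by
      intro z
      rw [Subgroup.mem_sup_of_normal_left]
      simp [Subgroup.mem_zpowers_iff]
    refine hxM (hmax (y := M ⊔ Subgroup.zpowers x)
      ⟨sup_le hMN (Subgroup.zpowers_le.2 hxN), ⟨?_⟩, ?_⟩ le_sup_left
      (Subgroup.mem_sup_right (Subgroup.mem_zpowers x)))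
    · rintro _ hz g
      obtain ⟨m, hm, i, rfl⟩ := hmem.1 hz
      have h1 : g * x * g⁻¹ ∈ M ⊔ Subgroup.zpowers x := by
        have := mul_mem (Subgroup.mem_sup_right (Subgroup.mem_zpowers x))
          (Subgroup.mem_sup_left (T := Subgroup.zpowers x) (hxc g))
        rwa [mul_inv_cancel_left] at this
      have h2 : g * (m * x ^ i) * g⁻¹ = (g * m * g⁻¹) * (g * x * g⁻¹) ^ i := by
        rw [conj_zpow]; group
      rw [h2]
      exact mul_mem (Subgroup.mem_sup_left (hMn.conj_mem m hm g)) (zpow_mem h1 i)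
    · rintro _ hz _ hw
      obtain ⟨m, hm, i, rfl⟩ := hmem.1 hz
      obtain ⟨m', hm', j, rfl⟩ := hmem.1 hw
      have c1 : Commute m m' := hMc m hm m' hm'
      exact ((c1.mul_right ((hxC m hm).zpow_right j)).mul_left
        (((hxC m' hm').symm.zpow_left i).mul_right ((Commute.refl x).zpow_zpow i j))).eq
  obtain ⟨x, hxN, hxM, hxp, hxc⟩ := exists_mem_center_quotient M N hN hP hNM
  obtain ⟨⟨a, ha⟩, hgen⟩ := hMcyc.exists_zpow_surjective
  have hgen : ∀ m ∈ M, ∃ i : ℤ, a ^ i = m := fun m hm => by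
    obtain ⟨i, hi⟩ := hgen ⟨m, hm⟩
    exact ⟨i, congrArg Subtype.val hi⟩
  obtain ⟨r, hr⟩ := hgen _ (hMn.conj_mem a ha x)
  obtain ⟨k, hk⟩ := IsPGroup.iff_orderOf.1 (hN.to_le hMN) ⟨a, ha⟩
  rw [← Subgroup.orderOf_coe] at hk
  change orderOf a = p ^ k at hk
  have hxa : x * a * x⁻¹ ≠ a := fun h => hxM (hCM ⟨hxN, Subgroup.mem_centralizer_iff.2 fun m hm => by
    obtain ⟨i, rfl⟩ := hgen m hm
    have : Commute x a := mul_inv_eq_iff_eq_mul.1 h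
    exact (this.zpow_right i).eq.symm⟩)
  have hk0 : k ≠ 0 := by
    rintro rfl
    rw [pow_zero, orderOf_eq_one_iff] at hk
    simp [hk] at hxa
  have hconj : ∀ n : ℕ, x ^ n * a * (x ^ n)⁻¹ = a ^ (r ^ n) := by
    intro n
    induction n with
    | zero => simp
    | succ n ih =>
      have : x ^ (n + 1) * a * (x ^ (n + 1))⁻¹ = x * (x ^ n * a * (x ^ n)⁻¹) * x⁻¹ := by
        rw [pow_succ']; group
      rw [this, ih, ← conj_zpow, ← hr, ← zpow_mul, pow_succ']
  have hrp : (p : ℤ) ^ k ∣ r ^ p - 1 := by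
    have h1 := hconj p
    rw [hMc _ hxp a ha, mul_inv_cancel_right] at h1
    have h2 : a ^ (r ^ p - 1) = 1 := by rw [zpow_sub, ← h1]; simp
    have h3 := orderOf_dvd_iff_zpow_eq_one.2 h2
    rw [hk] at h3
    exact_mod_cast h3
  obtain ⟨hr1, hr2⟩ := dvd_mul_sub_one_of_dvd_pow_sub_one hp2 hk0 hrp
  -- The commutator of `x` with the generator `a` of `M`. It is nontrivial because `M` is
  -- self-centralizing, and of order `p` by lifting the exponent.
  set ω := a ^ (r - 1) with hω
  have hωM : ω ∈ M := zpow_mem ha _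
  have hxω : x * a = ω * a * x := by
    rw [hω, ← zpow_add_one, sub_add_cancel, hr]; group
  have hω1 : ω ≠ 1 := fun h => hxa (by rw [hxω, h]; group)
  have hωp : ω ^ p = 1 := by
    rw [hω, ← zpow_natCast, ← zpow_mul, mul_comm]
    refine orderOf_dvd_iff_zpow_eq_one.1 ?_
    rw [hk]; exact_mod_cast hr2
  have hωo : orderOf ω = p := orderOf_eq_prime hωp hω1
  have hωx : Commute ω x := by
    have h1 : x * ω * x⁻¹ = ω := by
      have h2 : ω ^ r = ω * ω ^ (r - 1) := by rw [← zpow_one_add, add_sub_cancel]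
      rw [hω, ← conj_zpow, ← hr, ← zpow_mul, mul_comm r, zpow_mul, ← hω, h2]
      rw [orderOf_dvd_iff_zpow_eq_one.1 (by rw [hωo]; exact hr1), mul_one]
    exact (mul_inv_eq_iff_eq_mul.1 h1).symm
  have hωa : Commute ω a := hMc _ hωM _ ha
  have hcomm : ∀ i : ℤ, a ^ i * x = ω ^ (-i) * (x * a ^ i) := by
    intro i
    have h1 : x * a * x⁻¹ = ω * a := by rw [hxω]; group
    have h2 : x * a ^ i * x⁻¹ = ω ^ i * a ^ i := by rw [← conj_zpow, h1, hωa.mul_zpow]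
    rw [mul_inv_eq_iff_eq_mul.1 h2]
    group
  have hpch : p ∣ p.choose 2 := hp.1.dvd_choose_self two_ne_zero
    (lt_of_le_of_ne hp.1.two_le (Ne.symm hp2))
  have htp : ∀ i : ℤ, (ω ^ i) ^ p.choose 2 = 1 := by
    intro i
    obtain ⟨c, hc⟩ := hpch
    rw [hc, pow_mul, ← zpow_natCast (ω ^ i), ← zpow_mul, mul_comm, zpow_mul, zpow_natCast, hωp]
    simp
  obtain ⟨i, hi⟩ := hgen _ hxp
  -- `x ^ p = a ^ i` commutes with `x`, while commuting `a ^ i` past `x` costs `ω ^ (-i)`. Hence `x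
  -- ^ p` is a `p`-th power in `M` and can be cancelled by a factor `b ∈ M`.
  have hpi : (p : ℤ) ∣ i := by
    have h1 := hcomm i
    rw [hi, ← pow_succ, ← pow_succ', right_eq_mul] at h1
    have h2 := orderOf_dvd_iff_zpow_eq_one.2 h1
    rw [hωo] at h2
    exact (dvd_neg.1 h2)
  obtain ⟨j, rfl⟩ := hpi
  set b := a ^ (-j) with hb
  have hbM : b ∈ M := zpow_mem ha _
  -- The correction term is a power of `ω` raised to `p.choose 2`, which is trivial since `p` is
  -- odd.
  have hyp : (x * b) ^ p = 1 := by
    rw [mul_pow_of_commutator (hcomm (-j)) (hωx.zpow_left _)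
      ((hωa.zpow_zpow _ _)), htp, mul_one, ← hi, ← zpow_natCast, ← zpow_mul, ← zpow_add]
    simp [mul_comm]
  have hyM : x * b ∉ M := fun h => hxM ((mul_mem_cancel_right hbM).1 h)
  have hyc : ∀ g : P, (x * b)⁻¹ * (g * (x * b) * g⁻¹) ∈ M := by
    intro g
    have h1 : (x * b)⁻¹ * (g * (x * b) * g⁻¹) =
        b⁻¹ * (x⁻¹ * (g * x * g⁻¹)) * (g * b * g⁻¹) := by group
    rw [h1]
    exact mul_mem (mul_mem (inv_mem hbM) (hxc g)) (hMn.conj_mem b hbM g)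
  have hωy : Commute ω (x * b) := hωx.mul_right (hMc _ hωM _ hbM)
  have hconjω : ∀ g : P, g * ω * g⁻¹ ∈ Subgroup.zpowers ω := fun g =>
    mem_zpowers_of_isCyclic M hωM hωo (hMn.conj_mem _ hωM g) (by rw [conj_pow, hωp]; simp)
  -- Both `x * b` and its conjugate are killed by `p`, so the power formula shows that their
  -- quotient in `M` is too; the cyclic group `M` has only one subgroup of order `p`.
  have hconjy : ∀ g : P, (x * b)⁻¹ * (g * (x * b) * g⁻¹) ∈ Subgroup.zpowers ω := by
    intro g
    refine mem_zpowers_of_isCyclic M hωM hωo (hyc g) ?_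
    obtain ⟨i, hi⟩ := hgen _ (hyc g)
    have h1 : a ^ i * (x * b) = ω ^ (-i) * (x * b * a ^ i) := by
      rw [← mul_assoc, hcomm, mul_assoc, mul_assoc, mul_assoc,
        hMc (a ^ i) (zpow_mem ha i) b hbM]
    have h2 := mul_pow_of_commutator h1 (hωy.zpow_left _) (hωa.zpow_zpow _ _) p
    rw [htp, mul_one, hyp, one_mul, hi, mul_inv_cancel_left, conj_pow, hyp] at h2
    rw [← h2]; simp
  set E := Subgroup.closure ({ω, x * b} : Set P) with hE
  have hωE : ω ∈ E := Subgroup.subset_closure (by simp)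
  have hyE : x * b ∈ E := Subgroup.subset_closure (by simp)
  have hωE' : Subgroup.zpowers ω ≤ E := Subgroup.zpowers_le.2 hωE
  have hEN : E ≤ N := by
    rw [hE, Subgroup.closure_le]
    rintro z (rfl | rfl)
    · exact hMN hωM
    · exact mul_mem hxN (hMN hbM)
  have hEn : E.Normal := by
    refine ⟨fun n hn g => ?_⟩
    have h1 : E ≤ E.comap (MulAut.conj g).toMonoidHom := by
      conv_lhs => rw [hE]
      rw [Subgroup.closure_le]
      rintro z (rfl | rfl)
      · exact hωE' (hconjω g)
      · have := mul_mem hyE (hωE' (hconjy g))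
        rwa [mul_inv_cancel_left] at this
    exact h1 hn
  have hEc : ∀ u ∈ E, ∀ v ∈ E, u * v = v * u := by
    have h1 : E ≤ Subgroup.centralizer (E : Set P) := by
      rw [hE, Subgroup.centralizer_closure, Subgroup.closure_le]
      rintro z (rfl | rfl) <;> refine Subgroup.mem_centralizer_iff.2 ?_ <;> rintro w (rfl | rfl)
      exacts [rfl, hωy.eq.symm, hωy.eq, rfl]
    exact fun u hu v hv => Subgroup.mem_centralizer_iff.1 (h1 hv) u hu
  have hEcyc := hcyc E hEN hEn hEc
  have hEfin : Finite E := Set.Finite.subset (Set.toFinite (N : Set P)) hEN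
  -- In a cyclic `E` the element `x * b` would be a power of `ω`, hence in `M`.
  obtain ⟨i, hi⟩ := Subgroup.mem_zpowers_iff.1 (mem_zpowers_of_isCyclic E hωE hωo hyE hyp)
  exact hyM (hi ▸ zpow_mem hωM i)

end PGroup

end Iwasawa

namespace Iwasawa

/-! ### Corners of an algebra as algebras -/

section Corner

variable {F A : Type*} [CommRing F] [Ring A] [Algebra F A] {ε : A} (hε : IsIdempotentElem ε)

theorem smul_mem_corner (r : F) (x : hε.Corner) : r • x.1 ∈ Subsemigroup.corner ε := by
  obtain ⟨h1, h2⟩ := (Subsemigroup.mem_corner_iff hε).1 x.2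
  exact (Subsemigroup.mem_corner_iff hε).2 ⟨by rw [mul_smul_comm, h1], by rw [smul_mul_assoc, h2]⟩

/-- The inclusion of a corner, as an additive homomorphism. -/
def cornerVal : hε.Corner →+ A where
  toFun x := x.1
  map_zero' := rfl
  map_add' _ _ := rfl

instance cornerSMul : SMul F hε.Corner := ⟨fun r x => ⟨r • x.1, smul_mem_corner hε r x⟩⟩

instance cornerModule : Module F hε.Corner :=
  Function.Injective.module F (cornerVal hε) Subtype.val_injective fun _ _ => rfl

instance cornerAlgebra : Algebra F hε.Corner :=
  Algebra.ofModule (fun r x y => Subtype.ext (smul_mul_assoc r x.1 y.1))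
    (fun r x y => Subtype.ext (mul_smul_comm r x.1 y.1))

theorem corner_coe_algebraMap (r : F) : (algebraMap F hε.Corner r).1 = r • ε := by
  rw [Algebra.algebraMap_eq_smul_one]; rfl

/-- The inclusion of a corner, as a linear map. -/
def cornerValₗ : hε.Corner →ₗ[F] A where
  toFun x := x.1
  map_add' _ _ := rfl
  map_smul' _ _ := rfl

end Corner

theorem exists_minimal_image {α : Type*} (d : α → ℕ) (Q : α → Prop) (h : ∃ a, Q a) :
    ∃ a, Q a ∧ ∀ b, Q b → d a ≤ d b := by
  obtain ⟨a, ha, hmin⟩ := (measure d).wf.has_min {a | Q a} h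
  exact ⟨a, ha, fun b hb => not_lt.1 (hmin b hb)⟩

/-! ### Clifford theory: minimal corners spanned by a subgroup -/

section Idempotents

variable {F : Type*} [Field F]

/-- In a commutative von Neumann regular subalgebra of a finite-dimensional algebra, a nonzero
non-unit gives rise to a nontrivial primitive idempotent. -/
theorem exists_primitive_idempotent {B : Type*} [Ring B] [Algebra F B] [FiniteDimensional F B]
    (R : Subalgebra F B) (hcomm : ∀ x ∈ R, ∀ y ∈ R, x * y = y * x)
    (hreg : ∀ x ∈ R, ∃ y ∈ R, x * y * x = x) {x : B} (hxR : x ∈ R) (hx : x ≠ 0)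
    (hxu : ∀ y ∈ R, x * y ≠ 1) :
    ∃ η ∈ R, η * η = η ∧ η ≠ 0 ∧ η ≠ 1 ∧ ∀ η' ∈ R, η' * η' = η' → η * η' = 0 ∨ η * η' = η := by
  obtain ⟨y, hyR, hxy⟩ := hreg x hxR
  -- The dimension of `ηB` measures idempotents; one of least positive dimension in `R` is
  -- primitive.
  let d : B → ℕ := fun η => Module.finrank F (LinearMap.range (LinearMap.mulLeft F η))
  obtain ⟨η, ⟨hηR, hηi, hη0⟩, hmin⟩ := exists_minimal_image d
    (fun η => η ∈ R ∧ η * η = η ∧ η ≠ 0)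
    ⟨x * y, mul_mem hxR hyR, by rw [← mul_assoc, hxy], fun h => hx (by rw [← hxy, h, zero_mul])⟩
  have hprim : ∀ η' ∈ R, η' * η' = η' → η * η' = 0 ∨ η * η' = η := by
    intro η' hη'R hη'
    by_cases h0 : η * η' = 0
    · exact Or.inl h0
    refine Or.inr ?_
    have hle : LinearMap.range (LinearMap.mulLeft F (η * η')) ≤
        LinearMap.range (LinearMap.mulLeft F η) := by
      rintro _ ⟨z, rfl⟩
      exact ⟨η' * z, by simp⟩
    have hid : η * η' * (η * η') = η * η' := by
      rw [mul_assoc, ← mul_assoc η', hcomm η' hη'R η hηR, mul_assoc η, hη', ← mul_assoc, hηi]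
    have heq := Submodule.eq_of_le_of_finrank_le hle
      (hmin (η * η') ⟨mul_mem hηR hη'R, hid, h0⟩)
    have hmem : η ∈ LinearMap.range (LinearMap.mulLeft F (η * η')) := by
      rw [heq]; exact ⟨1, by simp⟩
    obtain ⟨z, hz⟩ := hmem
    have hz : η * η' * z = η := hz
    calc η * η' = η * η' * η := by
          rw [mul_assoc, hcomm η' hη'R η hηR, ← mul_assoc, hηi]
      _ = η * η' * (η * η' * z) := by rw [hz]
      _ = η := by rw [← mul_assoc, hid, hz]
  refine ⟨η, hηR, hηi, hη0, fun h1 => ?_, hprim⟩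
  -- Were `1` primitive, the idempotent `x * y` would be `0` or `1`, so `x` would be zero or
  -- invertible in `R`.
  rcases hprim (x * y) (mul_mem hxR hyR) (by rw [← mul_assoc, hxy]) with h | h <;>
    rw [h1, one_mul] at h
  · exact hx (by rw [← hxy, h, zero_mul])
  · exact hxu y hyR h

/-- The commutative group algebra of a finite group is von Neumann regular in characteristic
zero. -/
theorem monoidAlgebra_regular [CharZero F] (M : Type*) [CommGroup M] [Finite M]
    (x : MonoidAlgebra F M) : ∃ y, x * y * x = x := by
  have : Fintype M := Fintype.ofFinite M
  have : NeZero (Nat.card M : F) := ⟨Nat.cast_ne_zero.2 Nat.card_pos.ne'⟩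
  -- By Maschke the group algebra is semisimple, so the ideal of `x` is generated by an idempotent;
  -- writing this idempotent as `y * x` gives the quasi-inverse `y`.
  obtain ⟨e, he, hspan⟩ := IsSemisimpleRing.ideal_eq_span_idempotent (Ideal.span {x})
  have hxe : x ∈ Ideal.span {e} := hspan ▸ Ideal.mem_span_singleton_self x
  have hex : e ∈ Ideal.span {x} := hspan ▸ Ideal.mem_span_singleton_self e
  obtain ⟨y, rfl⟩ := Ideal.mem_span_singleton'.1 hex
  obtain ⟨z, hz⟩ := Ideal.mem_span_singleton'.1 hxe
  refine ⟨y, ?_⟩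
  calc x * y * x = y * x * x := by rw [mul_comm x y]
    _ = y * x * (z * (y * x)) := by rw [hz]
    _ = z * ((y * x) * (y * x)) := by ring
    _ = z * (y * x) := by rw [he.eq]
    _ = x := hz

variable {A : Type*} [Ring A] [Algebra F A] {G : Type*} [Group G] (ρ : G →* A)

/-- The subgroup `S` and the nonzero idempotent `ε` commute, `S` contains all elements acting
centrally, and the corner cut out by `ε` is spanned by the image of `S`. -/
structure IsCornerPair (ε : A) (S : Subgroup G) : Prop where
  ne_zero : ε ≠ 0
  idem : IsIdempotentElem ε
  comm : ∀ s ∈ S, ρ s * ε = ε * ρ s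
  -- This keeps the central power of `γ` in `S` however far the corner shrinks.
  central : ∀ z : G, (∀ a : A, ρ z * a = a * ρ z) → z ∈ S
  span : ∀ a : A, ε * a * ε ∈ Submodule.span F ((fun s => ε * ρ s) '' (S : Set G))

variable {ρ}

namespace IsCornerPair

variable {ε : A} {S : Subgroup G} (h : IsCornerPair (F := F) ρ ε S)


/-- The representation of `S` in the corner. -/
def hom : S →* h.idem.Corner where
  toFun s := ⟨ε * ρ s, (Subsemigroup.mem_corner_iff h.idem).2
    ⟨by rw [← mul_assoc, h.idem.eq], by rw [mul_assoc, h.comm _ s.2, ← mul_assoc, h.idem.eq]⟩⟩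
  map_one' := Subtype.ext (by change ε * ρ 1 = ε; rw [map_one, mul_one])
  map_mul' s t := Subtype.ext (by
    change ε * ρ (s * t : G) = ε * ρ s * (ε * ρ t)
    rw [map_mul, mul_assoc ε, ← mul_assoc (ρ (s : G)) ε, h.comm _ s.2, ← mul_assoc, ← mul_assoc,
      ← mul_assoc, h.idem.eq])

theorem span_hom : Submodule.span F (Set.range h.hom) = ⊤ := by
  rw [eq_top_iff]
  rintro b -
  have hb := h.span b.1
  obtain ⟨h1, h2⟩ := (Subsemigroup.mem_corner_iff h.idem).1 b.2
  rw [h1, h2] at hb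
  have him : (fun s => ε * ρ s) '' (S : Set G) = cornerValₗ (F := F) h.idem '' Set.range h.hom := by
    ext a
    constructor
    · rintro ⟨s, hs, rfl⟩
      exact ⟨_, ⟨⟨s, hs⟩, rfl⟩, rfl⟩
    · rintro ⟨_, ⟨s, rfl⟩, rfl⟩
      exact ⟨s, s.2, rfl⟩
  rw [him, ← Submodule.map_span] at hb
  obtain ⟨c, hc, hcb⟩ := hb
  rwa [← show c = b from Subtype.ext hcb]

/-- If the corner contains a commutative von Neumann regular subalgebra normalized by `S` which is
not a field, then there is a smaller corner. -/
theorem exists_smaller [FiniteDimensional F A]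
    (R : Subalgebra F h.idem.Corner) (hcomm : ∀ x ∈ R, ∀ y ∈ R, x * y = y * x)
    (hreg : ∀ x ∈ R, ∃ y ∈ R, x * y * x = x) (hnorm : ∀ s, ∀ x ∈ R, h.hom s * x * h.hom s⁻¹ ∈ R)
    {x : h.idem.Corner} (hxR : x ∈ R) (hx : x ≠ 0) (hxu : ∀ y ∈ R, x * y ≠ 1) :
    ∃ (η : A) (T : Subgroup G), IsCornerPair (F := F) ρ η T ∧
      Module.finrank F (LinearMap.range (LinearMap.mulLeft F η)) <
        Module.finrank F (LinearMap.range (LinearMap.mulLeft F ε)) := by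
  have : FiniteDimensional F h.idem.Corner :=
    FiniteDimensional.of_injective (cornerValₗ (F := F) h.idem) Subtype.val_injective
  obtain ⟨η, hηR, hηi, hη0, hη1, hprim⟩ := exists_primitive_idempotent R hcomm hreg hxR hx hxu
  have hval : ∀ {a b : h.idem.Corner}, a.1 = b.1 → a = b := fun h => Subtype.ext h
  obtain ⟨hεη, hηε⟩ := (Subsemigroup.mem_corner_iff h.idem).1 η.2
  have hinv : ∀ s : S, h.hom s⁻¹ * h.hom s = 1 := fun s => by rw [← map_mul]; simp
  have hinv' : ∀ s : S, h.hom s * h.hom s⁻¹ = 1 := fun s => by rw [← map_mul]; simp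
  -- The conjugates of the primitive idempotent `η` lie in the commutative algebra `R`, so each is
  -- equal or orthogonal to `η`: a system of imprimitivity.
  have horth : ∀ s : S, ρ s * η.1 ≠ η.1 * ρ s → η.1 * ρ s * η.1 = 0 := by
    intro s hs
    have hsη : h.hom s * η * h.hom s⁻¹ ∈ R := hnorm s η hηR
    have hidem : h.hom s * η * h.hom s⁻¹ * (h.hom s * η * h.hom s⁻¹) = h.hom s * η * h.hom s⁻¹ := by
      calc _ = h.hom s * η * (h.hom s⁻¹ * h.hom s) * η * h.hom s⁻¹ := by simp only [mul_assoc]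
        _ = h.hom s * (η * η) * h.hom s⁻¹ := by rw [hinv, mul_one]; simp only [mul_assoc]
        _ = _ := by rw [hηi]
    have hcoe : (h.hom s * η).1 = ρ s * η.1 := by
      change ε * ρ s * η.1 = _
      rw [← h.comm _ s.2, mul_assoc, hεη]
    have hcoe' : (η * h.hom s).1 = η.1 * ρ s := by
      change η.1 * (ε * ρ s) = _
      rw [← mul_assoc, hηε]
    have hzero : η * (h.hom s * η * h.hom s⁻¹) = 0 := by
      refine (hprim _ hsη hidem).resolve_right fun h1 => hs ?_
      have hsη' : h.hom s⁻¹ * η * h.hom s ∈ R := by simpa using hnorm s⁻¹ η hηR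
      have hidem' : h.hom s⁻¹ * η * h.hom s * (h.hom s⁻¹ * η * h.hom s) =
          h.hom s⁻¹ * η * h.hom s := by
        calc _ = h.hom s⁻¹ * η * (h.hom s * h.hom s⁻¹) * η * h.hom s := by simp only [mul_assoc]
          _ = h.hom s⁻¹ * (η * η) * h.hom s := by rw [hinv', mul_one]; simp only [mul_assoc]
          _ = _ := by rw [hηi]
      -- `h1` only puts `η` below its conjugate by `s`. Primitivity tested against the conjugate by
      -- `s⁻¹`, and conjugated back, gives equality.
      have h2 : h.hom s * (η * (h.hom s⁻¹ * η * h.hom s)) * h.hom s⁻¹ = η := by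
        calc _ = h.hom s * η * h.hom s⁻¹ * η * (h.hom s * h.hom s⁻¹) := by simp only [mul_assoc]
          _ = η := by rw [hinv', mul_one, hcomm _ hsη _ hηR, h1]
      have h3 : h.hom s * η * h.hom s⁻¹ = η := by
        rcases hprim _ hsη' hidem' with h4 | h4
        · rw [h4] at h2
          exact absurd (by rw [← h2]; simp) hη0
        · rwa [h4] at h2
      rw [← hcoe, ← hcoe']
      congr 1
      calc h.hom s * η = h.hom s * η * (h.hom s⁻¹ * h.hom s) := by rw [hinv, mul_one]
        _ = η * h.hom s := by rw [← mul_assoc, h3]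
    have h5 : η * h.hom s * η = 0 := by
      calc _ = η * (h.hom s * η) * (h.hom s⁻¹ * h.hom s) := by rw [hinv, mul_one, mul_assoc]
        _ = η * (h.hom s * η * h.hom s⁻¹) * h.hom s := by simp only [mul_assoc]
        _ = 0 := by rw [hzero, zero_mul]
    have h6 := congrArg Subtype.val h5
    change (η * h.hom s).1 * η.1 = 0 at h6
    rwa [hcoe'] at h6
  let T : Subgroup G := S ⊓
    { carrier := {s | ρ s * η.1 = η.1 * ρ s}
      one_mem' := by simp
      mul_mem' := fun {a b} ha hb => by
        change ρ (a * b) * η.1 = η.1 * ρ (a * b)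
        rw [map_mul, mul_assoc, show ρ b * η.1 = η.1 * ρ b from hb, ← mul_assoc,
          show ρ a * η.1 = η.1 * ρ a from ha, mul_assoc]
      inv_mem' := fun {a} ha => by
        have ha : ρ a * η.1 = η.1 * ρ a := ha
        have h1 : ρ a⁻¹ * ρ a = 1 := by rw [← map_mul]; simp
        have h2 : ρ a * ρ a⁻¹ = 1 := by rw [← map_mul]; simp
        change ρ a⁻¹ * η.1 = η.1 * ρ a⁻¹
        calc ρ a⁻¹ * η.1 = ρ a⁻¹ * (η.1 * ρ a) * ρ a⁻¹ := by
              rw [mul_assoc, mul_assoc, h2, mul_one]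
          _ = η.1 * ρ a⁻¹ := by rw [← ha, ← mul_assoc, h1, one_mul] }
  refine ⟨η.1, T, ⟨fun h0 => hη0 (hval h0), congrArg Subtype.val hηi, fun s hs => hs.2,
    fun z hz => ⟨h.central z hz, hz _⟩, fun a => ?_⟩, ?_⟩
  · have h1 : η.1 * a * η.1 = η.1 * (ε * a * ε) * η.1 := by
      rw [← mul_assoc, ← mul_assoc, hηε, mul_assoc _ ε, hεη]
    rw [h1]
    -- Cutting down by `η` kills every `s` outside the stabilizer `T`, so `T` spans the new corner.
    refine Submodule.span_induction (p := fun b _ => η.1 * b * η.1 ∈ Submodule.span F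
      ((fun s => η.1 * ρ s) '' (T : Set G))) ?_ ?_ ?_ ?_ (h.span a)
    · rintro _ ⟨s, hs, rfl⟩
      change η.1 * (ε * ρ s) * η.1 ∈ _
      rw [← mul_assoc, hηε]
      by_cases hsT : ρ s * η.1 = η.1 * ρ s
      · rw [mul_assoc, hsT, ← mul_assoc, show η.1 * η.1 = η.1 from congrArg Subtype.val hηi]
        exact Submodule.subset_span ⟨s, ⟨hs, hsT⟩, rfl⟩
      · rw [horth ⟨s, hs⟩ hsT]
        exact zero_mem _
    · simp
    · intro b c _ _ hb hc
      rw [mul_add, add_mul]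
      exact add_mem hb hc
    · intro r b _ hb
      rw [mul_smul_comm, smul_mul_assoc]
      exact Submodule.smul_mem _ r hb
  · refine Submodule.finrank_lt_finrank_of_lt (lt_of_le_of_ne ?_ fun heq => ?_)
    · rintro _ ⟨z, rfl⟩
      exact ⟨η.1 * z, by simp [← mul_assoc, hεη]⟩
    · have hmem : ε ∈ LinearMap.range (LinearMap.mulLeft F η.1) := by
        rw [heq]; exact ⟨1, by simp⟩
      obtain ⟨z, hz⟩ := hmem
      have hz : η.1 * z = ε := hz
      refine hη1 (hval ?_)
      change η.1 = ε
      calc η.1 = η.1 * (η.1 * z) := by rw [hz, hηε]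
        _ = ε := by rw [← mul_assoc, show η.1 * η.1 = η.1 from congrArg Subtype.val hηi, hz]

theorem mul_smul_mul_mem {B : Type*} [Ring B] [Algebra F B] (R : Subalgebra F B) (r : F)
    {a b c : B} (h : a * b * c ∈ R) : a * r • b * c ∈ R := by
  rw [mul_smul_comm, smul_mul_assoc]
  exact R.smul_mem h r

/-- The algebra homomorphism from the group algebra of a group of units. -/
noncomputable def unitsLift {B : Type*} [Ring B] [Algebra F B] {P : Subgroup Bˣ} (M : Subgroup P) :
    MonoidAlgebra F M →ₐ[F] B :=
  MonoidAlgebra.lift F B M ((Units.coeHom B).comp (P.subtype.comp M.subtype))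

/-- The image of `S` in the unit group of the corner. -/
def image : Subgroup h.idem.Cornerˣ := h.hom.toHomUnits.range

/-- The subalgebra of a minimal corner spanned by a finite commutative normal subgroup of the image
of `S` is a field. -/
theorem exists_mul_eq_one_of_minimal [CharZero F] [FiniteDimensional F A]
    (hmin : ∀ (η : A) (T : Subgroup G), IsCornerPair (F := F) ρ η T →
      Module.finrank F (LinearMap.range (LinearMap.mulLeft F ε)) ≤
        Module.finrank F (LinearMap.range (LinearMap.mulLeft F η)))
    (M : Subgroup h.image) [Finite M] (hM : M.Normal) (hMc : ∀ a ∈ M, ∀ b ∈ M, a * b = b * a)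
    {x : h.idem.Corner} (hx : x ∈ (unitsLift (F := F) M).range) (hx0 : x ≠ 0) :
    ∃ y ∈ (unitsLift (F := F) M).range, x * y = 1 := by
  let _ : CommGroup M :=
    { (inferInstance : Group M) with
      mul_comm := fun a b => Subtype.ext (hMc _ a.2 _ b.2) }
  by_contra! hxu
  suffices H : ∃ (η : A) (T : Subgroup G), IsCornerPair (F := F) ρ η T ∧
      Module.finrank F (LinearMap.range (LinearMap.mulLeft F η)) <
        Module.finrank F (LinearMap.range (LinearMap.mulLeft F ε)) by
    obtain ⟨η, T, hT, hlt⟩ := H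
    exact absurd (hmin η T hT) (not_le.2 hlt)
  refine h.exists_smaller (unitsLift (F := F) M).range ?_ ?_ ?_ hx hx0 hxu
  · rintro _ ⟨a, rfl⟩ _ ⟨b, rfl⟩
    change unitsLift M a * unitsLift M b = unitsLift M b * unitsLift M a
    rw [← map_mul, ← map_mul, mul_comm a b]
  · rintro _ ⟨a, rfl⟩
    obtain ⟨b, hb⟩ := monoidAlgebra_regular (F := F) M a
    refine ⟨_, ⟨b, rfl⟩, ?_⟩
    change unitsLift M a * unitsLift M b * unitsLift M a = unitsLift M a
    rw [← map_mul, ← map_mul, hb]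
  · rintro s _ ⟨a, rfl⟩
    change h.hom s * unitsLift M a * h.hom s⁻¹ ∈ _
    induction a using MonoidAlgebra.induction_on with
    | of m =>
      refine ⟨MonoidAlgebra.of F M ⟨⟨h.hom.toHomUnits s, s, rfl⟩ * m.1 *
        (⟨h.hom.toHomUnits s, s, rfl⟩)⁻¹, hM.conj_mem _ m.2 _⟩, ?_⟩
      change unitsLift M _ = _
      simp only [unitsLift, MonoidAlgebra.lift_of, MonoidHom.comp_apply, Subgroup.subtype_apply,
        Units.coeHom_apply]
      push_cast
      rw [← map_inv]
      rfl
    | add a b ha hb =>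
      rw [map_add, mul_add, add_mul]
      exact add_mem ha hb
    | smul r a ha =>
      rw [map_smul]
      exact mul_smul_mul_mem _ r ha

end IsCornerPair

/-- A faithful corner of an algebra spanned by a group `G` in which a finite normal `l`-subgroup
`H` acts through a cyclic group. -/
theorem exists_isCornerPair_cyclic [CharZero F] [FiniteDimensional F A] [Nontrivial A]
    (hspan : Submodule.span F (Set.range ρ) = ⊤) {l : ℕ} [hl : Fact l.Prime] (hl2 : l ≠ 2)
    (H : Subgroup G) [H.Normal] [Finite H] (hH : IsPGroup l H)
    (hG : ∀ g : G, ∃ k : ℕ, g ^ l ^ k ∈ Subgroup.center G) :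
    ∃ (ε : A) (S : Subgroup G) (h : IsCornerPair (F := F) ρ ε S) (h₀ : S), (h₀ : G) ∈ H ∧
      (∀ s : S, (s : G) ∈ H → ∃ i : ℕ, h.hom s = h.hom h₀ ^ i) ∧
      (h.hom h₀ = 1 ∨ ∃ f : Polynomial ℤ,
        (l : h.idem.Corner) = (h.hom h₀ - 1) * Polynomial.aeval (h.hom h₀) f) := by
  -- The family of pairs is nonempty because it contains `(1, ⊤)`.
  obtain ⟨⟨ε, S⟩, h, hmin⟩ := exists_minimal_image
    (fun q : A × Subgroup G => Module.finrank F (LinearMap.range (LinearMap.mulLeft F q.1)))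
    (fun q => IsCornerPair (F := F) ρ q.1 q.2)
    ⟨(1, ⊤), one_ne_zero, IsIdempotentElem.one, by simp, by simp, fun a => by
      simp only [Subgroup.coe_top, Set.image_univ, one_mul, mul_one]
      change a ∈ Submodule.span F (Set.range ρ)
      rw [hspan]; trivial⟩
  have h : IsCornerPair (F := F) ρ ε S := h
  have hmin := fun η T hT => hmin (η, T) hT
  have hfield := fun (M : Subgroup h.image) (_ : Finite M) =>
    h.exists_mul_eq_one_of_minimal hmin M
  have hnt : Nontrivial h.idem.Corner :=
    ⟨1, 0, fun h1 => h.ne_zero (congrArg Subtype.val h1)⟩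
  let π : S →* h.image := h.hom.toHomUnits.rangeRestrict
  have hπ : ∀ s, (((π s : h.image) : h.idem.Cornerˣ) : h.idem.Corner) = h.hom s := fun s => rfl
  have hπs : Function.Surjective π := MonoidHom.rangeRestrict_surjective _
  let N : Subgroup h.image := (H.subgroupOf S).map π
  have hNn : N.Normal := Subgroup.Normal.map inferInstance _ hπs
  have hHf : Finite (H.subgroupOf S) :=
    Finite.of_injective (fun s => (⟨s.1.1, s.2⟩ : H)) fun a b hab =>
      Subtype.ext (Subtype.ext (congrArg (fun z : H => (z : G)) hab))
  have hNf : Finite N := Set.Finite.image _ (Set.toFinite ((H.subgroupOf S : Subgroup S) : Set S))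
  have hNp : IsPGroup l N := (hH.comap_of_injective S.subtype S.subtype_injective).map π
  -- A commutative normal subgroup embeds in the units of the field it spans, so it is cyclic as a
  -- finite subgroup of the units of a domain; the group-theoretic criterion then applies to the
  -- image `N` of `H ∩ S`.
  have hcyc : IsCyclic N := by
    refine isCyclic_of_forall_normal_isCyclic hl2 N hNp (fun g => ?_) fun M hMN hMn hMc => ?_
    · obtain ⟨s, rfl⟩ := hπs g
      obtain ⟨k, hk⟩ := hG s
      refine ⟨k, Subgroup.mem_center_iff.2 fun q => ?_⟩
      obtain ⟨t, rfl⟩ := hπs q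
      rw [← map_pow, ← map_mul, ← map_mul]
      exact congrArg π (Subtype.ext (by simpa using Subgroup.mem_center_iff.1 hk t))
    · have hMf : Finite M := Set.Finite.subset (Set.toFinite (N : Set h.image)) hMN
      have hcomm : ∀ a b : (IsCornerPair.unitsLift (F := F) M).range, a * b = b * a := by
        let _ : CommGroup M :=
          { (inferInstance : Group M) with mul_comm := fun a b => Subtype.ext (hMc _ a.2 _ b.2) }
        rintro ⟨_, a, rfl⟩ ⟨_, b, rfl⟩
        refine Subtype.ext ?_
        change IsCornerPair.unitsLift M a * IsCornerPair.unitsLift M b =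
          IsCornerPair.unitsLift M b * IsCornerPair.unitsLift M a
        rw [← map_mul, ← map_mul, mul_comm a b]
      let _ : CommRing (IsCornerPair.unitsLift (F := F) M).range :=
        { (inferInstance : Ring (IsCornerPair.unitsLift (F := F) M).range) with
          mul_comm := hcomm }
      have hnz : NoZeroDivisors (IsCornerPair.unitsLift (F := F) M).range := by
        refine ⟨fun {a b} hab => or_iff_not_imp_left.2 fun ha => ?_⟩
        obtain ⟨y, hy, hay⟩ := hfield M hMf hMn hMc a.2 fun h0 => ha (Subtype.ext h0)
        have h1 : (⟨y, hy⟩ : (IsCornerPair.unitsLift (F := F) M).range) * a = 1 := by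
          rw [hcomm]; exact Subtype.ext hay
        rw [← one_mul b, ← h1, mul_assoc, hab, mul_zero]
      have hdom : IsDomain (IsCornerPair.unitsLift (F := F) M).range := NoZeroDivisors.to_isDomain _
      refine isCyclic_of_injective_ringHom
        (f := ((IsCornerPair.unitsLift (F := F) M).rangeRestrict : _ →ₐ[F] _).toMonoidHom.comp
          (MonoidAlgebra.of F M)) fun a b hab => ?_
      have := congrArg Subtype.val hab
      change IsCornerPair.unitsLift M (MonoidAlgebra.of F M a) =
        IsCornerPair.unitsLift M (MonoidAlgebra.of F M b) at this
      simp only [IsCornerPair.unitsLift, MonoidAlgebra.lift_of] at this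
      exact Subtype.ext (Subtype.ext (Units.ext this))
  obtain ⟨⟨_, h₀, hh₀, rfl⟩, hgen⟩ := hcyc.exists_zpow_surjective
  refine ⟨ε, S, h, h₀, hh₀, fun s hs => ?_, ?_⟩
  · obtain ⟨i, hi⟩ : (⟨π s, s, hs, rfl⟩ : N) ∈ Submonoid.powers (⟨π h₀, h₀, hh₀, rfl⟩ : N) :=
      mem_powers_iff_mem_zpowers.2 (Subgroup.mem_zpowers_iff.2 (hgen _))
    refine ⟨i, ?_⟩
    have := congrArg (fun z : N => (((z : h.image) : h.idem.Cornerˣ) : h.idem.Corner)) hi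
    rw [← hπ, ← hπ]
    simpa using this.symm
  · obtain ⟨k, hk⟩ := IsPGroup.iff_orderOf.1 hNp ⟨π h₀, h₀, hh₀, rfl⟩
    rcases k with _ | k
    · left
      rw [pow_zero, orderOf_eq_one_iff] at hk
      exact congrArg (fun z : N => (((z : h.image) : h.idem.Cornerˣ) : h.idem.Corner)) hk
    right
    set ζ := h.hom h₀ with hζ
    let z : N := ⟨π h₀, h₀, hh₀, rfl⟩
    have hpow : ∀ n : ℕ, (((z ^ n : N) : h.image) : h.idem.Cornerˣ) = (ζ ^ n : h.idem.Corner) :=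
      fun n => by simp [z, hπ, hζ]
    have hz1 : z ^ l ^ k ≠ 1 := fun h1 => by
      have := Nat.le_of_dvd (pow_pos hl.1.pos _) (orderOf_dvd_of_pow_eq_one h1)
      rw [hk] at this
      exact absurd this (not_le.2 (Nat.pow_lt_pow_right hl.1.one_lt (Nat.lt_succ_self k)))
    have hω1 : ζ ^ l ^ k ≠ 1 := fun h1 => hz1 (by
      refine Subtype.ext (Subtype.ext (Units.ext ?_))
      rw [hpow, h1]; rfl)
    have hωl : (ζ ^ l ^ k) ^ l = 1 := by
      rw [← pow_mul, ← pow_succ, ← hpow, ← hk, pow_orderOf_eq_one]; rfl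
    have hNc : ∀ a ∈ N, ∀ b ∈ N, a * b = b * a := fun a ha b hb =>
      congrArg Subtype.val (hcyc.isMulCommutative.is_comm.comm (⟨a, ha⟩ : N) ⟨b, hb⟩)
    have hmemω : ζ ^ l ^ k ∈ (IsCornerPair.unitsLift (F := F) N).range :=
      ⟨MonoidAlgebra.of F N (z ^ l ^ k), by
        change IsCornerPair.unitsLift N _ = _
        simp only [IsCornerPair.unitsLift, MonoidAlgebra.lift_of]
        exact hpow _⟩
    -- `ζ ^ l ^ k - 1` is nonzero in a field, hence invertible, so the element `ζ ^ l ^ k` of order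
    -- `l` satisfies the cyclotomic equation.
    obtain ⟨y, -, hy⟩ := hfield N hNf hNn hNc (sub_mem hmemω (one_mem _)) (sub_ne_zero.2 hω1)
    have hsum : ∑ i ∈ Finset.range l, (ζ ^ l ^ k) ^ i = 0 := by
      have h1 : (∑ i ∈ Finset.range l, (ζ ^ l ^ k) ^ i) * (ζ ^ l ^ k - 1) = 0 := by
        rw [geom_sum_mul, hωl, sub_self]
      rw [← mul_one (∑ i ∈ Finset.range l, (ζ ^ l ^ k) ^ i), ← hy, ← mul_assoc, h1, zero_mul]
    -- This is the cyclotomic polynomial of order `l ^ (k + 1)`. As `f(1) = l` and `f(ζ) = 0`, the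
    -- difference `f(1) - f(ζ)` exhibits `l` as a multiple of `ζ - 1`.
    let f : Polynomial ℤ := ∑ i ∈ Finset.range l, (Polynomial.X ^ l ^ k) ^ i
    obtain ⟨g, hg⟩ := Polynomial.X_sub_C_dvd_sub_C_eval (a := (1 : ℤ)) (p := f)
    have hf1 : f.eval 1 = l := by simp [f, Polynomial.eval_finsetSum]
    have hfζ : Polynomial.aeval ζ f = 0 := by simpa [f] using hsum
    refine ⟨-g, ?_⟩
    have := congrArg (Polynomial.aeval ζ) hg
    rw [hf1] at this
    simp only [map_sub, map_mul, hfζ, Polynomial.aeval_X, zero_sub, map_one,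
      map_natCast] at this
    rw [map_neg]
    exact (neg_eq_iff_eq_neg.1 this).trans (neg_mul_eq_mul_neg _ _)

end Idempotents

end Iwasawa

namespace Iwasawa

/-! ### Normal elements and powers of a uniformizer -/

section NormalElement

variable {O W : Type*} [CommRing O] [IsLocalRing O] [IsNoetherianRing O] [Ring W] [Algebra O W]
  [Module.Finite O W]

/-- Left multiplication by `a` is a surjective endomorphism of a finite module, hence injective, so
a right inverse is also a left inverse. -/
theorem isUnit_of_mul_eq_one_of_finite (O : Type*) {W : Type*} [CommRing O] [Ring W]
    [Algebra O W] [Module.Finite O W] {a b : W} (h : a * b = 1) : IsUnit a := by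
  have hs : Function.Surjective (LinearMap.mulLeft O a) := fun w => ⟨b * w, by
    simp [← mul_assoc, h]⟩
  have hi := OrzechProperty.injective_of_surjective_endomorphism (LinearMap.mulLeft O a) hs
  exact ⟨⟨a, b, h, hi (by simp [← mul_assoc, h])⟩, rfl⟩

/-- By Nakayama, left multiplication by an element congruent to `1` modulo the maximal ideal is
surjective. -/
theorem isUnit_one_add_smul {O W : Type*} [CommRing O] [IsLocalRing O] [Ring W] [Algebra O W]
    [Module.Finite O W] {m : O} (hm : m ∈ IsLocalRing.maximalIdeal O) (z : W) :
    IsUnit (1 + m • z) := by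
  have hle : (⊤ : Submodule O W) ≤ LinearMap.range (LinearMap.mulLeft O (1 + m • z)) := by
    refine Submodule.le_of_le_smul_of_le_jacobson_bot (I := IsLocalRing.maximalIdeal O)
      Module.Finite.fg_top (IsLocalRing.maximalIdeal_le_jacobson _) fun w _ => ?_
    have h1 : w = (1 + m • z) * w + m • (-(z * w)) := by
      rw [add_mul, one_mul, smul_mul_assoc, smul_neg]; abel
    rw [h1]
    exact Submodule.add_mem_sup ⟨w, rfl⟩ (Submodule.smul_mem_smul hm trivial)
  obtain ⟨b, hb⟩ := hle (x := 1) trivial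
  exact isUnit_of_mul_eq_one_of_finite O hb

variable {π : W} (hr : ∀ w, ∃ w', w * π = π * w') {e : ℕ} {m : O}
  (hm : m ∈ IsLocalRing.maximalIdeal O) {y : W} (hpow : π ^ e = m • y)

include hr in
theorem exists_normal_mul_pow (z : W) (n : ℕ) : ∃ z', (π * z) ^ n = π ^ n * z' := by
  induction n with
  | zero => exact ⟨1, by simp⟩
  | succ n ih =>
    obtain ⟨z', hz'⟩ := ih
    obtain ⟨w, hw⟩ := hr z'
    refine ⟨w * z, ?_⟩
    rw [pow_succ, hz', pow_succ, mul_assoc (π ^ n), ← mul_assoc z', hw]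
    simp only [mul_assoc]

-- Normality collects all factors `π` of `(π * -z) ^ e` on the left, so this power lies in `m • W`
-- and one minus it is a unit. The geometric sum writes that unit as a product of commuting factors,
-- one of which is `1 + π * z`.
omit [IsNoetherianRing O] in
include hr hm hpow in
theorem isUnit_one_add_normal_mul (z : W) : IsUnit (1 + π * z) := by
  obtain ⟨z', hz'⟩ := exists_normal_mul_pow hr (-z) e
  have h1 : IsUnit (1 - (π * -z) ^ e) := by
    have : 1 - (π * -z) ^ e = 1 + m • (-(y * z')) := by
      rw [hz', hpow, smul_mul_assoc, smul_neg, sub_eq_add_neg]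
    rw [this]
    exact isUnit_one_add_smul hm _
  have h2 : 1 + π * z = 1 - π * -z := by simp
  rw [h2]
  rw [← mul_neg_geom_sum] at h1
  refine ((Commute.isUnit_mul_iff ?_).1 h1).1
  exact Commute.sum_right _ _ _ fun i _ =>
    ((Commute.one_left _).sub_left (Commute.refl _)).pow_right i

include hr hm hpow in
/-- If `π` is a normal, topologically nilpotent element of a finite algebra `W` over a noetherian
local ring and `W / π W` is a skew field, then every nonzero element of `W` is a power of `π`
times a unit. -/
theorem exists_eq_pow_mul_unit
    (hdiv : ∀ w : W, (∃ v, w = π * v) ∨ ∃ w' v, w * w' = 1 + π * v) {w : W} (hw : w ≠ 0) :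
    ∃ (j : ℕ) (u : Wˣ), w = π ^ j * u := by
  classical
  have hunit : ∀ w : W, (∃ v, w = π * v) ∨ IsUnit w := by
    intro w
    refine (hdiv w).imp_right ?_
    rintro ⟨w', v, h⟩
    obtain ⟨u, hu⟩ := isUnit_one_add_normal_mul hr hm hpow v
    refine isUnit_of_mul_eq_one_of_finite O (b := w' * ↑u⁻¹) ?_
    rw [← mul_assoc, h, ← hu, Units.mul_inv]
  -- Divisibility by all powers of `π` would put `w` in every power of the maximal ideal times `W`,
  -- and Krull's intersection theorem makes that intersection zero.
  have hex : ∃ j, ¬ ∃ v, w = π ^ j * v := by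
    by_contra! h
    apply hw
    have hmem : w ∈ (⨅ i : ℕ, IsLocalRing.maximalIdeal O ^ i • ⊤ : Submodule O W) := by
      refine Submodule.mem_iInf _ |>.2 fun n => ?_
      obtain ⟨v, hv⟩ := h (e * n)
      rw [hv, pow_mul, hpow, smul_pow, smul_mul_assoc]
      exact Submodule.smul_mem_smul (Ideal.pow_mem_pow hm n) trivial
    rwa [Ideal.iInf_pow_smul_eq_bot_of_isLocalRing _ (IsLocalRing.maximalIdeal.isMaximal O).ne_top,
      Submodule.mem_bot] at hmem
  obtain ⟨j, hj⟩ : ∃ j, Nat.find hex = j + 1 :=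
    Nat.exists_eq_succ_of_ne_zero fun h0 => (h0 ▸ Nat.find_spec hex) ⟨w, by simp⟩
  obtain ⟨v, hv⟩ := not_not.1 (Nat.find_min hex (m := j) (by omega))
  rcases hunit v with ⟨v', rfl⟩ | ⟨u, rfl⟩
  · exact absurd ⟨v', by rw [hj, pow_succ, mul_assoc, ← hv]⟩ (Nat.find_spec hex)
  · exact ⟨j, u, hv⟩

end NormalElement

/-! ### The valuation attached to a normal uniformizer -/

section DiscreteValuation

open WithZero

theorem zpow_conj_mem {B : Type*} [Ring B] {W : Subring B} {ϖ : Bˣ}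
    (hc : ∀ w ∈ W, (ϖ : B) * w * ((ϖ⁻¹ : Bˣ) : B) ∈ W)
    (hic : ∀ w ∈ W, ((ϖ⁻¹ : Bˣ) : B) * w * (ϖ : B) ∈ W) (i : ℤ) {w : B} (hw : w ∈ W) :
    ((ϖ ^ (-i) : Bˣ) : B) * w * ((ϖ ^ i : Bˣ) : B) ∈ W := by
  induction i with
  | zero => simpa
  | succ i ih =>
    convert hic _ ih using 1
    simp only [← mul_assoc]
    rw [← Units.val_mul, mul_assoc _ _ (ϖ : B), ← Units.val_mul, ← zpow_add_one, ← zpow_neg_one,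
      ← zpow_add]
    congr 4; ring
  | pred i ih =>
    convert hc _ ih using 1
    simp only [← mul_assoc]
    rw [← Units.val_mul, mul_assoc _ _ ((ϖ⁻¹ : Bˣ) : B), ← Units.val_mul, ← zpow_sub_one,
      ← zpow_one_add]
    congr 4; ring

/-- A subring `W` and a unit `ϖ` normalizing `W` such that every nonzero element is a power of `ϖ`
times a unit of `W`. -/
structure IsNormalUniformizer {B : Type*} [Ring B] (W : Subring B) (ϖ : Bˣ) : Prop where
  exists_eq : ∀ b : B, b ≠ 0 → ∃ (i : ℤ) (u : Bˣ), (u : B) ∈ W ∧ ((u⁻¹ : Bˣ) : B) ∈ W ∧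
    b = ((ϖ ^ i * u : Bˣ) : B)
  conj_mem : ∀ w ∈ W, (ϖ : B) * w * ((ϖ⁻¹ : Bˣ) : B) ∈ W
  inv_conj_mem : ∀ w ∈ W, ((ϖ⁻¹ : Bˣ) : B) * w * (ϖ : B) ∈ W
  mem : (ϖ : B) ∈ W
  inv_notMem : ((ϖ⁻¹ : Bˣ) : B) ∉ W

namespace IsNormalUniformizer

variable {B : Type*} [Ring B] {W : Subring B} {ϖ : Bˣ} (h : IsNormalUniformizer W ϖ)

include h

theorem zpow_mem_iff (i : ℤ) : ((ϖ ^ i : Bˣ) : B) ∈ W ↔ 0 ≤ i := by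
  constructor
  · intro hi
    by_contra! hneg
    obtain ⟨n, rfl⟩ : ∃ n : ℕ, i = -(n + 1 : ℕ) := ⟨(-i - 1).toNat, by omega⟩
    refine h.inv_notMem ?_
    have : ((ϖ⁻¹ : Bˣ) : B) = (ϖ : B) ^ n * ((ϖ ^ (-(n + 1 : ℕ) : ℤ) : Bˣ) : B) := by
      rw [← Units.val_pow_eq_pow_val, ← Units.val_mul, ← zpow_natCast, ← zpow_add]
      congr 1
      rw [← zpow_neg_one]; congr 1; push_cast; ring
    rw [this]
    exact mul_mem (pow_mem h.mem n) hi
  · intro hi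
    lift i to ℕ using hi
    rw [zpow_natCast, Units.val_pow_eq_pow_val]
    exact pow_mem h.mem i

theorem conj_zpow_mem (i : ℤ) {w : B} (hw : w ∈ W) :
    ((ϖ ^ (-i) : Bˣ) : B) * w * ((ϖ ^ i : Bˣ) : B) ∈ W :=
  zpow_conj_mem h.conj_mem h.inv_conj_mem i hw

/-- The exponent of the uniformizer in a nonzero element. -/
noncomputable def ord (b : B) (hb : b ≠ 0) : ℤ := (h.exists_eq b hb).choose

/-- This trades inequalities of orders for membership in `W`; the ultrametric inequality becomes
closure of `W` under addition, and the order is seen not to depend on the chosen decomposition. -/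
theorem le_ord_iff {b : B} (hb : b ≠ 0) (i : ℤ) :
    i ≤ h.ord b hb ↔ ((ϖ ^ (-i) : Bˣ) : B) * b ∈ W := by
  obtain ⟨u, hu, hu', hbu⟩ := (h.exists_eq b hb).choose_spec
  change b = ((ϖ ^ h.ord b hb * u : Bˣ) : B) at hbu
  have h1 : ((ϖ ^ (-i) : Bˣ) : B) * b = ((ϖ ^ (h.ord b hb - i) : Bˣ) : B) * u := by
    conv_lhs => rw [hbu]
    rw [← Units.val_mul, ← Units.val_mul, ← mul_assoc, ← zpow_add]
    congr 3; ring
  rw [h1, ← sub_nonneg, ← h.zpow_mem_iff]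
  refine ⟨fun h2 => mul_mem h2 hu, fun h2 => ?_⟩
  have h3 := mul_mem h2 hu'
  rwa [mul_assoc, Units.mul_inv, mul_one] at h3

theorem ord_eq {b : B} (hb : b ≠ 0) {i : ℤ} {u : Bˣ} (hu : (u : B) ∈ W)
    (hu' : ((u⁻¹ : Bˣ) : B) ∈ W) (hbu : b = ((ϖ ^ i * u : Bˣ) : B)) : h.ord b hb = i := by
  refine eq_of_forall_le_iff fun j => ?_
  have h1 : ((ϖ ^ (-j) : Bˣ) : B) * b = ((ϖ ^ (i - j) : Bˣ) : B) * u := by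
    conv_lhs => rw [hbu]
    rw [← Units.val_mul, ← Units.val_mul, ← mul_assoc, ← zpow_add]
    congr 3; ring
  rw [h.le_ord_iff, h1, ← sub_nonneg (a := i), ← h.zpow_mem_iff]
  refine ⟨fun h2 => ?_, fun h2 => mul_mem h2 hu⟩
  have h3 := mul_mem h2 hu'
  rwa [mul_assoc, Units.mul_inv, mul_one] at h3

theorem isUnit {b : B} (hb : b ≠ 0) : IsUnit b := by
  obtain ⟨i, u, -, -, h1⟩ := h.exists_eq b hb
  exact h1 ▸ (ϖ ^ i * u).isUnit

theorem ord_mul [Nontrivial B] {b c : B} (hb : b ≠ 0) (hc : c ≠ 0) (hbc : b * c ≠ 0) :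
    h.ord (b * c) hbc = h.ord b hb + h.ord c hc := by
  obtain ⟨u, hu, hu', hbu⟩ := (h.exists_eq b hb).choose_spec
  obtain ⟨t, ht, ht', hct⟩ := (h.exists_eq c hc).choose_spec
  change b = ((ϖ ^ h.ord b hb * u : Bˣ) : B) at hbu
  change c = ((ϖ ^ h.ord c hc * t : Bˣ) : B) at hct
  -- Moving `u` to the right past the power of `ϖ` in `c` conjugates it, and conjugation by `ϖ`
  -- preserves `W`.
  refine h.ord_eq hbc (u := ϖ ^ (-h.ord c hc) * u * ϖ ^ h.ord c hc * t) ?_ ?_ ?_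
  · rw [Units.val_mul, Units.val_mul, Units.val_mul]
    exact mul_mem (h.conj_zpow_mem _ hu) ht
  · have : (ϖ ^ (-h.ord c hc) * u * ϖ ^ h.ord c hc * t)⁻¹ =
      t⁻¹ * (ϖ ^ (-h.ord c hc) * u⁻¹ * ϖ ^ h.ord c hc) := by group
    rw [this, Units.val_mul, Units.val_mul, Units.val_mul]
    exact mul_mem ht' (h.conj_zpow_mem _ hu')
  · conv_lhs => rw [hbu, hct]
    rw [← Units.val_mul]
    congr 1
    group

open Classical in
/-- The valuation of a skew field defined by a normal uniformizer. -/
noncomputable def valuation [Nontrivial B] : Valuation B ℤᵐ⁰ where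
  toFun b := if hb : b = 0 then 0 else exp (-(h.ord b hb))
  map_zero' := by simp
  map_one' := by
    have : h.ord 1 one_ne_zero = 0 := h.ord_eq _ (i := 0) (u := 1) (by simp) (by simp) (by simp)
    simp [this]
  map_mul' b c := by
    by_cases hb : b = 0
    · simp [hb]
    by_cases hc : c = 0
    · simp [hc]
    have hbc : b * c ≠ 0 := ((h.isUnit hb).mul (h.isUnit hc)).ne_zero
    simp only [hb, hc, hbc, dite_false]
    rw [h.ord_mul hb hc hbc, ← exp_add]; congr 1; ring
  map_add_le_max' b c := by
    by_cases hb : b = 0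
    · simp [hb]
    by_cases hc : c = 0
    · simp [hc]
    by_cases hbc : b + c = 0
    · simp [hbc]
    simp only [hb, hc, hbc, dite_false]
    rw [le_max_iff, exp_le_exp, exp_le_exp, neg_le_neg_iff, neg_le_neg_iff, ← min_le_iff,
      h.le_ord_iff hbc, mul_add]
    exact add_mem ((h.le_ord_iff hb _).1 (min_le_left _ _))
      ((h.le_ord_iff hc _).1 (min_le_right _ _))

open Classical in
theorem valuation_le_one_iff [Nontrivial B] {b : B} : h.valuation b ≤ 1 ↔ b ∈ W := by
  by_cases hb : b = 0
  · simp [hb]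
  change (if hb : b = 0 then 0 else exp (-(h.ord b hb))) ≤ _ ↔ _
  rw [dif_neg hb, ← exp_zero, exp_le_exp, neg_nonpos, h.le_ord_iff]
  simp

open Classical in
theorem valuation_lt_one_iff [Nontrivial B] {b : B} :
    h.valuation b < 1 ↔ ((ϖ⁻¹ : Bˣ) : B) * b ∈ W := by
  by_cases hb : b = 0
  · simp [hb]
  change (if hb : b = 0 then 0 else exp (-(h.ord b hb))) < _ ↔ _
  rw [dif_neg hb, ← exp_zero, exp_lt_exp, neg_lt_zero, Int.lt_iff_add_one_le, h.le_ord_iff]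
  simp

end IsNormalUniformizer

end DiscreteValuation

end Iwasawa

namespace Iwasawa

/-! ### Commutativity of the residue ring -/

section ResidueField

variable {Λ V : Type*} [CommRing Λ] [IsLocalRing Λ] [IsNoetherianRing Λ] [Ring V] [Algebra Λ V]

theorem commute_of_mem_adjoin_singleton {R V : Type*} [CommRing R] [Ring V] [Algebra R V] {t a b : V}
    (ha : a ∈ Algebra.adjoin R {t}) (hb : b ∈ Algebra.adjoin R {t}) : a * b = b * a := by
  have h1 : Algebra.adjoin R {t} ≤ Subalgebra.centralizer R {t} :=
    Algebra.adjoin_le (by rintro _ rfl; exact Subalgebra.mem_centralizer_iff R |>.2 (by simp))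
  have h2 : Algebra.adjoin R {t} ≤ Subalgebra.centralizer R {b} :=
    Algebra.adjoin_le (by
      rintro _ rfl
      refine Subalgebra.mem_centralizer_iff R |>.2 ?_
      rintro _ rfl
      exact (Subalgebra.mem_centralizer_iff R |>.1 (h1 hb) _ rfl).symm)
  exact (Subalgebra.mem_centralizer_iff R |>.1 (h2 ha) b rfl).symm

/-- If `(l, T)` is the maximal ideal of `Λ`, then in a `Λ`-algebra killed by `l` in which `T` is
invertible, all nonzero polynomials in a root `t` of `T` are invertible. -/
theorem isUnit_of_mem_adjoin_root {l T : Λ} (hmax : IsLocalRing.maximalIdeal Λ = Ideal.span {l, T})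
    (hl : algebraMap Λ V l = 0) {t : V} {q : ℕ} (hq : q ≠ 0) (ht : t ^ q = algebraMap Λ V T)
    (hT : IsUnit (algebraMap Λ V T)) {w : V} (hw : w ∈ Algebra.adjoin Λ {t}) (hw0 : w ≠ 0) :
    IsUnit w := by
  let E := Algebra.adjoin Λ {t}
  have hint : IsIntegral Λ t := ⟨Polynomial.X ^ q - Polynomial.C T,
    Polynomial.monic_X_pow_sub_C T hq, by simp [ht]⟩
  have hfin : Module.Finite Λ E :=
    Module.Finite.iff_fg.2 hint.fg_adjoin_singleton
  have htE : t ∈ E := Algebra.self_mem_adjoin_singleton Λ t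
  have hcomm : ∀ a b : E, a * b = b * a := fun a b =>
    Subtype.ext (commute_of_mem_adjoin_singleton a.2 b.2)
  let τ : E := ⟨t, htE⟩
  have hτ : τ ^ q = T • 1 := Subtype.ext (by simp [τ, ht, Algebra.smul_def])
  have hform : ∀ w ∈ E, ∃ f : Λ, ∃ v ∈ E, w = algebraMap Λ V f + t * v := by
    intro w hw
    induction hw using Algebra.adjoin_induction with
    | mem c hc =>
      rw [Set.mem_singleton_iff.1 hc]
      exact ⟨0, 1, one_mem _, by simp⟩
    | algebraMap r => exact ⟨r, 0, zero_mem _, by simp⟩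
    | add a b ha hb iha ihb =>
      obtain ⟨f, v, hv, rfl⟩ := iha
      obtain ⟨g, u, hu, rfl⟩ := ihb
      exact ⟨f + g, v + u, add_mem hv hu, by rw [map_add, mul_add]; abel⟩
    | mul a b ha hb iha ihb =>
      obtain ⟨f, v, hv, rfl⟩ := iha
      obtain ⟨g, u, hu, rfl⟩ := ihb
      refine ⟨f * g, algebraMap Λ V f * u + v * (algebraMap Λ V g + t * u),
        add_mem (mul_mem (E.algebraMap_mem f) hu) (mul_mem hv hb), ?_⟩
      have hft : algebraMap Λ V f * (t * u) = t * (algebraMap Λ V f * u) := by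
        rw [← mul_assoc, Algebra.commutes, mul_assoc]
      rw [map_mul, add_mul, mul_add (algebraMap Λ V f), hft]
      simp only [mul_add, mul_assoc]
      abel
  -- In `Λ[t]` every element is congruent modulo `t` to a constant `f`. If `f` is in the maximal
  -- ideal `(l, T)` it is a multiple of `t`, since `l = 0` and `T = t ^ q`; otherwise `f` is a unit.
  -- So `t` is a uniformizer, and it becomes invertible with `T`.
  obtain ⟨j, u, hu⟩ := exists_eq_pow_mul_unit (O := Λ) (π := τ) (e := q) (m := T) (y := 1)
    (fun w => ⟨w, hcomm _ _⟩) (by rw [hmax]; exact Ideal.subset_span (by simp)) hτ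
    (fun w => by
      obtain ⟨f, v, hv, hfv⟩ := hform w w.2
      by_cases hf : f ∈ IsLocalRing.maximalIdeal Λ
      · left
        rw [hmax, Ideal.mem_span_pair] at hf
        obtain ⟨a, b, rfl⟩ := hf
        refine ⟨τ ^ (q - 1) * algebraMap Λ E b + ⟨v, hv⟩, ?_⟩
        rw [mul_add, ← mul_assoc, mul_pow_sub_one hq, hτ]
        refine Subtype.ext ?_
        rw [hfv, map_add, map_mul, map_mul, hl, mul_zero, zero_add]
        change _ = (T • (1 : V)) * algebraMap Λ V b + t * v
        rw [Algebra.smul_def, mul_one, ← map_mul, ← map_mul, mul_comm]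
      · right
        obtain ⟨g, hg⟩ := (not_not.1 fun h => hf ((IsLocalRing.mem_maximalIdeal f).2 h) : IsUnit f)
        refine ⟨algebraMap Λ E ((g⁻¹ : Λˣ) : Λ), ⟨v, hv⟩ * algebraMap Λ E ((g⁻¹ : Λˣ) : Λ), ?_⟩
        refine Subtype.ext ?_
        change w.1 * algebraMap Λ V _ = 1 + t * (v * algebraMap Λ V _)
        rw [hfv, add_mul, ← map_mul, ← hg, Units.mul_inv, map_one, mul_assoc])
    (w := ⟨w, hw⟩) (fun h => hw0 (congrArg Subtype.val h))
  have hu' : w = t ^ j * u.1.1 := congrArg Subtype.val hu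
  have htu : IsUnit t := (isUnit_pow_iff hq).1 (ht ▸ hT)
  rw [hu']
  exact (htu.pow j).mul (u.isUnit.map E.val)

/-- The algebra `V` is a field if a localization of `Λ` at `(l)` acts on it and it is generated by
`x` with `x ^ q = 1 + T`, where `q` is a power of `l`. -/
theorem isUnit_and_commute_of_residue {l : ℕ} [hlp : Fact l.Prime] (hl2 : l ≠ 2) {T : Λ}
    (hmax : IsLocalRing.maximalIdeal Λ = Ideal.span {(l : Λ), T}) (hl : (l : V) = 0)
    (hT : T ∉ Ideal.span {(l : Λ)}) {x : V} {j : ℕ}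
    (hx : x ^ l ^ j = algebraMap Λ V (1 + T))
    (hu : ∀ f ∉ Ideal.span {(l : Λ)}, IsUnit (algebraMap Λ V f))
    (hgen : ∀ w : V, ∃ f ∉ Ideal.span {(l : Λ)}, f • w ∈ Algebra.adjoin Λ {x}) :
    (∀ w : V, w ≠ 0 → IsUnit w) ∧ ∀ w w' : V, w * w' = w' * w := by
  have hq : l ^ j ≠ 0 := pow_ne_zero _ hlp.1.ne_zero
  -- Frobenius in characteristic `l`: after the shift by one, the generator is an `l ^ j`-th root of
  -- `T`.
  have ht : (x - 1) ^ l ^ j = algebraMap Λ V T := by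
    obtain ⟨r, hr⟩ := (Commute.neg_one_right x).exists_add_pow_prime_pow_eq hlp.1 j
    have hodd : Odd (l ^ j) := (hlp.1.odd_of_ne_two hl2).pow
    rw [sub_eq_add_neg, hr, hx, hodd.neg_one_pow, hl, map_add, map_one]
    simp
  have hadj : Algebra.adjoin Λ {x} ≤ Algebra.adjoin Λ {x - 1} := by
    refine Algebra.adjoin_le ?_
    have := add_mem (Algebra.self_mem_adjoin_singleton Λ (x - 1)) (one_mem _)
    rw [sub_add_cancel] at this
    exact Set.singleton_subset_iff.2 this
  refine ⟨fun w hw => ?_, fun w w' => ?_⟩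
  · obtain ⟨f, hf, hfw⟩ := hgen w
    rw [Algebra.smul_def] at hfw
    have hne : algebraMap Λ V f * w ≠ 0 := fun h0 => hw ((hu f hf).mul_right_eq_zero.1 h0)
    have := isUnit_of_mem_adjoin_root hmax (by rw [map_natCast, hl]) hq ht (hu T hT) (hadj hfw) hne
    exact (Commute.isUnit_mul_iff (Algebra.commutes f w)).1 this |>.2
  · obtain ⟨f, hf, hfw⟩ := hgen w
    obtain ⟨g, hg, hgw⟩ := hgen w'
    have hc : (f • w) * (g • w') = (g • w') * (f • w) :=
      commute_of_mem_adjoin_singleton hfw hgw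
    rw [smul_mul_smul_comm, smul_mul_smul_comm, mul_comm g f, Algebra.smul_def,
      Algebra.smul_def, map_mul] at hc
    exact ((hu f hf).mul (hu g hg)).mul_left_cancel hc

end ResidueField

/-! ### From the order to the whole algebra -/

section NormalUniformizer

variable {O B : Type*} [CommRing O] [IsLocalRing O] [IsNoetherianRing O] [Ring B] [Nontrivial B]
  [Algebra O B]

/-- Nonzero elements of `W` are powers of `π` times units of `W`. For `b` in `B`, both `l ^ n` and
`l ^ n * b` have such a form for some `n`, and so has their quotient because conjugation by `π`
preserves `W`. -/
theorem exists_isNormalUniformizer (W : Subalgebra O B) [Module.Finite O W] {l : ℕ}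
    (hlm : (l : O) ∈ IsLocalRing.maximalIdeal O) (hlB : IsUnit (l : B)) {π : B} (hπ : π ∈ W)
    (hr : ∀ w ∈ W, ∃ w' ∈ W, w * π = π * w') (hl : ∀ w ∈ W, ∃ w' ∈ W, π * w = w' * π) {e : ℕ}
    (hpow : ∃ y ∈ W, π ^ e = l * y) (hlπ : ∃ y ∈ W, (l : B) = π * y)
    (hspan : ∀ b : B, ∃ n : ℕ, (l : B) ^ n * b ∈ W)
    (hdiv : ∀ w ∈ W, (∃ v ∈ W, w = π * v) ∨ ∃ w' ∈ W, ∃ v ∈ W, w * w' = 1 + π * v) :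
    ∃ ϖ : Bˣ, (ϖ : B) = π ∧ IsNormalUniformizer W.toSubring ϖ := by
  obtain ⟨y, hy, hly⟩ := hlπ
  -- Writing `l = π * y` also as `y' * π` supplies a left inverse of `π` besides the right one.
  obtain ⟨y', hy', hly'⟩ := hl y hy
  obtain ⟨L, hL⟩ := hlB
  have hLc : ∀ b : B, Commute (L : B) b := fun b => hL ▸ Nat.cast_commute l b
  have hLc' : ∀ b : B, Commute ((L⁻¹ : Bˣ) : B) b := fun b => (hLc b).units_inv_left
  have hinv1 : π * (y * ((L⁻¹ : Bˣ) : B)) = 1 := by rw [← mul_assoc, ← hly, ← hL, Units.mul_inv]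
  have hinv2 : ((L⁻¹ : Bˣ) : B) * y' * π = 1 := by
    rw [mul_assoc, ← hly', ← hly, ← hL, Units.inv_mul]
  let ϖ : Bˣ := ⟨π, y * ((L⁻¹ : Bˣ) : B), hinv1, by
    rwa [← left_inv_eq_right_inv hinv2 hinv1]⟩
  have hϖ : (ϖ : B) = π := rfl
  obtain ⟨z, hz, hez⟩ := hpow
  have hform : ∀ w ∈ W, w ≠ 0 → ∃ (j : ℕ) (u : Bˣ), (u : B) ∈ W ∧ ((u⁻¹ : Bˣ) : B) ∈ W ∧
      w = ((ϖ ^ j * u : Bˣ) : B) := by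
    intro w hw hw0
    obtain ⟨j, u, hu⟩ := exists_eq_pow_mul_unit (O := O) (W := W) (π := ⟨π, hπ⟩) (e := e)
      (m := (l : O)) (y := ⟨z, hz⟩)
      (fun w => by
        obtain ⟨w', hw', h⟩ := hr w w.2
        exact ⟨⟨w', hw'⟩, Subtype.ext h⟩) hlm
      (Subtype.ext (by simpa [Algebra.smul_def] using hez))
      (fun w => by
        rcases hdiv w w.2 with ⟨v, hv, h⟩ | ⟨w', hw', v, hv, h⟩
        · exact Or.inl ⟨⟨v, hv⟩, Subtype.ext h⟩
        · exact Or.inr ⟨⟨w', hw'⟩, ⟨v, hv⟩, Subtype.ext h⟩)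
      (w := ⟨w, hw⟩) (fun h => hw0 (congrArg Subtype.val h))
    refine ⟨j, Units.map (W.val : W →* B) u, u.1.2, u⁻¹.1.2, ?_⟩
    exact congrArg Subtype.val hu
  have hic : ∀ w ∈ W, ((ϖ⁻¹ : Bˣ) : B) * w * (ϖ : B) ∈ W := by
    intro w hw
    obtain ⟨w', hw', h⟩ := hr w hw
    rw [mul_assoc, hϖ, h, ← hϖ, Units.inv_mul_cancel_left]
    exact hw'
  have hc : ∀ w ∈ W, (ϖ : B) * w * ((ϖ⁻¹ : Bˣ) : B) ∈ W := by
    intro w hw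
    obtain ⟨w', hw', h⟩ := hl w hw
    rw [hϖ, h, ← hϖ, Units.mul_inv_cancel_right]
    exact hw'
  refine ⟨ϖ, rfl, ⟨fun b hb => ?_, hc, hic, hπ, fun hinv => ?_⟩⟩
  · obtain ⟨n, hn⟩ := hspan b
    have hlW : (l : B) ^ n ∈ W := pow_mem (natCast_mem W l) n
    obtain ⟨j, u, hu, hu', h1⟩ := hform _ hn (by
      rw [← hL, ← Units.val_pow_eq_pow_val]
      exact fun h0 => hb ((Units.mul_right_eq_zero _).1 h0))
    obtain ⟨i, t, ht, ht', h2⟩ := hform _ hlW (by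
      rw [← hL, ← Units.val_pow_eq_pow_val]; exact Units.ne_zero _)
    refine ⟨(j : ℤ) - i, ϖ ^ (-((j : ℤ) - i)) * t⁻¹ * ϖ ^ ((j : ℤ) - i) * u, ?_, ?_, ?_⟩
    · rw [Units.val_mul, Units.val_mul, Units.val_mul]
      exact mul_mem (zpow_conj_mem (W := W.toSubring) hc hic _ ht') hu
    · have h3 : (ϖ ^ (-((j : ℤ) - i)) * t⁻¹ * ϖ ^ ((j : ℤ) - i) * u)⁻¹ =
          u⁻¹ * (ϖ ^ (-((j : ℤ) - i)) * t * ϖ ^ ((j : ℤ) - i)) := by group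
      rw [h3, Units.val_mul, Units.val_mul, Units.val_mul]
      exact mul_mem hu' (zpow_conj_mem (W := W.toSubring) hc hic _ ht)
    · have h3 : b = (((ϖ ^ i * t)⁻¹ * (ϖ ^ j * u) : Bˣ) : B) := by
        rw [Units.val_mul, ← h1, h2, Units.inv_mul_cancel_left]
      rw [h3]
      congr 1
      group
  -- If `ϖ⁻¹` were in `W`, then `π ^ e = l * z` would give `l` an inverse in `W`, and `0` would be
  -- of the form `1 + l • w`, a unit by Nakayama.
  · have h1 : ((ϖ⁻¹ : Bˣ) : B) ^ e * z ∈ W := mul_mem (pow_mem hinv e) hz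
    have h2 : 1 + (l : O) • (-⟨_, h1⟩ : W) = 0 := by
      refine Subtype.ext ?_
      have : (l : B) * (((ϖ⁻¹ : Bˣ) : B) ^ e * z) = 1 := by
        rw [← mul_assoc, (Nat.cast_commute l _).eq, mul_assoc, ← hez, ← hϖ,
          ← Units.val_pow_eq_pow_val, ← Units.val_pow_eq_pow_val, ← Units.val_mul]
        simp
      simp [Algebra.smul_def, this]
    have h3 := isUnit_one_add_smul hlm (-⟨_, h1⟩ : W)
    rw [h2, isUnit_zero_iff] at h3
    exact one_ne_zero (congrArg Subtype.val h3).symm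

end NormalUniformizer

end Iwasawa

namespace Iwasawa

open WithZero

/-! ### The order spanned by a group with a cyclic normal part -/

section CyclicOrder

variable {B S : Type*} [Ring B] [Group S] (χ : S →* B)

/-- The element `χ h₀ - 1` is normal in the algebra spanned by `χ`, if `h₀` generates the image of a
normal subgroup. -/
theorem exists_normal_sub_one {A₀ : Type*} [CommRing A₀] [Algebra A₀ B] {HS : Subgroup S}
    (hn : HS.Normal) {h₀ : S} (hh₀ : h₀ ∈ HS) (hgen : ∀ h ∈ HS, ∃ i : ℕ, χ h = χ h₀ ^ i)
    {w : B} (hw : w ∈ Submodule.span A₀ (Set.range χ)) :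
    (∃ w' ∈ Algebra.adjoin A₀ (Set.range χ), w * (χ h₀ - 1) = (χ h₀ - 1) * w') ∧
      ∃ w' ∈ Algebra.adjoin A₀ (Set.range χ), (χ h₀ - 1) * w = w' * (χ h₀ - 1) := by
  have hmem : ∀ s, χ s ∈ Algebra.adjoin A₀ (Set.range χ) := fun s => Algebra.subset_adjoin ⟨s, rfl⟩
  have hgeom : ∀ n, ∑ i ∈ Finset.range n, χ h₀ ^ i ∈ Algebra.adjoin A₀ (Set.range χ) := fun n =>
    sum_mem fun i _ => pow_mem (hmem _) i
  induction hw using Submodule.span_induction with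
  | mem b hb =>
    obtain ⟨s, rfl⟩ := hb
    constructor
    · obtain ⟨i, hi⟩ := hgen _ (hn.conj_mem h₀ hh₀ s)
      refine ⟨(∑ j ∈ Finset.range i, χ h₀ ^ j) * χ s, mul_mem (hgeom i) (hmem s), ?_⟩
      rw [← mul_assoc, mul_geom_sum, ← hi, sub_mul, ← map_mul, inv_mul_cancel_right, map_mul,
        mul_sub, mul_one, one_mul]
    · obtain ⟨i, hi⟩ := hgen _ (hn.conj_mem h₀ hh₀ s⁻¹)
      refine ⟨χ s * (∑ j ∈ Finset.range i, χ h₀ ^ j), mul_mem (hmem s) (hgeom i), ?_⟩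
      rw [mul_assoc, geom_sum_mul, ← hi, mul_sub, ← map_mul]
      simp only [inv_inv, mul_assoc, mul_inv_cancel_left, map_mul, sub_mul, mul_one, one_mul]
  | zero => exact ⟨⟨0, zero_mem _, by simp⟩, ⟨0, zero_mem _, by simp⟩⟩
  | add a b _ _ iha ihb =>
    obtain ⟨⟨a', ha', h1⟩, ⟨a'', ha'', h2⟩⟩ := iha
    obtain ⟨⟨b', hb', h3⟩, ⟨b'', hb'', h4⟩⟩ := ihb
    exact ⟨⟨a' + b', add_mem ha' hb', by rw [add_mul, mul_add, h1, h3]⟩,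
      ⟨a'' + b'', add_mem ha'' hb'', by rw [mul_add, add_mul, h2, h4]⟩⟩
  | smul r a _ iha =>
    obtain ⟨⟨a', ha', h1⟩, ⟨a'', ha'', h2⟩⟩ := iha
    exact ⟨⟨r • a', Subalgebra.smul_mem _ ha' r, by rw [smul_mul_assoc, mul_smul_comm, h1]⟩,
      ⟨r • a'', Subalgebra.smul_mem _ ha'' r, by rw [smul_mul_assoc, mul_smul_comm, h2]⟩⟩

theorem mem_adjoin_range_iff {A₀ : Type*} [CommRing A₀] [Algebra A₀ B] {b : B} :
    b ∈ Algebra.adjoin A₀ (Set.range χ) ↔ b ∈ Submodule.span A₀ (Set.range χ) := by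
  rw [← Subalgebra.mem_toSubmodule, Algebra.adjoin_eq_span, ← MonoidHom.coe_mrange,
    Submonoid.closure_eq]

/-- A normal, topologically nilpotent element of the order spanned by a group with a normal
subgroup acting through a cyclic `l`-group, modulo which this subgroup acts trivially. -/
theorem exists_normal_element (A₀ : Type*) [CommRing A₀] [Algebra A₀ B] {l : ℕ}
    [hl : Fact l.Prime] (hl2 : l ≠ 2) {HS : Subgroup S}
    (hn : HS.Normal) {h₀ : S} (hh₀ : h₀ ∈ HS) (hgen : ∀ h ∈ HS, ∃ i : ℕ, χ h = χ h₀ ^ i)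
    {k : ℕ} (hk : h₀ ^ l ^ k = 1)
    (hζ : χ h₀ = 1 ∨ ∃ f : Polynomial ℤ, (l : B) = (χ h₀ - 1) * Polynomial.aeval (χ h₀) f) :
    ∃ π ∈ Algebra.adjoin A₀ (Set.range χ),
      (∀ w ∈ Algebra.adjoin A₀ (Set.range χ), ∃ w' ∈ Algebra.adjoin A₀ (Set.range χ),
        w * π = π * w') ∧
      (∀ w ∈ Algebra.adjoin A₀ (Set.range χ), ∃ w' ∈ Algebra.adjoin A₀ (Set.range χ),
        π * w = w' * π) ∧
      (∃ e : ℕ, ∃ y ∈ Algebra.adjoin A₀ (Set.range χ), π ^ e = l * y) ∧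
      (∃ y ∈ Algebra.adjoin A₀ (Set.range χ), (l : B) = π * y) ∧
      ∀ h ∈ HS, ∃ v ∈ Algebra.adjoin A₀ (Set.range χ), χ h = 1 + π * v := by
  set W := Algebra.adjoin A₀ (Set.range χ) with hW
  have hmem : ∀ s, χ s ∈ W := fun s => Algebra.subset_adjoin ⟨s, rfl⟩
  -- The element is `l` when `χ h₀ = 1`, and `χ h₀ - 1` otherwise.
  rcases hζ with h1 | ⟨f, hf⟩
  · refine ⟨l, natCast_mem W l, fun w hw => ⟨w, hw, (Nat.cast_commute l w).eq.symm⟩,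
      fun w hw => ⟨w, hw, (Nat.cast_commute l w).eq⟩, ⟨1, 1, one_mem _, by simp⟩,
      ⟨1, one_mem _, by simp⟩, fun h hh => ⟨0, zero_mem _, ?_⟩⟩
    obtain ⟨i, hi⟩ := hgen h hh
    simp [hi, h1]
  · refine ⟨χ h₀ - 1, sub_mem (hmem _) (one_mem _),
      fun w hw => (exists_normal_sub_one χ hn hh₀ hgen ((mem_adjoin_range_iff χ).1 hw)).1,
      fun w hw => (exists_normal_sub_one χ hn hh₀ hgen ((mem_adjoin_range_iff χ).1 hw)).2,
      ⟨l ^ k, ?_⟩, ⟨_, ?_, hf⟩, fun h hh => ?_⟩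
    -- Modulo `l`, the `l ^ k`-th power of `ζ - 1` is `ζ ^ l ^ k - 1 = 0`.
    · obtain ⟨r, hr⟩ := (Commute.neg_one_right (⟨χ h₀, hmem h₀⟩ : W)).exists_add_pow_prime_pow_eq
        hl.1 k
      refine ⟨-(χ h₀ * r), neg_mem (mul_mem (hmem _) r.2), ?_⟩
      have hodd : Odd (l ^ k) := (hl.1.odd_of_ne_two hl2).pow
      rw [hodd.neg_one_pow] at hr
      have hr' : (χ h₀ + -1) ^ l ^ k = χ h₀ ^ l ^ k + -1 + l * χ h₀ * -1 * r := by
        simpa using congrArg W.val hr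
      rw [sub_eq_add_neg, hr', ← map_pow, hk, map_one]
      simp [mul_assoc]
    · rw [Polynomial.aeval_eq_sum_range]
      exact sum_mem fun i _ => zsmul_mem (pow_mem (hmem _) i) _
    · obtain ⟨i, hi⟩ := hgen h hh
      refine ⟨∑ j ∈ Finset.range i, χ h₀ ^ j, sum_mem fun j _ => pow_mem (hmem _) j, ?_⟩
      rw [mul_geom_sum, hi]; abel

/-- Let `(l, T)` be the maximal ideal of `Λ`, and let `B` be an algebra spanned over the fraction
field of `Λ` by a group `S = ⟨h₀⟩ ⟨x⟩` such that `⟨h₀⟩` is a normal `l`-subgroup and `x ^ q` acts as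
`1 + T` up to `⟨h₀⟩`, where `q` is a power of `l`. Then `B` is a skew field, and the localization at
`(l)` of the order spanned by `S` is the valuation ring of a discrete valuation of `B` with
commutative residue field. -/
theorem exists_valuation_of_span {Λ : Type*} (A₀ : Type*) [CommRing Λ] [IsLocalRing Λ]
    [IsNoetherianRing Λ] {l : ℕ} [hlp : Fact l.Prime] (hl2 : l ≠ 2) {T : Λ}
    (hmax : IsLocalRing.maximalIdeal Λ = Ideal.span {(l : Λ), T})
    [hP : (Ideal.span {(l : Λ)}).IsPrime] (hT : T ∉ Ideal.span {(l : Λ)})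
    [CommRing A₀] [Algebra Λ A₀] [IsLocalization.AtPrime A₀ (Ideal.span {(l : Λ)})]
    [Nontrivial B] [Algebra Λ B] [Algebra A₀ B] [IsScalarTower Λ A₀ B]
    {HS : Subgroup S} (hn : HS.Normal) [Finite HS] {h₀ : S} (hh₀ : h₀ ∈ HS)
    (hgen : ∀ h ∈ HS, ∃ i : ℕ, χ h = χ h₀ ^ i) {k : ℕ} (hk : h₀ ^ l ^ k = 1)
    (hζ : χ h₀ = 1 ∨ ∃ f : Polynomial ℤ, (l : B) = (χ h₀ - 1) * Polynomial.aeval (χ h₀) f)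
    {x γ₀ : S} {j : ℕ} (hγ₀ : χ γ₀ = algebraMap Λ B (1 + T))
    (hS : ∀ s, ∃ h ∈ HS, ∃ i < l ^ j, ∃ d : ℤ, s = h * x ^ i * γ₀ ^ d)
    (hx : ∃ h ∈ HS, x ^ l ^ j = h * γ₀) (hlB : IsUnit (l : B))
    (hspan : ∀ b : B, ∃ n : ℕ, (l : B) ^ n * b ∈ Submodule.span A₀ (Set.range χ)) :
    (∀ b : B, b ≠ 0 → IsUnit b) ∧ ∃ v : Valuation B ℤᵐ⁰,
      (∃ t : Finset B, ∀ b, v b ≤ 1 ↔ b ∈ Submodule.span A₀ (t : Set B)) ∧ v (l : B) < 1 ∧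
      ∀ a b, v a ≤ 1 → v b ≤ 1 → v (a * b - b * a) < 1 := by
  classical
  have hlocal : IsLocalRing A₀ := IsLocalization.AtPrime.isLocalRing A₀ (Ideal.span {(l : Λ)})
  have hnoeth : IsNoetherianRing A₀ :=
    IsLocalization.isNoetherianRing (Ideal.span {(l : Λ)}).primeCompl A₀ inferInstance
  have hlm : (l : A₀) ∈ IsLocalRing.maximalIdeal A₀ := by
    rw [← map_natCast (algebraMap Λ A₀),
      IsLocalization.AtPrime.to_map_mem_maximal_iff A₀ (Ideal.span {(l : Λ)})]
    exact Ideal.mem_span_singleton_self _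
  have hTu : IsUnit (1 + T) := by
    by_contra h1
    have h2 : T ∈ IsLocalRing.maximalIdeal Λ := by rw [hmax]; exact Ideal.subset_span (by simp)
    have h3 := sub_mem ((IsLocalRing.mem_maximalIdeal _).2 h1) h2
    rw [add_sub_cancel_right] at h3
    exact (Ideal.ne_top_iff_one _).1 (IsLocalRing.maximalIdeal.isMaximal Λ).ne_top h3
  obtain ⟨u, hu⟩ := hTu
  have hγ : ∀ d : ℤ, χ (γ₀ ^ d) = algebraMap Λ B ((u ^ d : Λˣ) : Λ) := by
    have h1 : χ.toHomUnits γ₀ = Units.map (algebraMap Λ B : Λ →* B) u :=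
      Units.ext (by simp [hγ₀, hu])
    intro d
    have h2 : χ.toHomUnits (γ₀ ^ d) = Units.map (algebraMap Λ B : Λ →* B) (u ^ d) := by
      rw [map_zpow, map_zpow, h1]
    exact congrArg Units.val h2
  set W := Algebra.adjoin A₀ (Set.range χ) with hW
  have hmem : ∀ s, χ s ∈ W := fun s => Algebra.subset_adjoin ⟨s, rfl⟩
  -- Powers of `γ₀` act as units of `Λ`, so the finitely many `h * x ^ i` with `i < l ^ j` already
  -- span the order.
  obtain ⟨t, ht⟩ : ∃ t : Finset B, Submodule.span A₀ (t : Set B) =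
      Submodule.span A₀ (Set.range χ) := by
    have hfin : (Set.range fun z : HS × Fin (l ^ j) => χ (z.1 * x ^ (z.2 : ℕ))).Finite :=
      Set.finite_range _
    refine ⟨hfin.toFinset, ?_⟩
    rw [Set.Finite.coe_toFinset]
    refine le_antisymm ?_ ?_ <;> rw [Submodule.span_le]
    · rintro _ ⟨z, rfl⟩
      exact Submodule.subset_span ⟨_, rfl⟩
    · rintro _ ⟨s, rfl⟩
      obtain ⟨h, hh, i, hi, d, rfl⟩ := hS s
      have h1 : χ (h * x ^ i * γ₀ ^ d) =
          algebraMap Λ A₀ ((u ^ d : Λˣ) : Λ) • χ (h * x ^ i) := by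
        rw [map_mul, hγ, ← Algebra.commutes, IsScalarTower.algebraMap_apply Λ A₀ B,
          ← Algebra.smul_def]
      rw [h1]
      exact Submodule.smul_mem _ _ (Submodule.subset_span ⟨(⟨h, hh⟩, ⟨i, hi⟩), rfl⟩)
  have hfin : Module.Finite A₀ W := by
    refine Module.Finite.iff_fg (N := Subalgebra.toSubmodule W).2 ⟨t, ?_⟩
    rw [ht]
    ext b
    rw [Subalgebra.mem_toSubmodule, mem_adjoin_range_iff]
  obtain ⟨π, hπ, hr, hl, ⟨e, hpow⟩, hlπ, hHS⟩ :=
    exists_normal_element χ A₀ hl2 hn hh₀ hgen hk hζ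
  let I : TwoSidedIdeal W := TwoSidedIdeal.mk' {w | ∃ v : W, w = ⟨π, hπ⟩ * v}
    ⟨0, by simp⟩
    (by rintro _ _ ⟨v, rfl⟩ ⟨v', rfl⟩; exact ⟨v + v', by rw [mul_add]⟩)
    (by rintro _ ⟨v, rfl⟩; exact ⟨-v, by rw [mul_neg]⟩)
    (by
      rintro w _ ⟨v, rfl⟩
      obtain ⟨w', hw', h⟩ := hr w w.2
      refine ⟨⟨w', hw'⟩ * v, ?_⟩
      rw [← mul_assoc, ← mul_assoc]
      congr 1
      exact Subtype.ext h)
    (by rintro _ w ⟨v, rfl⟩; exact ⟨v * w, by rw [mul_assoc]⟩)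
  let mk : W →+* I.ringCon.Quotient := I.ringCon.mk'
  have hmks : Function.Surjective mk := I.ringCon.mk'_surjective
  have hmk0 : ∀ w : W, mk w = 0 ↔ ∃ v ∈ W, (w : B) = π * v := by
    intro w
    have h1 : mk w = 0 ↔ w ∈ I := by
      rw [TwoSidedIdeal.mem_iff, ← RingCon.eq]; rfl
    rw [h1, TwoSidedIdeal.mem_mk']
    exact ⟨fun ⟨v, hv⟩ => ⟨v, v.2, congrArg Subtype.val hv⟩,
      fun ⟨v, hv, h⟩ => ⟨⟨v, hv⟩, Subtype.ext h⟩⟩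
  have hmkΛ : ∀ f : Λ, algebraMap Λ I.ringCon.Quotient f = mk (algebraMap Λ W f) := fun f => rfl
  have hHS' : ∀ h (hh : h ∈ HS), mk ⟨χ h, hmem h⟩ = 1 := by
    intro h hh
    obtain ⟨v, hv, h1⟩ := hHS h hh
    rw [← sub_eq_zero, ← map_one mk, ← map_sub, hmk0]
    exact ⟨v, hv, by simp [h1]⟩
  have hunit : ∀ f ∉ Ideal.span {(l : Λ)}, IsUnit (algebraMap Λ I.ringCon.Quotient f) := by
    intro f hf
    have h1 : IsUnit (algebraMap Λ A₀ f) :=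
      IsLocalization.map_units A₀ (⟨f, hf⟩ : (Ideal.span {(l : Λ)}).primeCompl)
    rw [hmkΛ, IsScalarTower.algebraMap_apply Λ A₀ W]
    exact (h1.map (algebraMap A₀ W)).map mk
  -- Modulo `π` the subgroup `HS` is trivial, so the residue ring is generated by `x` alone, up to
  -- denominators prime to `l`, and `x ^ l ^ j` becomes `1 + T`.
  obtain ⟨hVu, hVc⟩ := isUnit_and_commute_of_residue (V := I.ringCon.Quotient) hl2 hmax
    (by
      rw [← map_natCast mk, hmk0]
      exact hlπ)
    hT (x := mk ⟨χ x, hmem x⟩) (j := j)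
    (by
      obtain ⟨h, hh, hxh⟩ := hx
      have h1 : (⟨χ x, hmem x⟩ : W) ^ l ^ j = ⟨χ h, hmem h⟩ * algebraMap Λ W (1 + T) := by
        refine Subtype.ext ?_
        change χ x ^ l ^ j = χ h * algebraMap Λ B (1 + T)
        rw [← map_pow, hxh, map_mul, hγ₀]
      rw [← map_pow, h1, map_mul, hHS' h hh, one_mul, hmkΛ])
    hunit
    (by
      intro w
      obtain ⟨⟨w, hw⟩, rfl⟩ := hmks w
      have hw' := (mem_adjoin_range_iff χ).1 hw
      induction hw' using Submodule.span_induction with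
      | mem b hb =>
        obtain ⟨s, rfl⟩ := hb
        obtain ⟨h, hh, i, hi, d, rfl⟩ := hS s
        refine ⟨1, (Ideal.ne_top_iff_one _).1 hP.ne_top, ?_⟩
        have h1 : (⟨χ (h * x ^ i * γ₀ ^ d), hw⟩ : W) =
            ⟨χ h, hmem h⟩ * ⟨χ x, hmem x⟩ ^ i * algebraMap Λ W ((u ^ d : Λˣ) : Λ) := by
          refine Subtype.ext ?_
          change χ (h * x ^ i * γ₀ ^ d) = χ h * χ x ^ i * algebraMap Λ B _
          rw [map_mul, map_mul, map_pow, hγ]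
        rw [one_smul, h1, map_mul, map_mul, hHS' h hh, one_mul, map_pow, ← hmkΛ]
        exact mul_mem (pow_mem (Algebra.self_mem_adjoin_singleton _ _) _)
          (Subalgebra.algebraMap_mem _ _)
      | zero =>
        refine ⟨1, (Ideal.ne_top_iff_one _).1 hP.ne_top, ?_⟩
        have h1 : mk ⟨0, hw⟩ = 0 := map_zero mk
        rw [h1, smul_zero]
        exact zero_mem _
      | add a b ha hb iha ihb =>
        obtain ⟨f, hf, hfa⟩ := iha ((mem_adjoin_range_iff χ).2 ha)
        obtain ⟨g, hg, hgb⟩ := ihb ((mem_adjoin_range_iff χ).2 hb)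
        refine ⟨f * g, fun h => (hP.mem_or_mem h).elim hf hg, ?_⟩
        have h1 : mk ⟨a + b, hw⟩ = mk ⟨a, (mem_adjoin_range_iff χ).2 ha⟩ +
          mk ⟨b, (mem_adjoin_range_iff χ).2 hb⟩ := by rw [← map_add]; rfl
        rw [h1, smul_add]
        refine add_mem ?_ ?_
        · rw [mul_comm, mul_smul]
          exact Subalgebra.smul_mem _ hfa g
        · rw [mul_smul]
          exact Subalgebra.smul_mem _ hgb f
      | smul r a ha iha =>
        obtain ⟨f, hf, hfa⟩ := iha ((mem_adjoin_range_iff χ).2 ha)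
        obtain ⟨⟨c, g⟩, hcg⟩ := IsLocalization.surj (Ideal.span {(l : Λ)}).primeCompl r
        refine ⟨g * f, fun h => (hP.mem_or_mem h).elim g.2 hf, ?_⟩
        have h1 : (g : Λ) • mk ⟨r • a, hw⟩ = c • mk ⟨a, (mem_adjoin_range_iff χ).2 ha⟩ := by
          rw [Algebra.smul_def (g : Λ), Algebra.smul_def c, hmkΛ, hmkΛ, ← map_mul, ← map_mul]
          congr 1
          refine Subtype.ext ?_
          change algebraMap Λ B g * (r • a) = algebraMap Λ B c * a
          rw [IsScalarTower.algebraMap_apply Λ A₀ B, IsScalarTower.algebraMap_apply Λ A₀ B,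
            ← hcg, Algebra.smul_def, ← mul_assoc, ← map_mul, mul_comm r]
        rw [mul_comm, mul_smul, h1, smul_comm]
        exact Subalgebra.smul_mem _ hfa c)
  obtain ⟨ϖ, hϖ, hnu⟩ := exists_isNormalUniformizer W hlm hlB hπ hr hl hpow hlπ
    (fun b => by
      obtain ⟨n, hn⟩ := hspan b
      exact ⟨n, (mem_adjoin_range_iff χ).2 hn⟩)
    (fun w hw => by
      by_cases h0 : mk ⟨w, hw⟩ = 0
      · exact Or.inl ((hmk0 _).1 h0)
      · obtain ⟨b, hb⟩ := (hVu _ h0).exists_right_inv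
        obtain ⟨b, rfl⟩ := hmks b
        rw [← map_mul, ← sub_eq_zero, ← map_one mk, ← map_sub, hmk0] at hb
        obtain ⟨v, hv, h⟩ := hb
        refine Or.inr ⟨b, b.2, v, hv, ?_⟩
        rw [← h]
        simp)
  refine ⟨fun b hb => hnu.isUnit hb, hnu.valuation, ⟨t, fun b => ?_⟩, ?_, fun a b ha hb => ?_⟩
  · rw [hnu.valuation_le_one_iff, ht, ← mem_adjoin_range_iff]; rfl
  · obtain ⟨y, hy, hly⟩ := hlπ
    rw [hnu.valuation_lt_one_iff, hly, ← hϖ, Units.inv_mul_cancel_left]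
    exact hy
  · rw [hnu.valuation_le_one_iff] at ha hb
    rw [hnu.valuation_lt_one_iff]
    have h1 : mk (⟨a, ha⟩ * ⟨b, hb⟩ - ⟨b, hb⟩ * ⟨a, ha⟩) = 0 := by
      rw [map_sub, map_mul, map_mul, hVc, sub_self]
    obtain ⟨v, hv, h2⟩ := (hmk0 _).1 h1
    have h3 : a * b - b * a = π * v := h2
    rw [h3, ← hϖ, Units.inv_mul_cancel_left]
    exact hv

end CyclicOrder

end Iwasawa

noncomputable section

namespace Iwasawa

open Module WithZero

/-! ### Norms of integral vectors -/

section Lattice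

variable {K' B Γ : Type*} [Field K'] [Ring B] [Algebra K' B] [LinearOrderedCommGroupWithZero Γ]
  (u : Valuation K' Γ) {ι : Type*} (b : Basis ι K' B)

/-- The elements of `B` with integral coordinates. -/
def IsIntegralVector (x : B) : Prop := ∀ i, u (b.repr x i) ≤ 1

variable {u b}

theorem IsIntegralVector.add {x y : B} (hx : IsIntegralVector u b x)
    (hy : IsIntegralVector u b y) : IsIntegralVector u b (x + y) := fun i => by
  rw [map_add, Finsupp.add_apply]
  exact u.map_add_le (hx i) (hy i)

theorem IsIntegralVector.zero : IsIntegralVector u b 0 := fun i => by simp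

theorem IsIntegralVector.smul {c : K'} (hc : u c ≤ 1) {x : B} (hx : IsIntegralVector u b x) :
    IsIntegralVector u b (c • x) := fun i => by
  rw [map_smul, Finsupp.smul_apply, smul_eq_mul, map_mul]
  exact mul_le_one' hc (hx i)

theorem IsIntegralVector.sum {α : Type*} {s : Finset α} {f : α → B}
    (h : ∀ a ∈ s, IsIntegralVector u b (f a)) : IsIntegralVector u b (∑ a ∈ s, f a) :=
  Finset.sum_induction f _ (fun _ _ => .add) .zero h

variable [Fintype ι]

theorem IsIntegralVector.mul (hb : ∀ i j, IsIntegralVector u b (b i * b j)) {x y : B}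
    (hx : IsIntegralVector u b x) (hy : IsIntegralVector u b y) :
    IsIntegralVector u b (x * y) := by
  rw [← b.sum_repr x, ← b.sum_repr y, Finset.sum_mul_sum]
  refine .sum fun i _ => .sum fun j _ => ?_
  rw [smul_mul_smul_comm]
  exact .smul ((map_mul u _ _).trans_le (mul_le_one' (hx i) (hy j))) (hb i j)

theorem det_le_one [DecidableEq ι] {M : Matrix ι ι K'} (hM : ∀ i j, u (M i j) ≤ 1) :
    u M.det ≤ 1 := by
  rw [Matrix.det_apply]
  refine u.map_sum_le fun σ _ => ?_
  rw [Units.smul_def, zsmul_eq_mul, map_mul, map_prod]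
  refine mul_le_one' ?_ (Finset.prod_le_one' fun i _ => hM _ _)
  rcases Int.units_eq_one_or (Equiv.Perm.sign σ) with h | h <;> simp [h]

theorem IsIntegralVector.leftMulMatrix [DecidableEq ι]
    (hb : ∀ i j, IsIntegralVector u b (b i * b j)) {x : B}
    (hx : IsIntegralVector u b x) (i j : ι) : u (Algebra.leftMulMatrix b x i j) ≤ 1 := by
  rw [Algebra.leftMulMatrix_eq_repr_mul]
  refine IsIntegralVector.mul hb hx (fun k => ?_) i
  rw [b.repr_self]
  by_cases h : j = k <;> simp [h]

theorem IsIntegralVector.norm (hb : ∀ i j, IsIntegralVector u b (b i * b j)) {x : B}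
    (hx : IsIntegralVector u b x) : u (Algebra.norm K' x) ≤ 1 := by
  classical
  rw [Algebra.norm_eq_matrix_det b]
  exact det_le_one (hx.leftMulMatrix hb)

theorem IsIntegralVector.norm_one_add_smul (hb : ∀ i j, IsIntegralVector u b (b i * b j)) {x : B}
    (hx : IsIntegralVector u b x) {p : K'} (hp : u p < 1) :
    u (Algebra.norm K' (1 + p • x)) = 1 := by
  classical
  -- Expanding `det (1 + p N)` over the ring of integers, not over the field, shows that everything
  -- beyond the leading `1` is `p` times an integral element.
  let N : Matrix ι ι u.integer := fun i j => ⟨_, hx.leftMulMatrix hb i j⟩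
  have hN : N.map u.integer.subtype = Algebra.leftMulMatrix b x := by ext; rfl
  let p' : u.integer := ⟨p, hp.le⟩
  have h1 := congrArg u.integer.subtype (Matrix.det_one_add_smul p' N)
  rw [RingHom.map_det, map_add, RingHom.map_one, RingHom.mapMatrix_apply,
    Matrix.map_smul' _ _ _ (map_mul _), hN] at h1
  have h2 : Algebra.norm K' (1 + p • x) = 1 + (N.trace + Polynomial.eval p'
      ((1 + (Polynomial.X : Polynomial u.integer) • N.map Polynomial.C).det.divX.divX) * p' :
      u.integer) * p := by
    rw [Algebra.norm_eq_matrix_det b, map_add, map_one, map_smul]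
    refine h1.trans ?_
    simp [p']
    ring
  rw [h2]
  refine u.map_one_add_of_lt ?_
  rw [map_mul]
  exact (mul_le_of_le_one_left' (Subtype.prop (p := fun x => u x ≤ 1) _)).trans_lt hp

variable (K') in
theorem isUnit_of_norm_ne_zero [Module.Finite K' B] {x : B} (hx : Algebra.norm K' x ≠ 0) :
    IsUnit x := by
  rw [Algebra.norm_apply] at hx
  have h1 : IsUnit (LinearMap.det (LinearMap.mulLeft K' x)) := isUnit_iff_ne_zero.2 hx
  have h2 := (LinearMap.isUnit_iff_isUnit_det _).2 h1
  obtain ⟨y, hy⟩ := ((Module.End.isUnit_iff _).1 h2).2 1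
  exact isUnit_of_mul_eq_one_of_finite K' hy

end Lattice

/-! ### The norm valuation on the completed skew field -/

section Completion

variable {K K' D Γ : Type*} [Field K] [DivisionRing D] [Algebra K D] [Field K'] [Algebra K K']
  [LinearOrderedCommGroupWithZero Γ] {u : Valuation K' Γ} {v : Valuation D ℤᵐ⁰}
  {ι : Type*} [Fintype ι] {b : Basis ι K D} {p : K}

omit [Fintype ι] in
theorem isIntegralVector_tmul (hb : ∀ d, v d ≤ 1 ↔ ∀ i, u (algebraMap K K' (b.repr d i)) ≤ 1)
    {d : D} : IsIntegralVector u (Algebra.TensorProduct.basis K' b) (1 ⊗ₜ d) ↔ v d ≤ 1 := by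
  rw [hb]
  refine forall_congr' fun i => ?_
  rw [Algebra.TensorProduct.basis_repr_tmul]
  simp

omit [Fintype ι] in
theorem isIntegralVector_basis_mul_basis
    (hb : ∀ d, v d ≤ 1 ↔ ∀ i, u (algebraMap K K' (b.repr d i)) ≤ 1) (i j : ι) :
    IsIntegralVector u (Algebra.TensorProduct.basis K' b)
      (Algebra.TensorProduct.basis K' b i * Algebra.TensorProduct.basis K' b j) := by
  have h1 : ∀ i, v (b i) ≤ 1 := fun i => (hb _).2 fun j => by
    rw [b.repr_self]
    by_cases h : i = j <;> simp [h]
  rw [Algebra.TensorProduct.basis_apply, Algebra.TensorProduct.basis_apply,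
    Algebra.TensorProduct.tmul_mul_tmul, one_mul, isIntegralVector_tmul hb, map_mul]
  exact mul_le_one' (h1 i) (h1 j)

/-- An element of `K' ⊗ D` is approximated by an element of `D`. -/
theorem exists_eq_tmul_mul_one_add
    (hb : ∀ d, v d ≤ 1 ↔ ∀ i, u (algebraMap K K' (b.repr d i)) ≤ 1) (hp : p ≠ 0)
    (hp1 : u (algebraMap K K' p) < 1)
    (hdense : ∀ (c : K') (γ : Γ), γ ≠ 0 → ∃ a : K, u (c - algebraMap K K' a) < γ)
    {x : K' ⊗[K] D} (hx : x ≠ 0) :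
    ∃ d : D, d ≠ 0 ∧ ∃ z, IsIntegralVector u (Algebra.TensorProduct.basis K' b) z ∧
      x = (1 ⊗ₜ d) * (1 + algebraMap K K' p • z) := by
  classical
  set B := Algebra.TensorProduct.basis K' b with hB
  set p' := algebraMap K K' p with hp'
  have hp0 : p' ≠ 0 := (map_ne_zero _).2 hp
  have hι : Nonempty ι := by
    by_contra h
    rw [not_nonempty_iff] at h
    exact hx (B.ext_elem fun i => h.elim i)
  obtain ⟨i₀, hi₀⟩ := Finite.exists_max fun i => u (B.repr x i)
  have hM : u (B.repr x i₀) ≠ 0 := by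
    intro h0
    refine hx (B.ext_elem fun i => ?_)
    have h1 := hi₀ i
    rw [h0, le_zero_iff, map_eq_zero] at h1
    simp [h1]
  -- The coordinates of `x` are approximated to precision `p ^ 2` relative to the largest one. One
  -- factor `p` is spent making a multiple of `d⁻¹` integral, the other survives in `1 + p • z`.
  have hγ : u p' ^ 2 * u (B.repr x i₀) ≠ 0 :=
    mul_ne_zero (pow_ne_zero _ ((map_ne_zero u).2 hp0)) hM
  choose a ha using fun i => hdense (B.repr x i) _ hγ
  have hle : u p' ^ 2 * u (B.repr x i₀) ≤ u (B.repr x i₀) :=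
    mul_le_of_le_one_left' (pow_le_one' hp1.le _)
  have ha₀ : u (algebraMap K K' (a i₀)) = u (B.repr x i₀) :=
    (u.map_eq_of_sub_lt (by rw [Valuation.map_sub_swap]; exact (ha i₀).trans_le hle))
  have hane : a i₀ ≠ 0 := by
    rintro h
    rw [h, map_zero, map_zero] at ha₀
    exact hM ha₀.symm
  set d : D := ∑ i, a i • b i with hd
  have hrepr : ∀ i, b.repr d i = a i := fun i => by rw [hd, b.repr_sum_self]
  have hd0 : d ≠ 0 := by
    intro h
    apply hane
    rw [← hrepr, h]
    simp
  -- The vector `(a i₀ * p)⁻¹ • d` has the non-integral coordinate `p⁻¹`, so it is outside the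
  -- valuation ring; since `v` is a valuation, its inverse has value `< 1`.
  have hm : v ((a i₀ * p) • d⁻¹) < 1 := by
    have h1 : ¬ v ((a i₀ * p)⁻¹ • d) ≤ 1 := by
      rw [hb]
      intro h
      have h2 := h i₀
      rw [map_smul, Finsupp.smul_apply, hrepr, smul_eq_mul, mul_inv_rev, inv_mul_cancel_right₀ hane,
        map_inv₀, map_inv₀] at h2
      exact absurd hp1 (not_lt.2 ((inv_le_one₀ (zero_lt_iff.2 ((map_ne_zero u).2 hp0))).1 h2))
    have h2 : (a i₀ * p) • d⁻¹ = ((a i₀ * p)⁻¹ • d)⁻¹ := by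
      rw [Algebra.smul_def, Algebra.smul_def, mul_inv_rev, map_inv₀, inv_inv]
      exact (Algebra.commutes _ _)
    rw [h2, map_inv₀]
    exact inv_lt_one_of_one_lt₀ (not_le.1 h1)
  set c : K' := algebraMap K K' (a i₀) * p' ^ 2 with hc
  have hc0 : c ≠ 0 := mul_ne_zero ((map_ne_zero _).2 hane) (pow_ne_zero _ hp0)
  set z₀ := c⁻¹ • (x - 1 ⊗ₜ d) with hz₀
  have hz₀i : IsIntegralVector u B z₀ := by
    intro i
    rw [hz₀, map_smul, Finsupp.smul_apply, map_sub, Finsupp.sub_apply,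
      Algebra.TensorProduct.basis_repr_tmul]
    simp only [Finsupp.mapRange_apply, hrepr, one_smul, smul_eq_mul,
      map_mul, map_inv₀]
    rw [inv_mul_le_one₀ (zero_lt_iff.2 ((map_ne_zero u).2 hc0)), hc, map_mul, map_pow, ha₀,
      mul_comm]
    simpa [Algebra.smul_def] using (ha i).le
  refine ⟨d, hd0, (1 ⊗ₜ ((a i₀ * p) • d⁻¹)) * z₀,
    .mul (isIntegralVector_basis_mul_basis hb) ((isIntegralVector_tmul hb).2 hm.le) hz₀i, ?_⟩
  have h1 : x = 1 ⊗ₜ d + c • z₀ := by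
    rw [hz₀, smul_inv_smul₀ hc0, add_sub_cancel]
  have h2 : (1 ⊗ₜ ((a i₀ * p) • d⁻¹) : K' ⊗[K] D) = algebraMap K K' (a i₀ * p) • (1 ⊗ₜ d⁻¹) := by
    rw [TensorProduct.tmul_smul, TensorProduct.smul_tmul', TensorProduct.smul_tmul',
      Algebra.smul_def, smul_eq_mul]
  rw [mul_add, mul_one, h2, smul_mul_assoc, smul_smul, mul_smul_comm, ← mul_assoc,
    Algebra.TensorProduct.tmul_mul_tmul, mul_inv_cancel₀ hd0, one_mul,
    ← Algebra.TensorProduct.one_def, one_mul]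
  rw [h1]
  congr 2
  rw [hc, map_mul]; ring

theorem exists_pow_le_of_lt_one {x y : ℤᵐ⁰} (hx : x < 1) (hy : y ≠ 0) : ∃ k : ℕ, x ^ k ≤ y := by
  obtain ⟨k, hk⟩ := exists_pow_lt₀ hx (Units.mk0 y hy)
  exact ⟨k, hk.le⟩

theorem norm_tmul_ne_zero {d : D} (hd : d ≠ 0) : Algebra.norm K' (1 ⊗ₜ d : K' ⊗[K] D) ≠ 0 := by
  refine (IsUnit.map (Algebra.norm K') (x := (1 ⊗ₜ d : K' ⊗[K] D)) ?_).ne_zero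
  exact (isUnit_iff_ne_zero.2 hd).map (Algebra.TensorProduct.includeRight : D →ₐ[K] K' ⊗[K] D)

variable (hb : ∀ d, v d ≤ 1 ↔ ∀ i, u (algebraMap K K' (b.repr d i)) ≤ 1)
include hb

theorem norm_tmul_le_one {d : D} (hd : v d ≤ 1) :
    u (Algebra.norm K' (1 ⊗ₜ d : K' ⊗[K] D)) ≤ 1 :=
  ((isIntegralVector_tmul hb).2 hd).norm (isIntegralVector_basis_mul_basis hb)

/-- A power of `d` is `p` times an integral element, and the norm of `p` is a positive power of `p`.
-/
theorem norm_tmul_lt_one [Nonempty ι] (hp : p ≠ 0) (hp1 : u (algebraMap K K' p) < 1) {d : D}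
    (hd : v d < 1) : u (Algebra.norm K' (1 ⊗ₜ d : K' ⊗[K] D)) < 1 := by
  obtain ⟨k, hk⟩ := exists_pow_le_of_lt_one hd
    (y := v (algebraMap K D p)) ((map_ne_zero v).2 ((map_ne_zero _).2 hp))
  have h1 : v (p⁻¹ • d ^ k) ≤ 1 := by
    rw [Algebra.smul_def, map_mul, map_inv₀, map_inv₀, map_pow]
    exact inv_mul_le_one_of_le₀ hk zero_le
  have h2 : (1 ⊗ₜ d : K' ⊗[K] D) ^ k =
      algebraMap K' _ (algebraMap K K' p) * (1 ⊗ₜ (p⁻¹ • d ^ k)) := by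
    rw [Algebra.TensorProduct.tmul_pow, one_pow, Algebra.TensorProduct.algebraMap_apply,
      Algebra.TensorProduct.tmul_mul_tmul, one_mul, mul_one, Algebra.algebraMap_self_apply,
      Algebra.algebraMap_eq_smul_one p, TensorProduct.smul_tmul, smul_inv_smul₀ hp]
  have h3 : u (Algebra.norm K' (1 ⊗ₜ d : K' ⊗[K] D)) ^ k < 1 := by
    rw [← map_pow, ← map_pow, h2, map_mul, map_mul,
      Algebra.norm_algebraMap_of_basis (Algebra.TensorProduct.basis K' b), map_pow]
    exact mul_lt_one_of_lt_of_le (pow_lt_one₀ zero_le hp1 Fintype.card_ne_zero)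
      (norm_tmul_le_one hb h1)
  by_contra h
  exact absurd h3 (not_lt.2 (one_le_pow_of_one_le' (not_lt.1 h) k))

variable (hp : p ≠ 0) (hp1 : u (algebraMap K K' p) < 1)
  (hdense : ∀ (c : K') (γ : Γ), γ ≠ 0 → ∃ a : K, u (c - algebraMap K K' a) < γ)
include hp hp1 hdense

theorem norm_tensor_ne_zero {x : K' ⊗[K] D} (hx : x ≠ 0) : Algebra.norm K' x ≠ 0 := by
  obtain ⟨d, hd, z, hz, rfl⟩ := exists_eq_tmul_mul_one_add hb hp hp1 hdense hx
  rw [map_mul]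
  refine mul_ne_zero (norm_tmul_ne_zero hd) fun h => ?_
  have h1 := hz.norm_one_add_smul (isIntegralVector_basis_mul_basis hb) hp1
  rw [h, map_zero] at h1
  exact zero_ne_one h1

/-- An element of `K' ⊗ D` with integral norm is, up to a multiple of `p`, an integral element
of `D`. -/
theorem exists_eq_tmul_add_of_norm_le_one [Nonempty ι] {x : K' ⊗[K] D}
    (hx : u (Algebra.norm K' x) ≤ 1) :
    ∃ d : D, v d ≤ 1 ∧ ∃ z, IsIntegralVector u (Algebra.TensorProduct.basis K' b) z ∧
      x = (1 ⊗ₜ d) + algebraMap K K' p • z := by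
  by_cases hx0 : x = 0
  · exact ⟨0, by simp, 0, .zero, by simp [hx0]⟩
  obtain ⟨d, hd, z, hz, rfl⟩ := exists_eq_tmul_mul_one_add hb hp hp1 hdense hx0
  rw [map_mul, map_mul, hz.norm_one_add_smul (isIntegralVector_basis_mul_basis hb) hp1,
    mul_one] at hx
  -- As `1 + p • z` has norm of value one, `d` has integral norm; if `v d > 1`, then `d⁻¹` would
  -- have norm of value `< 1`.
  have hvd : v d ≤ 1 := by
    by_contra h
    have h1 := norm_tmul_lt_one hb hp hp1 (d := d⁻¹)
      (by rw [map_inv₀]; exact inv_lt_one_of_one_lt₀ (not_le.1 h))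
    have h2 := mul_lt_one_of_lt_of_le h1 hx
    rw [← map_mul, ← map_mul, Algebra.TensorProduct.tmul_mul_tmul, inv_mul_cancel₀ hd, one_mul,
      ← Algebra.TensorProduct.one_def, map_one, map_one] at h2
    exact lt_irrefl _ h2
  exact ⟨d, hvd, _, ((isIntegralVector_tmul hb).2 hvd).mul (isIntegralVector_basis_mul_basis hb) hz,
    by rw [mul_add, mul_one, mul_smul_comm]⟩

/-- The unit ball of the norm is thus an additive group. After division by the element of larger
norm, this is the ultrametric inequality for `normValuation`. -/
theorem norm_le_one_iff [Nonempty ι] {x : K' ⊗[K] D} :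
    u (Algebra.norm K' x) ≤ 1 ↔ IsIntegralVector u (Algebra.TensorProduct.basis K' b) x := by
  refine ⟨fun h => ?_, fun h => h.norm (isIntegralVector_basis_mul_basis hb)⟩
  obtain ⟨d, hd, z, hz, rfl⟩ := exists_eq_tmul_add_of_norm_le_one hb hp hp1 hdense h
  exact ((isIntegralVector_tmul hb).2 hd).add (hz.smul hp1.le)

/-- The valuation of `K' ⊗ D` given by the norm to `K'`. -/
def normValuation [Nonempty ι] : Valuation (K' ⊗[K] D) Γ where
  toFun x := u (Algebra.norm K' x)
  map_zero' := by
    have := Module.Finite.of_basis b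
    have : Nontrivial (K' ⊗[K] D) := (Algebra.TensorProduct.basis K' b).repr.toEquiv.nontrivial
    rw [Algebra.norm_zero, map_zero]
  map_one' := by simp
  map_mul' x y := by simp
  map_add_le_max' := by
    have key : ∀ x y : K' ⊗[K] D, u (Algebra.norm K' x) ≤ u (Algebra.norm K' y) →
        u (Algebra.norm K' (x + y)) ≤ u (Algebra.norm K' y) := by
      intro x y hxy
      by_cases hy : y = 0
      · rw [hy] at hxy ⊢
        rwa [add_zero]
      · have := Module.Finite.of_basis b
        have hN := norm_tensor_ne_zero hb hp hp1 hdense hy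
        obtain ⟨y', hy'⟩ := isUnit_of_norm_ne_zero K' hN
        have hN' : u (Algebra.norm K' y) ≠ 0 := (map_ne_zero u).2 hN
        have h1 : ∀ z : K' ⊗[K] D, u (Algebra.norm K' z) =
            u (Algebra.norm K' (z * (y'⁻¹ : (K' ⊗[K] D)ˣ))) * u (Algebra.norm K' y) := fun z => by
          rw [← map_mul, ← map_mul, ← hy', Units.inv_mul_cancel_right]
        rw [h1 x, mul_le_iff_le_one_left (zero_lt_iff.2 hN'),
          norm_le_one_iff hb hp hp1 hdense] at hxy
        rw [h1 (x + y), mul_le_iff_le_one_left (zero_lt_iff.2 hN'),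
          norm_le_one_iff hb hp hp1 hdense, add_mul, ← hy', Units.mul_inv]
        refine hxy.add ((norm_le_one_iff hb hp hp1 hdense).1 ?_)
        simp
    intro x y
    rcases le_total (u (Algebra.norm K' x)) (u (Algebra.norm K' y)) with h | h
    · exact (key x y h).trans (le_max_right _ _)
    · rw [add_comm]
      exact (key y x h).trans (le_max_left _ _)

/-- Let the valuation ring of `v` on the skew field `D` be free over the valuation ring of its
centre, with commutative residue field, and let `K'` be an extension of `K` in which `K` is dense
for the valuation `u`. Then `K' ⊗ D` is a skew field, and the norm defines a valuation with
commutative residue field. -/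
theorem isSkewField_and_exists_valuation [Nonempty ι]
    (hcomm : ∀ a b, v a ≤ 1 → v b ≤ 1 → v (a * b - b * a) < 1) :
    IsSkewField (K' ⊗[K] D) ∧ ∃ w : Valuation (K' ⊗[K] D) Γ,
      (∀ d, w d = u (Algebra.norm K' d)) ∧
      (w.comap (algebraMap K' (K' ⊗[K] D))).IsEquiv u ∧ IsField (ResidueRing w) := by
  have := Module.Finite.of_basis b
  have hnt : Nontrivial (K' ⊗[K] D) := (Algebra.TensorProduct.basis K' b).repr.toEquiv.nontrivial
  have hunit : ∀ x : K' ⊗[K] D, x ≠ 0 → IsUnit x := fun x hx =>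
    isUnit_of_norm_ne_zero K' (norm_tensor_ne_zero hb hp hp1 hdense hx)
  refine ⟨⟨hnt, hunit⟩, ?_⟩
  obtain ⟨w, hw⟩ : ∃ w : Valuation (K' ⊗[K] D) Γ, ∀ d, w d = u (Algebra.norm K' d) :=
    ⟨normValuation hb hp hp1 hdense, fun d => rfl⟩
  refine ⟨w, hw, ?_, ?_⟩
  -- On a scalar the norm is a power with exponent the dimension, so `w` restricts to a power of
  -- `u`, not to `u` itself.
  · refine Valuation.isEquiv_of_val_le_one fun {c} => ?_
    rw [Valuation.comap_apply, hw,
      Algebra.norm_algebraMap_of_basis (Algebra.TensorProduct.basis K' b), map_pow]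
    exact pow_le_one_iff Fintype.card_ne_zero
  · have hmk : ∀ x y : w.integer, (valuationIdeal w).ringCon.mk' x =
        (valuationIdeal w).ringCon.mk' y ↔ w ((x : K' ⊗[K] D) - y) < 1 := by
      intro x y
      refine (RingCon.eq _).trans ?_
      rw [TwoSidedIdeal.rel_iff, valuationIdeal, TwoSidedIdeal.mem_mk']
      rfl
    have hsurj := (valuationIdeal w).ringCon.mk'_surjective
    refine ⟨⟨(valuationIdeal w).ringCon.mk' 0, (valuationIdeal w).ringCon.mk' 1, ?_⟩, ?_, ?_⟩
    · rw [Ne, hmk]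
      simp
    · intro a b
      obtain ⟨x, rfl⟩ := hsurj a
      obtain ⟨y, rfl⟩ := hsurj b
      rw [← map_mul, ← map_mul, hmk]
      obtain ⟨x, hx⟩ := x
      obtain ⟨y, hy⟩ := y
      change w (x * y - y * x) < 1
      change w x ≤ 1 at hx
      change w y ≤ 1 at hy
      rw [hw] at hx hy
      have hI : ∀ {x}, IsIntegralVector u (Algebra.TensorProduct.basis K' b) x → w x ≤ 1 :=
        fun h => by rw [hw]; exact (norm_le_one_iff hb hp hp1 hdense).2 h
      have hpw : ∀ {z}, w z ≤ 1 → w (algebraMap K K' p • z) < 1 := fun {z} h => by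
        rw [Algebra.smul_def, map_mul, hw (algebraMap _ _ _),
          Algebra.norm_algebraMap_of_basis (Algebra.TensorProduct.basis K' b), map_pow]
        exact mul_lt_one_of_lt_of_le (pow_lt_one₀ zero_le hp1 Fintype.card_ne_zero) h
      have hy' := hI ((norm_le_one_iff hb hp hp1 hdense).1 hy)
      obtain ⟨d, hd, z, hz, rfl⟩ := exists_eq_tmul_add_of_norm_le_one hb hp hp1 hdense hx
      obtain ⟨d', hd', z', hz', rfl⟩ := exists_eq_tmul_add_of_norm_le_one hb hp hp1 hdense hy
      have hwd : w (1 ⊗ₜ d) ≤ 1 := hI ((isIntegralVector_tmul hb).2 hd)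
      -- Up to multiples of `p`, the commutator of two integral elements is the commutator of their
      -- approximations in `D`, where `hcomm` applies.
      have h1 : ∀ s t s' t' : K' ⊗[K] D, ∀ c : K', (s + c • t) * (s' + c • t') -
          (s' + c • t') * (s + c • t) = (s * s' - s' * s) +
            (c • (s * t' + t * (s' + c • t')) - c • (t' * s + (s' + c • t') * t)) := by
        intro s t s' t' c
        simp only [mul_add, add_mul, smul_add, mul_smul_comm, smul_mul_assoc]
        abel
      rw [h1]
      refine w.map_add_lt ?_ (w.map_sub_lt (hpw (w.map_add_le ?_ ?_)) (hpw (w.map_add_le ?_ ?_)))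
      · rw [Algebra.TensorProduct.tmul_mul_tmul, Algebra.TensorProduct.tmul_mul_tmul, one_mul,
          ← TensorProduct.tmul_sub, hw]
        exact norm_tmul_lt_one hb hp hp1 (hcomm _ _ hd hd')
      all_goals rw [map_mul]
      · exact mul_le_one' hwd (hI hz')
      · exact mul_le_one' (hI hz) hy'
      · exact mul_le_one' (hI hz') hwd
      · exact mul_le_one' hy' (hI hz)
    · intro a ha
      obtain ⟨x, rfl⟩ := hsurj a
      have hx : ¬ w (x : K' ⊗[K] D) < 1 := by
        rw [← map_zero (valuationIdeal w).ringCon.mk', Ne, hmk] at ha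
        simpa using ha
      have hx1 : w (x : K' ⊗[K] D) = 1 := le_antisymm x.2 (not_lt.1 hx)
      have hx0 : (x : K' ⊗[K] D) ≠ 0 := fun h => by simp [h] at hx1
      obtain ⟨y, hy⟩ := (hunit _ hx0).exists_right_inv
      have hy1 : w y = 1 := by
        have := congrArg w hy
        rwa [map_mul, hx1, one_mul, map_one] at this
      refine ⟨(valuationIdeal w).ringCon.mk' ⟨y, hy1.le⟩, ?_⟩
      rw [← map_mul, ← map_one (valuationIdeal w).ringCon.mk']
      congr 1
      exact Subtype.ext hy

end Completion

/-- A finitely generated module over a valuation ring inside a vector space is spanned by a basis. -/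
theorem exists_basis_of_valuationSubring {K D : Type*} [Field K] [AddCommGroup D] [Module K D]
    (𝒪 : ValuationSubring K) (t : Finset D) (ht : Submodule.span K (t : Set D) = ⊤) :
    ∃ (n : ℕ) (b : Basis (Fin n) K D), ∀ d, d ∈ Submodule.span 𝒪 (t : Set D) ↔
      ∀ i, b.repr d i ∈ 𝒪 := by
  set W := Submodule.span 𝒪 (t : Set D) with hW
  have hfin : Module.Finite 𝒪 W := Module.Finite.iff_fg.2 ⟨t, rfl⟩
  have htf : Module.IsTorsionFree 𝒪 D := 
    Module.IsTorsionFree.comap (fun r : 𝒪 => (r : K)) (fun r hr => by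
      simpa [isRegular_iff_ne_zero] using hr.ne_zero) fun r m => rfl
  -- Over a valuation ring torsion-free modules are flat, and finite flat modules over a local ring
  -- are free; this requires no Noetherian hypothesis.
  have hflat : Module.Flat 𝒪 W := by
    rw [Module.Flat.flat_iff_torsion_eq_bot_of_isBezout, ← Submodule.isTorsionFree_iff_torsion_eq_bot]
    infer_instance
  have hfree : Module.Free 𝒪 W := Module.free_of_flat_of_isLocalRing
  let b₀ := Module.finBasis 𝒪 W
  have hli : LinearIndependent K (fun i => (b₀ i : D)) := by
    rw [← LinearIndependent.iff_fractionRing 𝒪 K]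
    exact b₀.linearIndependent.map' W.subtype (Submodule.ker_subtype W)
  have hsp : ∀ w : W, (w : D) = ∑ i, (b₀.repr w i : K) • (b₀ i : D) := by
    intro w
    conv_lhs => rw [← b₀.sum_repr w]
    simp only [Submodule.coe_sum, Submodule.coe_smul]
    rfl
  have htop : ⊤ ≤ Submodule.span K (Set.range fun i => (b₀ i : D)) := by
    rw [← ht, Submodule.span_le]
    intro d hd
    have h1 := hsp ⟨d, Submodule.subset_span hd⟩
    change d = _ at h1
    rw [h1]
    exact sum_mem fun i _ => Submodule.smul_mem _ _ (Submodule.subset_span ⟨i, rfl⟩)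
  refine ⟨_, Basis.mk hli htop, fun d => ⟨fun hd i => ?_, fun h => ?_⟩⟩
  · have h1 := hsp ⟨d, hd⟩
    have h2 : d = ∑ i, (b₀.repr ⟨d, hd⟩ i : K) • Basis.mk hli htop i := by
      simpa using h1
    rw [h2, Basis.repr_sum_self]
    exact (b₀.repr ⟨d, hd⟩ i).2
  · rw [← (Basis.mk hli htop).sum_repr d]
    refine sum_mem fun i _ => ?_
    have h3 : ((⟨_, h i⟩ : 𝒪) • (b₀ i : D)) ∈ W := W.smul_mem _ (b₀ i).2
    rw [Basis.mk_apply]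
    exact h3


section

variable {D : Type*} [DivisionRing D] (𝒪 : ValuationSubring (Subring.center D))

theorem exists_sub_lt_of_centreCompletion (c : CentreCompletion 𝒪) {γ : 𝒪.ValueGroup}
    (hγ : γ ≠ 0) : ∃ a : Subring.center D,
      Valued.v (c - algebraMap (Subring.center D) (CentreCompletion 𝒪) a) < γ := by
  obtain ⟨x, rfl⟩ := 𝒪.valuation_surjective γ
  have hx : Valued.v (algebraMap (Subring.center D) (CentreCompletion 𝒪) x) = 𝒪.valuation x :=
    Valued.valuedCompletion_apply (WithVal.toVal 𝒪.valuation x)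
  have hx0 : algebraMap (Subring.center D) (CentreCompletion 𝒪) x ≠ 0 := by
    intro h
    rw [h, map_zero] at hx
    exact hγ hx.symm
  have hmem : {y : CentreCompletion 𝒪 | Valued.v (c - y) < 𝒪.valuation x} ∈ nhds c := by
    refine Valued.mem_nhds.2 ⟨Units.mk0 (Valued.v.restrict
      (algebraMap (Subring.center D) (CentreCompletion 𝒪) x)) ?_, fun y hy => ?_⟩
    · simpa using hx0
    · rw [Set.mem_ofPred_eq, Units.val_mk0, Valuation.restrict_lt_iff, hx,
        Valuation.map_sub_swap] at hy
      exact hy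
  obtain ⟨y, hy⟩ := UniformSpace.Completion.denseRange_coe.mem_nhds hmem
  exact ⟨WithVal.ofVal y, hy⟩

/-- Let the valuation ring of `v` on the skew field `D` be finitely generated over its centre, with
commutative residue field. Then the completion of `D` is a skew field, and the norm defines a
valuation with commutative residue field. -/
theorem isSkewField_skewCompletion {v : Valuation D ℤᵐ⁰}
    (hv : ∀ z : Subring.center D, z ∈ 𝒪 ↔ v (z : D) ≤ 1) {t : Finset D}
    (ht : ∀ d, v d ≤ 1 ↔ d ∈ Submodule.span 𝒪 (t : Set D)) {p : Subring.center D} (hp : p ≠ 0)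
    (hp1 : v (p : D) < 1) (hcomm : ∀ a b, v a ≤ 1 → v b ≤ 1 → v (a * b - b * a) < 1) :
    Module.Finite (Subring.center D) D ∧ IsSkewField (SkewCompletion 𝒪) ∧
      ∃ w : Valuation (SkewCompletion 𝒪) 𝒪.ValueGroup,
        (∀ d : SkewCompletion 𝒪, w d = Valued.v (Algebra.norm (CentreCompletion 𝒪) d)) ∧
        (w.comap (algebraMap (CentreCompletion 𝒪) (SkewCompletion 𝒪))).IsEquiv Valued.v ∧
        IsField (ResidueRing w) := by
  have hv0 : v (p : D) ≠ 0 := (map_ne_zero v).2 fun h => hp (Subtype.ext h)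
  have hspan : Submodule.span (Subring.center D) (t : Set D) = ⊤ := by
    refine eq_top_iff.2 fun d _ => ?_
    obtain ⟨k, hk⟩ : ∃ k : ℕ, v ((p ^ k) • d) ≤ 1 := by
      by_cases hd : d = 0
      · exact ⟨0, by simp [hd]⟩
      obtain ⟨k, hk⟩ := exists_pow_le_of_lt_one hp1 (y := (v d)⁻¹) (inv_ne_zero ((map_ne_zero v).2 hd))
      refine ⟨k, ?_⟩
      change v ((p ^ k : D) * d) ≤ 1
      rw [map_mul, map_pow]
      calc v (p : D) ^ k * v d ≤ (v d)⁻¹ * v d := mul_le_mul_left hk _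
        _ ≤ 1 := by rw [inv_mul_cancel₀ ((map_ne_zero v).2 hd)]
    have h1 : d = (p ^ k)⁻¹ • (p ^ k) • d := (inv_smul_smul₀ (pow_ne_zero k hp) d).symm
    rw [h1]
    exact Submodule.smul_mem _ _ (Submodule.span_le_restrictScalars 𝒪 _ _ ((ht _).1 hk))
  obtain ⟨n, b, hb⟩ := exists_basis_of_valuationSubring 𝒪 t hspan
  have hval : ∀ z : Subring.center D,
      Valued.v (algebraMap (Subring.center D) (CentreCompletion 𝒪) z) = 𝒪.valuation z := fun z =>
    Valued.valuedCompletion_apply (WithVal.toVal 𝒪.valuation z)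
  have hn : Nonempty (Fin n) := by
    by_contra h
    rw [not_nonempty_iff] at h
    exact one_ne_zero (α := D) (b.ext_elem fun i => h.elim i)
  refine ⟨.of_basis b, isSkewField_and_exists_valuation (b := b) (v := v) (p := p) (fun d => ?_) hp ?_
    (fun c γ hγ => exists_sub_lt_of_centreCompletion 𝒪 c hγ) hcomm⟩
  · rw [ht, hb]
    simp_rw [hval, ValuationSubring.valuation_le_one_iff]
  · rw [hval, ← not_le, ← map_one 𝒪.valuation]
    intro h
    have h1 : p⁻¹ ∈ 𝒪 := by
      rw [← ValuationSubring.valuation_le_one_iff, map_inv₀]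
      exact inv_le_one_of_one_le₀ (by simpa using h)
    rw [hv] at h1
    have h2 : v ((p : D) * (p⁻¹ : Subring.center D)) = 1 := by
      have : (p : D) * (p⁻¹ : Subring.center D) = 1 :=
        congrArg Subtype.val (mul_inv_cancel₀ hp)
      rw [this, map_one]
    rw [map_mul] at h2
    exact (mul_lt_one_of_lt_of_le hp1 h1).ne h2

end

end Iwasawa

end

noncomputable section

namespace Iwasawa

open Module

/-! ### Centre and dimension under extension of scalars -/

section Central

variable {K D L : Type*} [Field K] [DivisionRing D] [Algebra K D] [Field L] [Algebra K L]
  {ι : Type*} [DecidableEq ι] (e : Basis ι K L)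

theorem equivFinsupp_mul_mul (x : L ⊗[K] D) (a d : D) (i : ι) :
    TensorProduct.equivFinsuppOfBasisLeft e ((1 ⊗ₜ a) * x * (1 ⊗ₜ d)) i =
      a * TensorProduct.equivFinsuppOfBasisLeft e x i * d := by
  induction x using TensorProduct.induction_on with
  | zero => simp
  | tmul c b =>
    rw [Algebra.TensorProduct.tmul_mul_tmul, Algebra.TensorProduct.tmul_mul_tmul, one_mul, mul_one,
      TensorProduct.equivFinsuppOfBasisLeft_apply_tmul_apply,
      TensorProduct.equivFinsuppOfBasisLeft_apply_tmul_apply, mul_smul_comm, smul_mul_assoc]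
  | add x y hx hy =>
    rw [mul_add, add_mul, map_add, map_add, Finsupp.add_apply, Finsupp.add_apply, hx, hy, mul_add,
      add_mul]

variable (hK : ∀ d : D, (∀ a, a * d = d * a) → ∃ k, d = algebraMap K D k)
include hK

/-- An element of `L ⊗ D` centralizing `D` comes from `L`, if `D` is central over `K`. -/
theorem exists_eq_algebraMap_of_commute {x : L ⊗[K] D}
    (hx : ∀ d : D, (1 ⊗ₜ d) * x = x * (1 ⊗ₜ d)) : ∃ c, x = algebraMap L (L ⊗[K] D) c := by
  classical
  let e := Basis.ofVectorSpace K L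
  -- Coordinates with respect to a `K`-basis of `L` respect multiplication by `D` on both sides, so
  -- those of `x` commute with `D` and lie in `K`.
  have h1 : ∀ i, ∃ k, TensorProduct.equivFinsuppOfBasisLeft e x i = algebraMap K D k := fun i =>
    hK _ fun a => by
      have h2 := equivFinsupp_mul_mul e x a 1 i
      have h3 := equivFinsupp_mul_mul e x 1 a i
      rw [← Algebra.TensorProduct.one_def, one_mul, one_mul] at h3
      rw [← Algebra.TensorProduct.one_def, mul_one, mul_one] at h2
      rw [← h2, hx, h3]
  choose k hk using h1
  let s := (TensorProduct.equivFinsuppOfBasisLeft e x).support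
  refine ⟨∑ i ∈ s, k i • e i, ?_⟩
  have h4 : x = ∑ i ∈ s, e i ⊗ₜ TensorProduct.equivFinsuppOfBasisLeft e x i := by
    conv_lhs => rw [← (TensorProduct.equivFinsuppOfBasisLeft e).symm_apply_apply x]
    exact TensorProduct.equivFinsuppOfBasisLeft_symm_apply e _
  conv_lhs => rw [h4]
  rw [map_sum]
  refine Finset.sum_congr rfl fun i _ => ?_
  rw [hk, Algebra.algebraMap_eq_smul_one, Algebra.TensorProduct.algebraMap_apply,
    Algebra.algebraMap_self_apply, TensorProduct.tmul_smul, TensorProduct.smul_tmul']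

/-- A nonzero element of an ideal with fewest nonzero coordinates can be scaled so that one
coordinate is `1`. Its commutators with `D` are shorter, hence zero, so it comes from `L` and is a
unit. -/
theorem isSimpleRing_tensor : IsSimpleRing (L ⊗[K] D) := by
  classical
  refine IsSimpleRing.of_eq_bot_or_eq_top fun I => or_iff_not_imp_left.2 fun hI => ?_
  let e := Basis.ofVectorSpace K L
  let E := TensorProduct.equivFinsuppOfBasisLeft (N := D) e
  have hex : ∃ n, ∃ x ∈ I, x ≠ 0 ∧ (E x).support.card = n := by
    by_contra h
    push Not at h
    refine hI (le_antisymm (fun x hx => ?_) bot_le)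
    by_contra hx0
    exact h _ x hx (fun h => hx0 (by rw [h]; exact zero_mem _)) rfl
  obtain ⟨x, hxI, hx0, hcard⟩ := Nat.find_spec hex
  have hmin : ∀ y ∈ I, (E y).support.card < (E x).support.card → y = 0 := fun y hy hlt => by
    by_contra hy0
    exact Nat.find_min hex (hcard ▸ hlt) ⟨y, hy, hy0, rfl⟩
  obtain ⟨j, hj⟩ : ∃ j, E x j ≠ 0 := by
    by_contra h
    push Not at h
    exact hx0 (E.map_eq_zero_iff.1 (Finsupp.ext h))
  have hE : ∀ (y : L ⊗[K] D) (a d : D) i, E ((1 ⊗ₜ a) * y * (1 ⊗ₜ d)) i = a * E y i * d :=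
    fun y a d i => equivFinsupp_mul_mul e y a d i
  set y := (1 ⊗ₜ (E x j)⁻¹) * x with hy
  have hyI : y ∈ I := I.mul_mem_left _ _ hxI
  have hEy : ∀ i, E y i = (E x j)⁻¹ * E x i := fun i => by
    have := hE x (E x j)⁻¹ 1 i
    rwa [← Algebra.TensorProduct.one_def, mul_one, mul_one] at this
  have hcomm : ∀ d : D, (1 ⊗ₜ d) * y = y * (1 ⊗ₜ d) := by
    intro d
    rw [← sub_eq_zero]
    refine hmin _ (I.sub_mem (I.mul_mem_left _ _ hyI) (I.mul_mem_right _ _ hyI)) ?_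
    have hEd : ∀ i, E ((1 ⊗ₜ d) * y - y * (1 ⊗ₜ d)) i = d * E y i - E y i * d := fun i => by
      have h1 := hE y d 1 i
      have h2 := hE y 1 d i
      rw [← Algebra.TensorProduct.one_def, mul_one, mul_one] at h1
      rw [← Algebra.TensorProduct.one_def, one_mul, one_mul] at h2
      rw [map_sub, Finsupp.sub_apply, h1, h2]
    refine Finset.card_lt_card ((Finset.ssubset_iff_of_subset fun i hi => ?_).2 ⟨j, ?_, ?_⟩)
    · rw [Finsupp.mem_support_iff] at hi ⊢
      intro h
      rw [hEd, hEy, h] at hi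
      simp at hi
    · exact Finsupp.mem_support_iff.2 hj
    · rw [Finsupp.mem_support_iff, hEd, hEy, inv_mul_cancel₀ hj]
      simp
  obtain ⟨c, hc⟩ := exists_eq_algebraMap_of_commute hK hcomm
  have hc0 : c ≠ 0 := by
    intro h
    have h1 := hEy j
    rw [inv_mul_cancel₀ hj, hc, h, map_zero, map_zero] at h1
    exact zero_ne_one h1
  have h1 : (1 : L ⊗[K] D) ∈ I := by
    have := I.mul_mem_left (algebraMap L (L ⊗[K] D) c⁻¹) _ hyI
    rwa [hc, ← map_mul, inv_mul_cancel₀ hc0, map_one] at this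
  exact I.one_mem_iff.1 h1

/-- The dimension of a central division algebra is a square. -/
theorem exists_finrank_eq_sq [Module.Finite K D] : ∃ s : ℕ, 0 < s ∧ finrank K D = s ^ 2 := by
  have := isSimpleRing_tensor (L := AlgebraicClosure K) hK
  -- Over the algebraic closure the simple algebra is a full matrix algebra, whose size is the Schur
  -- index.
  obtain ⟨n, hn, ⟨f⟩⟩ := IsSimpleRing.exists_algEquiv_matrix_of_isAlgClosed (AlgebraicClosure K)
    (AlgebraicClosure K ⊗[K] D)
  refine ⟨n, Nat.pos_of_ne_zero hn.out, ?_⟩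
  rw [← Module.finrank_baseChange (R := AlgebraicClosure K), f.toLinearEquiv.finrank_eq,
    Module.finrank_matrix]
  simp [sq]

theorem finrank_center_tensor :
    finrank (Subring.center (L ⊗[K] D)) (L ⊗[K] D) = finrank K D := by
  have hc : ∀ c, algebraMap L (L ⊗[K] D) c ∈ Subring.center (L ⊗[K] D) := fun c =>
    Subring.mem_center_iff.2 fun x => (Algebra.commutes c x).symm
  have hbij : Function.Bijective ((algebraMap L (L ⊗[K] D)).codRestrict (Subring.center _) hc) := by
    refine ⟨RingHom.injective _, fun z => ?_⟩
    obtain ⟨c, h⟩ := exists_eq_algebraMap_of_commute hK (x := (z : L ⊗[K] D))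
      fun d => Subring.mem_center_iff.1 z.2 _
    exact ⟨c, Subtype.ext h.symm⟩
  have h1 : finrank L (L ⊗[K] D) = finrank (Subring.center (L ⊗[K] D)) (L ⊗[K] D) :=
    Algebra.finrank_eq_of_equiv_equiv (RingEquiv.ofBijective _ hbij) (RingEquiv.refl _) rfl
  rw [← h1, Module.finrank_baseChange]

end Central

theorem exists_isSchurIndex {D : Type*} [DivisionRing D] (𝒪 : ValuationSubring (Subring.center D))
    [Module.Finite (Subring.center D) D] :
    ∃ s, IsSchurIndex D s ∧ IsSchurIndex (SkewCompletion 𝒪) s := by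
  have hK : ∀ d : D, (∀ a, a * d = d * a) → ∃ k, d = algebraMap (Subring.center D) D k :=
    fun d hd => ⟨⟨d, Subring.mem_center_iff.2 hd⟩, rfl⟩
  obtain ⟨s, hs, h⟩ := exists_finrank_eq_sq hK
  exact ⟨s, ⟨hs, h⟩, hs, (finrank_center_tensor hK).trans h⟩

end Iwasawa

end

namespace Iwasawa

/-! ### A central power of γ and a neighbourhood basis of G -/

section Tower

variable {l : ℕ} [hl : Fact l.Prime] {G : Type*} [Group G] [TopologicalSpace G]

/-- The open normal subgroups `U n` form a neighbourhood basis of `1` in `G`, and `G / U n` is the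
semidirect product of the finite subgroup `H` and the cyclic group of order `l ^ (m + n)` generated
by `γ`, where `γ ^ l ^ m` is central. -/
structure IsIwasawaTower (l : ℕ) (H : Subgroup G) (γ : G) (m : ℕ)
    (U : ℕ → OpenNormalSubgroup G) : Prop where
  central : γ ^ l ^ m ∈ Subgroup.center G
  le_succ : ∀ n, (U (n + 1)).toSubgroup ≤ (U n).toSubgroup
  exists_le : ∀ V : OpenNormalSubgroup G, ∃ n, (U n).toSubgroup ≤ V.toSubgroup
  eq_one : ∀ n, ∀ h ∈ H, ∀ c : ℤ, h * γ ^ c ∈ (U n).toSubgroup → h = 1 ∧ (l : ℤ) ^ (m + n) ∣ c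
  pow_mem : ∀ n, γ ^ l ^ (m + n) ∈ (U n).toSubgroup
  exists_coset : ∀ n g, ∃ h ∈ H, ∃ c : ℕ, (h * γ ^ c)⁻¹ * g ∈ (U n).toSubgroup

theorem isOpenMap_quotient_comp [IsTopologicalGroup G] {H : Subgroup G} [H.Normal] {Z : Type*} [Group Z]
    [TopologicalSpace Z] (E : (G ⧸ H) ≃ₜ* Z) : IsOpenMap fun g : G => E g :=
  E.toHomeomorph.isOpenMap.comp QuotientGroup.isOpenMap_coe

theorem exists_pow_dvd_imp_mem {s : Set ℤ_[l]} (hs : IsOpen s) (h0 : (0 : ℤ_[l]) ∈ s) :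
    ∃ k : ℕ, ∀ z, (l : ℤ_[l]) ^ k ∣ z → z ∈ s := by
  obtain ⟨ε, hε, hball⟩ := Metric.isOpen_iff.1 hs 0 h0
  obtain ⟨k, hk⟩ := PadicInt.exists_pow_neg_lt l hε
  refine ⟨k, fun z hz => hball ?_⟩
  rw [Metric.mem_ball, dist_zero_right]
  refine lt_of_le_of_lt ?_ hk
  rw [PadicInt.norm_le_pow_iff_mem_span_pow, Ideal.mem_span_singleton]
  exact hz

theorem isOpen_setOf_pow_dvd (k : ℕ) : IsOpen {z : ℤ_[l] | (l : ℤ_[l]) ^ k ∣ z} := by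
  have h1 : {z : ℤ_[l] | (l : ℤ_[l]) ^ k ∣ z} = Metric.ball 0 ((l : ℝ) ^ (-(k : ℤ) + 1)) := by
    ext z
    rw [Metric.mem_ball, dist_zero_right, ← PadicInt.norm_le_pow_iff_norm_lt_pow_add_one,
      PadicInt.norm_le_pow_iff_mem_span_pow, Ideal.mem_span_singleton]
    rfl
  rw [h1]
  exact Metric.isOpen_ball

theorem pow_dvd_intCast_iff {k : ℕ} {c : ℤ} : (l : ℤ_[l]) ^ k ∣ (c : ℤ_[l]) ↔ (l : ℤ) ^ k ∣ c := by
  rw [← PadicInt.norm_int_le_pow_iff_dvd, PadicInt.norm_le_pow_iff_mem_span_pow,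
    Ideal.mem_span_singleton]

/-- An open normal `V` meeting the finite group `H` trivially commutes with it. A suitable power of
a lift `γ` of `1 ∈ ℤ_l` lies in `V`, hence commutes with `H` and `γ`, so with a dense subgroup. The
tower is `V ∩ ψ⁻¹(l ^ (m + n) ℤ_l)`. -/
theorem exists_isIwasawaTower [IsTopologicalGroup G] [CompactSpace G] [T2Space G]
    [TotallyDisconnectedSpace G] (H : Subgroup G) [H.Normal] [Finite H] (hH : IsPGroup l H)
    (E : (G ⧸ H) ≃ₜ* Multiplicative ℤ_[l]) :
    ∃ (γ : G) (m : ℕ) (U : ℕ → OpenNormalSubgroup G), IsIwasawaTower l H γ m U := by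
  let ψ : G →* Multiplicative ℤ_[l] := E.toMulEquiv.toMonoidHom.comp (QuotientGroup.mk' H)
  have hψH : ∀ g, ψ g = 1 ↔ g ∈ H := fun g => by
    rw [← QuotientGroup.eq_one_iff]
    exact E.toMulEquiv.map_eq_one_iff
  have hψs : Function.Surjective ψ := E.surjective.comp (QuotientGroup.mk'_surjective H)
  have hψo : IsOpenMap ψ := isOpenMap_quotient_comp E
  have hψc : Continuous ψ := E.continuous.comp QuotientGroup.continuous_mk
  have hopen : ∀ V : OpenNormalSubgroup G, ∃ k : ℕ, ∀ z : ℤ_[l], (l : ℤ_[l]) ^ k ∣ z →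
      ∃ v ∈ V.toSubgroup, ψ v = Multiplicative.ofAdd z := fun V => by
    obtain ⟨k, hk⟩ := exists_pow_dvd_imp_mem (l := l)
      (s := Multiplicative.ofAdd ⁻¹' (ψ '' (V.toSubgroup : Set G)))
      ((hψo _ V.isOpen').preimage continuous_ofAdd) ⟨1, one_mem _, map_one ψ⟩
    exact ⟨k, fun z hz => hk z hz⟩
  obtain ⟨γ, hγ⟩ := hψs (Multiplicative.ofAdd 1)
  have hψγ : ∀ c : ℤ, ψ (γ ^ c) = Multiplicative.ofAdd (c : ℤ_[l]) := fun c => by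
    rw [map_zpow, hγ, ← ofAdd_zsmul, zsmul_one]
  have hψγ' : ∀ c : ℕ, ψ (γ ^ c) = Multiplicative.ofAdd (c : ℤ_[l]) := fun c => by
    rw [map_pow, hγ, ← ofAdd_nsmul, nsmul_one]
  -- Density of the products `h * γ ^ c`: the exponent is a truncation of the `l`-adic integer `ψ
  -- g`, with precision depending on `V`.
  have hcoset : ∀ (V : OpenNormalSubgroup G) g,
      ∃ h ∈ H, ∃ c : ℕ, (h * γ ^ c)⁻¹ * g ∈ V.toSubgroup := fun V g => by
    obtain ⟨k, hk⟩ := hopen V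
    have h1 := (PadicInt.appr_spec k (Multiplicative.toAdd (ψ g)))
    rw [Ideal.mem_span_singleton] at h1
    obtain ⟨v, hv, hψv⟩ := hk _ h1
    refine ⟨g * v⁻¹ * (γ ^ (Multiplicative.toAdd (ψ g)).appr k)⁻¹, ?_,
      (Multiplicative.toAdd (ψ g)).appr k, ?_⟩
    rotate_left
    · have h2 : (g * v⁻¹ * (γ ^ (Multiplicative.toAdd (ψ g)).appr k)⁻¹ *
          γ ^ (Multiplicative.toAdd (ψ g)).appr k)⁻¹ * g = v := by group
      rw [h2]
      exact hv
    · rw [← hψH, map_mul, map_mul, map_inv, map_inv, hψv, hψγ', ← ofAdd_neg, ← ofAdd_neg]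
      apply Multiplicative.toAdd.injective
      simp
  have hsep : ∀ g : G, (∀ V : OpenNormalSubgroup G, g ∈ V.toSubgroup) → g = 1 := fun g hg => by
    by_contra h
    obtain ⟨V, hV⟩ := ProfiniteGrp.exist_openNormalSubgroup_sub_open_nhds_of_one
      (isOpen_compl_singleton (x := g)) (by simpa using (Ne.symm h))
    exact hV (hg V) rfl
  obtain ⟨V, hV⟩ : ∃ V : OpenNormalSubgroup G, ∀ g ∈ V.toSubgroup, g ∈ H → g = 1 := by
    have hfin : ((H : Set G) \ {1}).Finite := (Set.toFinite (H : Set G)).subset Set.sdiff_subset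
    obtain ⟨V, hV⟩ := ProfiniteGrp.exist_openNormalSubgroup_sub_open_nhds_of_one
      (hfin.isClosed.isOpen_compl) (by simp)
    refine ⟨V, fun g hg hgH => ?_⟩
    by_contra h
    exact hV hg ⟨hgH, h⟩
  have hVH : ∀ v ∈ V.toSubgroup, ∀ h ∈ H, Commute v h := fun v hv h hh => by
    have h1 : v * h * v⁻¹ * h⁻¹ = 1 := hV _
      (by
        rw [mul_assoc v, mul_assoc v]
        refine mul_mem hv ?_
        exact V.isNormal'.conj_mem _ (inv_mem hv) h)
      (mul_mem (Subgroup.Normal.conj_mem inferInstance _ hh v) (inv_mem hh))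
    rw [mul_inv_eq_one, mul_inv_eq_iff_eq_mul] at h1
    exact h1
  -- Since `l ^ k` is in the image of `V`, `γ ^ l ^ k` is an element of `H` times an element of `V`.
  -- These commute, and a further power by `l ^ c = |H|` removes the first factor.
  obtain ⟨m, hm⟩ : ∃ m, γ ^ l ^ m ∈ V.toSubgroup := by
    obtain ⟨k, hk⟩ := hopen V
    obtain ⟨v, hv, hψv⟩ := hk (l ^ k) dvd_rfl
    obtain ⟨c, hc⟩ := IsPGroup.iff_card.1 hH
    have hh : γ ^ l ^ k * v⁻¹ ∈ H := by
      rw [← hψH, map_mul, map_inv, hψv, hψγ']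
      simp
    refine ⟨k + c, ?_⟩
    have h1 : γ ^ l ^ k = (γ ^ l ^ k * v⁻¹) * v := by group
    rw [pow_add, pow_mul, h1, (hVH v hv _ hh).symm.mul_pow, ← hc]
    have h2 : (γ ^ l ^ k * v⁻¹) ^ Nat.card H = 1 := by
      have := pow_card_eq_one' (x := (⟨_, hh⟩ : H))
      exact congrArg Subtype.val this
    rw [h2, one_mul]
    exact pow_mem hv _
  let U : ℕ → OpenNormalSubgroup G := fun n =>
    { toSubgroup := V.toSubgroup ⊓ (AddSubgroup.toSubgroup
        (Ideal.span {(l : ℤ_[l]) ^ (m + n)}).toAddSubgroup).comap ψ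
      isOpen' := by
        refine V.isOpen'.inter ?_
        have h1 := (isOpen_setOf_pow_dvd (l := l) (m + n)).preimage
          (continuous_toAdd.comp hψc)
        convert h1 using 1
        ext g
        exact Ideal.mem_span_singleton }
  have hU : ∀ n g, g ∈ (U n).toSubgroup ↔ g ∈ V.toSubgroup ∧
      (l : ℤ_[l]) ^ (m + n) ∣ Multiplicative.toAdd (ψ g) := fun n g => by
    rw [← Ideal.mem_span_singleton]
    rfl
  have hcomm : ∀ h ∈ H, ∀ c : ℕ, Commute (γ ^ l ^ m) (h * γ ^ c) := fun h hh c =>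
    (hVH _ hm h hh).mul_right ((Commute.refl γ).pow_pow _ _)
  refine ⟨γ, m, U, ?_, ?_, ?_, ?_, ?_, fun n g => hcoset (U n) g⟩
  · refine Subgroup.mem_center_iff.2 fun g => ?_
    rw [← mul_inv_eq_iff_eq_mul, ← mul_inv_eq_one]
    refine hsep _ fun V' => ?_
    obtain ⟨h, hh, c, hv⟩ := hcoset V' g
    set v := (h * γ ^ c)⁻¹ * g with hvdef
    have hg : g = h * γ ^ c * v := by rw [hvdef]; group
    have h1 : g * γ ^ l ^ m * g⁻¹ * (γ ^ l ^ m)⁻¹ =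
        (h * γ ^ c) * (v * (γ ^ l ^ m * v⁻¹ * (γ ^ l ^ m)⁻¹)) * (h * γ ^ c)⁻¹ := by
      have h2 : (γ ^ l ^ m)⁻¹ * (h * γ ^ c)⁻¹ = (h * γ ^ c)⁻¹ * (γ ^ l ^ m)⁻¹ :=
        ((hcomm h hh c).inv_inv).eq
      rw [hg, mul_inv_rev]
      simp only [mul_assoc] at h2 ⊢
      rw [h2]
    rw [h1]
    exact V'.isNormal'.conj_mem _ (mul_mem hv (V'.isNormal'.conj_mem _ (inv_mem hv) _)) _
  · intro n g hg
    rw [hU] at hg ⊢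
    exact ⟨hg.1, (pow_dvd_pow _ (by omega)).trans hg.2⟩
  · intro V'
    -- `ψ` is injective on `V`, so an element of `V` with sufficiently divisible image coincides
    -- with an element of `V ⊓ V'`.
    obtain ⟨k, hk⟩ := hopen (V ⊓ V')
    refine ⟨k, fun u hu => ?_⟩
    rw [hU] at hu
    obtain ⟨v, hv, hψv⟩ := hk _ ((pow_dvd_pow _ (by omega)).trans hu.2)
    have hvV : v ∈ V.toSubgroup := hv.1
    have hvV' : v ∈ V'.toSubgroup := hv.2
    have h1 : u * v⁻¹ = 1 := hV _ (mul_mem hu.1 (inv_mem hvV)) (by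
      rw [← hψH, map_mul, map_inv, hψv]
      simp)
    rw [mul_inv_eq_one.1 h1]
    exact hvV'
  · intro n h hh c hc
    rw [hU, map_mul, (hψH h).2 hh, one_mul, hψγ, toAdd_ofAdd, pow_dvd_intCast_iff] at hc
    obtain ⟨hc1, hc2⟩ := hc
    refine ⟨hV h ?_ hh, hc2⟩
    obtain ⟨c', rfl⟩ := (pow_dvd_pow (l : ℤ) (Nat.le_add_right m n)).trans hc2
    have h1 : γ ^ ((l : ℤ) ^ m * c') ∈ V.toSubgroup := by
      rw [zpow_mul, ← Nat.cast_pow, zpow_natCast]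
      exact zpow_mem hm c'
    exact (Subgroup.mul_mem_cancel_right _ h1).1 hc1
  · intro n
    rw [hU, hψγ', toAdd_ofAdd]
    refine ⟨?_, by rw [Nat.cast_pow]⟩
    rw [pow_add, pow_mul]
    exact pow_mem hm _

end Tower

end Iwasawa

noncomputable section

namespace Iwasawa

open PowerSeries

/-! ### ℤ_l[[X]] and the polynomials (1 + X)^(l^n) - 1 -/

section PowerSeriesRing

variable {l : ℕ} [hl : Fact l.Prime]

theorem maximalIdeal_powerSeries :
    IsLocalRing.maximalIdeal ℤ_[l]⟦X⟧ = Ideal.span {(l : ℤ_[l]⟦X⟧), X} := by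
  have hmem : ∀ f : ℤ_[l]⟦X⟧, f ∈ IsLocalRing.maximalIdeal ℤ_[l]⟦X⟧ ↔
      (l : ℤ_[l]) ∣ constantCoeff f := fun f => by
    rw [IsLocalRing.mem_maximalIdeal, mem_nonunits_iff, isUnit_iff_constantCoeff,
      ← mem_nonunits_iff, ← IsLocalRing.mem_maximalIdeal, PadicInt.maximalIdeal_eq_span_p,
      Ideal.mem_span_singleton]
  refine le_antisymm (fun f hf => ?_) (Ideal.span_le.2 ?_)
  · obtain ⟨a, ha⟩ := (hmem f).1 hf
    obtain ⟨g, hg⟩ := X_dvd_iff.2 (show constantCoeff (f - C (constantCoeff f)) = 0 by simp)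
    refine Ideal.mem_span_pair.2 ⟨C a, g, ?_⟩
    rw [mul_comm g, ← hg, ha, map_mul, map_natCast]
    ring
  · rintro f (rfl | rfl)
    · rw [SetLike.mem_coe, hmem, map_natCast]
    · rw [SetLike.mem_coe, hmem, constantCoeff_X]
      exact dvd_zero _

theorem mem_span_natCast_iff {f : ℤ_[l]⟦X⟧} :
    f ∈ Ideal.span {(l : ℤ_[l]⟦X⟧)} ↔ ∀ n, (l : ℤ_[l]) ∣ coeff n f := by
  rw [Ideal.mem_span_singleton]
  constructor
  · rintro ⟨g, rfl⟩ n
    rw [← map_natCast (C (R := ℤ_[l])), coeff_C_mul]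
    exact dvd_mul_right _ _
  · intro h
    choose a ha using h
    refine ⟨PowerSeries.mk a, ext fun n => ?_⟩
    rw [← map_natCast (C (R := ℤ_[l])), coeff_C_mul, coeff_mk, ha]

instance isPrime_span_natCast : (Ideal.span {(l : ℤ_[l]⟦X⟧)}).IsPrime := by
  have h1 : Ideal.span {(l : ℤ_[l]⟦X⟧)} =
      RingHom.ker (PowerSeries.map (IsLocalRing.residue ℤ_[l])) := by
    ext f
    rw [mem_span_natCast_iff, RingHom.mem_ker, PowerSeries.ext_iff]
    refine forall_congr' fun n => ?_
    rw [coeff_map, map_zero, IsLocalRing.residue_eq_zero_iff, PadicInt.maximalIdeal_eq_span_p,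
      Ideal.mem_span_singleton]
  rw [h1]
  exact RingHom.ker_isPrime _

theorem X_notMem_span_natCast : (X : ℤ_[l]⟦X⟧) ∉ Ideal.span {(l : ℤ_[l]⟦X⟧)} := by
  rw [mem_span_natCast_iff]
  intro h
  have h1 := h 1
  rw [coeff_one_X] at h1
  exact PadicInt.prime_p.not_isUnit (isUnit_of_dvd_one h1)

variable (l) in
/-- The polynomial `(1 + X) ^ l ^ n - 1`. -/
def omega (n : ℕ) : Polynomial ℤ_[l] := (Polynomial.X + 1) ^ l ^ n - 1

theorem monic_X_add_one_pow (n : ℕ) : ((Polynomial.X + 1 : Polynomial ℤ_[l]) ^ n).Monic := by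
  rw [← Polynomial.C_1]
  exact (Polynomial.monic_X_add_C 1).pow n

theorem natDegree_X_add_one_pow (n : ℕ) :
    ((Polynomial.X + 1 : Polynomial ℤ_[l]) ^ n).natDegree = n := by
  rw [← Polynomial.C_1, (Polynomial.monic_X_add_C (1 : ℤ_[l])).natDegree_pow,
    Polynomial.natDegree_X_add_C, mul_one]

theorem degree_one_lt (n : ℕ) :
    (1 : Polynomial ℤ_[l]).degree < ((Polynomial.X + 1 : Polynomial ℤ_[l]) ^ l ^ n).degree := by
  rw [Polynomial.degree_one, Polynomial.degree_eq_natDegree (monic_X_add_one_pow _).ne_zero,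
    natDegree_X_add_one_pow]
  exact_mod_cast pow_pos hl.1.pos n

theorem omega_monic (n : ℕ) : (omega l n).Monic :=
  (monic_X_add_one_pow _).sub_of_left (degree_one_lt n)

theorem natDegree_omega (n : ℕ) : (omega l n).natDegree = l ^ n := by
  rw [omega, Polynomial.natDegree_sub_eq_left_of_natDegree_lt, natDegree_X_add_one_pow]
  rw [Polynomial.natDegree_one, natDegree_X_add_one_pow]
  exact pow_pos hl.1.pos n

theorem isDistinguishedAt_omega (n : ℕ) :
    (omega l n).IsDistinguishedAt (IsLocalRing.maximalIdeal ℤ_[l]) where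
  monic := omega_monic n
  mem {i} hi := by
    rw [natDegree_omega] at hi
    rw [omega, Polynomial.coeff_sub, Polynomial.coeff_X_add_one_pow, Polynomial.coeff_one,
      PadicInt.maximalIdeal_eq_span_p, Ideal.mem_span_singleton]
    by_cases h0 : i = 0
    · simp [h0]
    · rw [if_neg h0, sub_zero]
      exact_mod_cast Nat.cast_dvd_cast (hl.1.dvd_choose_pow h0 hi.ne)

theorem coe_omega (n : ℕ) : (omega l n : ℤ_[l]⟦X⟧) = (1 + X) ^ l ^ n - 1 := by
  simp [omega, add_comm]

theorem omega_dvd_omega {m n : ℕ} (h : m ≤ n) :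
    (omega l m : ℤ_[l]⟦X⟧) ∣ (omega l n : ℤ_[l]⟦X⟧) := by
  obtain ⟨k, rfl⟩ := Nat.exists_eq_add_of_le h
  rw [coe_omega, coe_omega, pow_add, pow_mul]
  exact sub_one_dvd_pow_sub_one _ _

/-- Weierstrass division by the distinguished polynomial `omega l n`; modulo it, power series may be
treated as polynomials of degree less than `l ^ n`. -/
theorem exists_polynomial (n : ℕ) (f : ℤ_[l]⟦X⟧) :
    ∃ p : Polynomial ℤ_[l], p.degree < (omega l n).degree ∧
      (omega l n : ℤ_[l]⟦X⟧) ∣ f - p := by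
  obtain ⟨p, hp⟩ := Ideal.Quotient.mk_surjective
    ((isDistinguishedAt_omega n).algEquivQuotient.symm (Ideal.Quotient.mk _ f))
  refine ⟨p %ₘ omega l n, Polynomial.degree_modByMonic_lt _ (omega_monic n), ?_⟩
  have h1 : Ideal.Quotient.mk (Ideal.span {(omega l n : ℤ_[l]⟦X⟧)}) f =
      Ideal.Quotient.mk _ (p : ℤ_[l]⟦X⟧) := by
    rw [AlgEquiv.eq_symm_apply] at hp
    exact hp.symm
  rw [Ideal.Quotient.eq, Ideal.mem_span_singleton] at h1
  have h2 : (p : ℤ_[l]⟦X⟧) = (p %ₘ omega l n : Polynomial ℤ_[l]) +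
      (omega l n : ℤ_[l]⟦X⟧) * (p /ₘ omega l n : Polynomial ℤ_[l]) := by
    rw [← Polynomial.coe_mul, ← Polynomial.coe_add, Polynomial.modByMonic_add_div]
  have h3 : f - (p %ₘ omega l n : Polynomial ℤ_[l]) = (f - p) +
      (omega l n : ℤ_[l]⟦X⟧) * (p /ₘ omega l n : Polynomial ℤ_[l]) := by
    rw [h2]; ring
  rw [h3]
  exact dvd_add h1 (dvd_mul_right _ _)

/-- Each quotient of consecutive `omega`s is a sum of `l` powers of `(1 + X) ^ l ^ n` and so has
constant term `l`; every step adds a factor from the maximal ideal. -/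
theorem omega_mem_pow (n : ℕ) :
    (omega l n : ℤ_[l]⟦X⟧) ∈ IsLocalRing.maximalIdeal ℤ_[l]⟦X⟧ ^ n := by
  induction n with
  | zero => simp
  | succ n ih =>
    have h1 : (omega l (n + 1) : ℤ_[l]⟦X⟧) = omega l n *
        ∑ i ∈ Finset.range l, ((1 + X : ℤ_[l]⟦X⟧) ^ l ^ n) ^ i := by
      rw [coe_omega, coe_omega, mul_comm, geom_sum_mul, pow_succ, pow_mul]
    rw [h1, pow_succ]
    refine Ideal.mul_mem_mul ih ?_
    rw [IsLocalRing.mem_maximalIdeal, mem_nonunits_iff, isUnit_iff_constantCoeff]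
    simp [PadicInt.prime_p.not_isUnit]

theorem eq_zero_of_forall_omega_dvd {f : ℤ_[l]⟦X⟧} (h : ∀ n, (omega l n : ℤ_[l]⟦X⟧) ∣ f) :
    f = 0 := by
  have h1 : f ∈ ⨅ n, IsLocalRing.maximalIdeal ℤ_[l]⟦X⟧ ^ n := by
    rw [Ideal.mem_iInf]
    exact fun n => Ideal.mem_of_dvd _ (h n) (omega_mem_pow n)
  rwa [Ideal.iInf_pow_eq_bot_of_isLocalRing _ (IsLocalRing.maximalIdeal.isMaximal _).ne_top] at h1

open scoped PowerSeries.WithPiTopology in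
/-- Completeness of `ℤ_l⟦X⟧` for the filtration by the ideals generated by the polynomials
`(1 + X) ^ l ^ n - 1`. -/
theorem exists_forall_omega_dvd_sub {r : ℕ → ℤ_[l]⟦X⟧}
    (h : ∀ n, (omega l n : ℤ_[l]⟦X⟧) ∣ r (n + 1) - r n) :
    ∃ f, ∀ n, (omega l n : ℤ_[l]⟦X⟧) ∣ f - r n := by
  have hc : CompactSpace ℤ_[l]⟦X⟧ := inferInstanceAs (CompactSpace ((Unit →₀ ℕ) → ℤ_[l]))
  let S : ℕ → Set ℤ_[l]⟦X⟧ := fun n => Set.range fun g => r n + omega l n * g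
  -- The cosets `r n + (omega l n)` form a decreasing sequence of nonempty compact sets in the
  -- compact ring `ℤ_l⟦X⟧`; a common point is the limit.
  have hcompact : ∀ n, IsCompact (S n) := fun n => isCompact_range (by fun_prop)
  obtain ⟨f, hf⟩ := IsCompact.nonempty_iInter_of_sequence_nonempty_isCompact_isClosed S
    (fun n => by
      rintro _ ⟨g, rfl⟩
      obtain ⟨a, ha⟩ := h n
      obtain ⟨b, hb⟩ := omega_dvd_omega (l := l) n.le_succ
      refine ⟨a + b * g, ?_⟩
      rw [sub_eq_iff_eq_add] at ha
      change r n + omega l n * (a + b * g) = r (n + 1) + omega l (n + 1) * g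
      rw [ha, hb]
      ring)
    (fun n => ⟨_, 0, rfl⟩) (hcompact 0) (fun n => (hcompact n).isClosed)
  refine ⟨f, fun n => ?_⟩
  obtain ⟨g, rfl⟩ := Set.mem_iInter.1 hf n
  exact ⟨g, by simp⟩

variable {A : Type*} [Ring A] [Algebra ℤ_[l] A]

theorem aeval_omega {y : A} {n : ℕ} (hy : y ^ l ^ n = 1) :
    Polynomial.aeval (y - 1) (omega l n) = 0 := by
  simp [omega, hy]

/-- A power series may be evaluated at `y - 1`, if `y` has finite `l`-power order. -/
theorem exists_algHom_of_pow_eq_one {y : A} {n : ℕ} (hy : y ^ l ^ n = 1) :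
    ∃ ψ : ℤ_[l]⟦X⟧ →ₐ[ℤ_[l]] A, ∀ p : Polynomial ℤ_[l], ψ p = Polynomial.aeval (y - 1) p := by
  let g : (Polynomial ℤ_[l] ⧸ Ideal.span {omega l n}) →ₐ[ℤ_[l]] A :=
    Ideal.Quotient.liftₐ _ (Polynomial.aeval (y - 1)) fun p hp => by
      obtain ⟨q, rfl⟩ := Ideal.mem_span_singleton.1 hp
      rw [map_mul, aeval_omega hy, zero_mul]
  refine ⟨(g.comp (isDistinguishedAt_omega n).algEquivQuotient.symm.toAlgHom).comp
    (Ideal.Quotient.mkₐ _ _), fun p => ?_⟩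
  have h1 : (isDistinguishedAt_omega n).algEquivQuotient.symm
      (Ideal.Quotient.mk _ (p : ℤ_[l]⟦X⟧)) = Ideal.Quotient.mk _ p := by
    rw [AlgEquiv.symm_apply_eq]
    rfl
  change g ((isDistinguishedAt_omega n).algEquivQuotient.symm
    (Ideal.Quotient.mk _ (p : ℤ_[l]⟦X⟧))) = _
  rw [h1]
  rfl

/-- Both maps kill `omega l n`, so they factor through polynomials and no continuity is needed. -/
theorem ringHom_ext_of_pow_eq_one {A : Type*} [Ring A] {ψ ψ' : ℤ_[l]⟦X⟧ →+* A} {n : ℕ}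
    (hy : (1 + ψ X) ^ l ^ n = 1) (hC : ∀ a, ψ (C a) = ψ' (C a)) (hX : ψ X = ψ' X) : ψ = ψ' := by
  ext f
  obtain ⟨p, -, g, hg⟩ := exists_polynomial n f
  rw [sub_eq_iff_eq_add] at hg
  have h1 : ψ (omega l n : ℤ_[l]⟦X⟧) = 0 := by
    rw [coe_omega, map_sub, map_pow, map_add, map_one, hy, sub_self]
  have h2 : ψ' (omega l n : ℤ_[l]⟦X⟧) = 0 := by
    rw [coe_omega, map_sub, map_pow, map_add, map_one, ← hX, hy, sub_self]
  have h3 : ψ.comp Polynomial.coeToPowerSeries.ringHom =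
      ψ'.comp Polynomial.coeToPowerSeries.ringHom :=
    Polynomial.ringHom_ext (by simpa using hC) (by simpa using hX)
  have h4 : ψ p = ψ' p := RingHom.congr_fun h3 p
  rw [hg, map_add, map_add, map_mul, map_mul, h1, h2, zero_mul, zero_mul, h4]

end PowerSeriesRing

end Iwasawa

end

noncomputable section

namespace Iwasawa

open PowerSeries

/-! ### Freeness of the Iwasawa algebra over ℤ_l[[X]] -/

section GroupElements

variable (l : ℕ) [hl : Fact l.Prime] {G : Type*} [Group G] [TopologicalSpace G]

/-- The image of `g` in the Iwasawa algebra. -/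
def groupElement : G →* iwasawaAlgebra l G where
  toFun g := ⟨fun V => MonoidAlgebra.of ℤ_[l] _ (QuotientGroup.mk g), fun V W h => by
    simp only [transition, MonoidAlgebra.of_apply, MonoidAlgebra.mapDomainRingHom_apply,
      MonoidAlgebra.mapDomain_single]
    rfl⟩
  map_one' := Subtype.ext (funext fun V => map_one (MonoidAlgebra.of ℤ_[l] (G ⧸ V.toSubgroup)))
  map_mul' g g' := Subtype.ext (funext fun V =>
    map_mul (MonoidAlgebra.of ℤ_[l] (G ⧸ V.toSubgroup)) (QuotientGroup.mk g) (QuotientGroup.mk g'))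

variable {l}

theorem transition_algebraMap {V W : OpenNormalSubgroup G} (h : V.toSubgroup ≤ W.toSubgroup)
    (a : ℤ_[l]) : transition l G h (algebraMap _ _ a) = algebraMap _ _ a := by
  simp [transition]

variable {H : Subgroup G} {γ : G} {m : ℕ} {U : ℕ → OpenNormalSubgroup G}
  (T : IsIwasawaTower l H γ m U)
include T

namespace IsIwasawaTower

theorem of_pow_eq_one {n : ℕ} {V : OpenNormalSubgroup G} (h : (U n).toSubgroup ≤ V.toSubgroup) :
    (MonoidAlgebra.of ℤ_[l] (G ⧸ V.toSubgroup) (QuotientGroup.mk (γ ^ l ^ m))) ^ l ^ n = 1 := by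
  rw [← map_pow, ← QuotientGroup.mk_pow, ← pow_mul, ← pow_add,
    (QuotientGroup.eq_one_iff _).2 (h (T.pow_mem n)), map_one]

theorem exists_eval (V : OpenNormalSubgroup G) :
    ∃ ψ : ℤ_[l]⟦X⟧ →ₐ[ℤ_[l]] MonoidAlgebra ℤ_[l] (G ⧸ V.toSubgroup),
      ∀ p : Polynomial ℤ_[l], ψ p = Polynomial.aeval
        (MonoidAlgebra.of ℤ_[l] (G ⧸ V.toSubgroup) (QuotientGroup.mk (γ ^ l ^ m)) - 1) p := by
  obtain ⟨n, hn⟩ := T.exists_le V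
  exact exists_algHom_of_pow_eq_one (T.of_pow_eq_one hn)

/-- The evaluation of power series at `γ ^ l ^ m - 1` in `ℤ_l[G/V]`. -/
def eval (V : OpenNormalSubgroup G) :
    ℤ_[l]⟦X⟧ →ₐ[ℤ_[l]] MonoidAlgebra ℤ_[l] (G ⧸ V.toSubgroup) :=
  (T.exists_eval V).choose

theorem eval_coe (V : OpenNormalSubgroup G) (p : Polynomial ℤ_[l]) :
    T.eval V p = Polynomial.aeval
      (MonoidAlgebra.of ℤ_[l] (G ⧸ V.toSubgroup) (QuotientGroup.mk (γ ^ l ^ m)) - 1) p :=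
  (T.exists_eval V).choose_spec p

theorem eval_X (V : OpenNormalSubgroup G) : T.eval V X =
    MonoidAlgebra.of ℤ_[l] (G ⧸ V.toSubgroup) (QuotientGroup.mk (γ ^ l ^ m)) - 1 := by
  simpa using T.eval_coe V Polynomial.X

theorem transition_eval {V W : OpenNormalSubgroup G} (h : V.toSubgroup ≤ W.toSubgroup)
    (f : ℤ_[l]⟦X⟧) : transition l G h (T.eval V f) = T.eval W f := by
  obtain ⟨n, hn⟩ := T.exists_le V
  refine RingHom.congr_fun (f := (transition l G h).comp (T.eval V).toRingHom)
    (g := (T.eval W).toRingHom) (ringHom_ext_of_pow_eq_one (n := n) ?_ (fun a => ?_) ?_) f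
  · change (1 + transition l G h (T.eval V X)) ^ l ^ n = 1
    rw [eval_X, map_sub, map_one, add_sub_cancel, ← map_pow, T.of_pow_eq_one hn, map_one]
  · change transition l G h (T.eval V (algebraMap _ _ a)) = T.eval W (algebraMap _ _ a)
    rw [AlgHom.commutes, AlgHom.commutes, transition_algebraMap]
  · change transition l G h (T.eval V X) = T.eval W X
    rw [eval_X, eval_X, map_sub, map_one]
    exact congrArg (· - 1) ((groupElement l (γ ^ l ^ m)).2 V W h)

/-- The embedding of `ℤ_l⟦X⟧` into the centre of the Iwasawa algebra, `X ↦ γ ^ l ^ m - 1`. -/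
def powerSeriesHom : ℤ_[l]⟦X⟧ →+* iwasawaAlgebra l G :=
  (RingHom.pi fun V => (T.eval V).toRingHom).codRestrict _ fun f _ _ h => T.transition_eval h f

theorem powerSeriesHom_X : T.powerSeriesHom X = groupElement l (γ ^ l ^ m) - 1 :=
  Subtype.ext (funext fun V => T.eval_X V)

theorem eval_omega_dvd {n : ℕ} {f : ℤ_[l]⟦X⟧} (h : (omega l n : ℤ_[l]⟦X⟧) ∣ f) :
    T.eval (U n) f = 0 := by
  obtain ⟨g, rfl⟩ := h
  rw [map_mul, eval_coe, aeval_omega (T.of_pow_eq_one le_rfl), zero_mul]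

theorem commute_eval (V : OpenNormalSubgroup G) (f : ℤ_[l]⟦X⟧)
    (x : MonoidAlgebra ℤ_[l] (G ⧸ V.toSubgroup)) : Commute (T.eval V f) x := by
  obtain ⟨n, hn⟩ := T.exists_le V
  obtain ⟨p, -, g, hg⟩ := exists_polynomial n f
  have h1 : T.eval V (omega l n : ℤ_[l]⟦X⟧) = 0 := by
    rw [eval_coe, aeval_omega (T.of_pow_eq_one hn)]
  rw [sub_eq_iff_eq_add] at hg
  rw [hg, map_add, map_mul, h1, zero_mul, zero_add, eval_coe]
  have h2 : Commute (MonoidAlgebra.of ℤ_[l] (G ⧸ V.toSubgroup)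
      (QuotientGroup.mk (γ ^ l ^ m))) x := by
    induction x using MonoidAlgebra.induction_on with
    | of g =>
      obtain ⟨g, rfl⟩ := QuotientGroup.mk_surjective g
      have := Subgroup.mem_center_iff.1 T.central g
      rw [Commute, SemiconjBy, ← map_mul, ← map_mul, ← QuotientGroup.mk_mul, ← QuotientGroup.mk_mul,
        this]
    | add a b ha hb => exact ha.add_right hb
    | smul r a ha => exact ha.smul_right r
  have h3 := h2.sub_left (Commute.one_left x)
  rw [Polynomial.aeval_eq_sum_range]
  exact Commute.sum_left _ _ _ fun i _ => (h3.pow_left i).smul_left _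

theorem commute_powerSeriesHom (f : ℤ_[l]⟦X⟧) (x : iwasawaAlgebra l G) :
    Commute (T.powerSeriesHom f) x :=
  Subtype.ext (funext fun V => T.commute_eval V f (x.1 V))

omit hl in
theorem mk_injective {n : ℕ} {h h' : G} (hh : h ∈ H) (hh' : h' ∈ H) {c c' : ℕ}
    (hc : c < l ^ (m + n)) (hc' : c' < l ^ (m + n))
    (he : (QuotientGroup.mk (h * γ ^ c) : G ⧸ (U n).toSubgroup) = QuotientGroup.mk (h' * γ ^ c')) :
    h = h' ∧ c = c' := by
  rw [QuotientGroup.eq] at he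
  -- Conjugation by `γ ^ c` brings the quotient into the normal form `h * γ ^ c`, to which the tower
  -- condition applies.
  have h1 := (U n).isNormal'.conj_mem _ he (γ ^ c)
  have h2 : γ ^ c * ((h * γ ^ c)⁻¹ * (h' * γ ^ c')) * (γ ^ c)⁻¹ =
      (h⁻¹ * h') * γ ^ ((c' : ℤ) - c) := by
    rw [zpow_sub, zpow_natCast, zpow_natCast]
    group
  rw [h2] at h1
  obtain ⟨h3, h4⟩ := T.eq_one n _ (mul_mem (inv_mem hh) hh') _ h1
  refine ⟨inv_mul_eq_one.1 h3, ?_⟩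
  have h6 : (c' : ℤ) - c = 0 := by
    refine Int.eq_zero_of_abs_lt_dvd h4 ?_
    rw [abs_lt]
    zify at hc hc'
    constructor <;> linarith
  omega

variable [Fintype H]

/-- In `h γ ^ c`, divide `c` by `l ^ m`: the remainder selects the basis element and the quotient is
absorbed into a power of `1 + X`. -/
theorem exists_sum_eval {n : ℕ} (x : MonoidAlgebra ℤ_[l] (G ⧸ (U n).toSubgroup)) :
    ∃ r : H × Fin (l ^ m) → ℤ_[l]⟦X⟧, x = ∑ i, T.eval (U n) (r i) *
      MonoidAlgebra.of ℤ_[l] _ (QuotientGroup.mk (i.1 * γ ^ (i.2 : ℕ))) := by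
  classical
  induction x using MonoidAlgebra.induction_on with
  | of g =>
    obtain ⟨g, rfl⟩ := QuotientGroup.mk_surjective g
    obtain ⟨h, hh, c, hc⟩ := T.exists_coset n g
    rw [← QuotientGroup.eq] at hc
    refine ⟨Pi.single (⟨h, hh⟩, ⟨c % l ^ m, Nat.mod_lt _ (pow_pos hl.1.pos m)⟩)
      ((1 + X) ^ (c / l ^ m)), ?_⟩
    rw [Finset.sum_eq_single (⟨h, hh⟩, ⟨c % l ^ m, Nat.mod_lt _ (pow_pos hl.1.pos m)⟩),
      Pi.single_eq_same, map_pow, map_add, map_one, eval_X, add_sub_cancel, ← map_pow, ← map_mul,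
      ← hc, ← QuotientGroup.mk_pow, ← QuotientGroup.mk_mul]
    · have h1 : (γ ^ l ^ m) ^ (c / l ^ m) * (h * γ ^ (c % l ^ m)) = h * γ ^ c := by
        have h2 := Subgroup.mem_center_iff.1 (Subgroup.pow_mem _ T.central (c / l ^ m)) (h * γ ^ (c % l ^ m))
        rw [← h2, mul_assoc, ← pow_mul, ← pow_add, Nat.mod_add_div]
      exact congrArg (fun g => MonoidAlgebra.of ℤ_[l] _ (QuotientGroup.mk g)) h1.symm
    · intro i _ hi
      rw [Pi.single_eq_of_ne hi, map_zero, zero_mul]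
    · simp
  | add a b ha hb =>
    obtain ⟨r, rfl⟩ := ha
    obtain ⟨r', rfl⟩ := hb
    refine ⟨r + r', ?_⟩
    simp only [Pi.add_apply, map_add, add_mul, Finset.sum_add_distrib]
  | smul c a ha =>
    obtain ⟨r, rfl⟩ := ha
    refine ⟨c • r, ?_⟩
    simp only [Pi.smul_apply, map_smul, smul_mul_assoc, Finset.smul_sum]

/-- Modulo `omega l n` the coefficients are polynomials of degree less than `l ^ n` in `γ ^ l ^ m -
1`. Re-expanded in powers of `γ ^ l ^ m`, they are the coordinates with respect to pairwise distinct
elements of `G / U n`. -/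
theorem omega_dvd_of_sum_eval_eq_zero {n : ℕ} {r : H × Fin (l ^ m) → ℤ_[l]⟦X⟧}
    (hr : ∑ i, T.eval (U n) (r i) *
      MonoidAlgebra.of ℤ_[l] _ (QuotientGroup.mk (i.1 * γ ^ (i.2 : ℕ))) = 0) (i : H × Fin (l ^ m)) :
    (omega l n : ℤ_[l]⟦X⟧) ∣ r i := by
  choose p hp hrp using fun i => exists_polynomial n (r i)
  let q : H × Fin (l ^ m) → Polynomial ℤ_[l] := fun i => (p i).comp (Polynomial.X - 1)
  set y := MonoidAlgebra.of ℤ_[l] (G ⧸ (U n).toSubgroup) (QuotientGroup.mk (γ ^ l ^ m)) with hy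
  have hq : ∀ i, (q i).natDegree < l ^ n := fun i => by
    have h1 : (p i).natDegree < l ^ n := by
      by_cases h0 : p i = 0
      · rw [h0, Polynomial.natDegree_zero]
        exact pow_pos hl.1.pos n
      · rw [← natDegree_omega (l := l) n]
        exact Polynomial.natDegree_lt_natDegree h0 (hp i)
    rw [Polynomial.natDegree_comp, ← Polynomial.C_1, Polynomial.natDegree_X_sub_C, mul_one]
    exact h1
  have hev : ∀ i, T.eval (U n) (r i) = ∑ b ∈ Finset.range (l ^ n), (q i).coeff b • y ^ b := fun i => by
    have h1 := T.eval_omega_dvd (hrp i)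
    rw [map_sub, sub_eq_zero] at h1
    rw [h1, eval_coe, ← hy, ← Polynomial.aeval_eq_sum_range' (hq i), Polynomial.aeval_comp]
    simp
  let g : (H × Fin (l ^ m)) × Fin (l ^ n) → G ⧸ (U n).toSubgroup := fun z =>
    QuotientGroup.mk (z.1.1 * γ ^ ((z.1.2 : ℕ) + l ^ m * z.2))
  have hg : Function.Injective g := by
    rintro ⟨⟨h, a⟩, b⟩ ⟨⟨h', a'⟩, b'⟩ he
    have hlt : ∀ (a : Fin (l ^ m)) (b : Fin (l ^ n)), (a : ℕ) + l ^ m * b < l ^ (m + n) :=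
      fun a b => by
        rw [pow_add]
        calc (a : ℕ) + l ^ m * b < l ^ m + l ^ m * b := by gcongr; exact a.2
          _ = l ^ m * (b + 1) := by ring
          _ ≤ l ^ m * l ^ n := by gcongr; exact b.2
    obtain ⟨h1, h2⟩ := T.mk_injective h.2 h'.2 (hlt a b) (hlt a' b') he
    have h3 : a = a' := by
      have := congrArg (· % l ^ m) h2
      simpa [Nat.mod_eq_of_lt a.2, Nat.mod_eq_of_lt a'.2, Fin.ext_iff] using this
    have h4 : b = b' := by
      rw [h3] at h2
      exact Fin.ext (Nat.eq_of_mul_eq_mul_left (pow_pos hl.1.pos m) (Nat.add_left_cancel h2))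
    rw [Subtype.ext h1, h3, h4]
  have hli := (MonoidAlgebra.basis (G ⧸ (U n).toSubgroup) ℤ_[l]).linearIndependent.comp g hg
  rw [Fintype.linearIndependent_iff] at hli
  have hcoef := hli (fun z => (q z.1).coeff z.2) (by
    rw [Fintype.sum_prod_type, ← hr]
    refine Finset.sum_congr rfl fun i _ => ?_
    rw [hev, Finset.sum_mul, ← Fin.sum_univ_eq_sum_range (fun b => ((q i).coeff b • y ^ b) * _)]
    refine Finset.sum_congr rfl fun b _ => ?_
    rw [smul_mul_assoc, hy, ← map_pow, ← map_mul, ← QuotientGroup.mk_pow, ← QuotientGroup.mk_mul]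
    congr 1
    have h1 : (γ ^ l ^ m) ^ (b : ℕ) * (i.1 * γ ^ (i.2 : ℕ)) =
        i.1 * γ ^ ((i.2 : ℕ) + l ^ m * b) := by
      have h2 := Subgroup.mem_center_iff.1 (Subgroup.pow_mem _ T.central (b : ℕ)) (i.1 * γ ^ (i.2 : ℕ))
      rw [← h2, mul_assoc, ← pow_mul, ← pow_add]
    rw [h1]
    simp [g])
  have hq0 : q i = 0 := by
    refine Polynomial.ext fun b => ?_
    by_cases hb : b < l ^ n
    · exact hcoef (i, ⟨b, hb⟩)
    · exact Polynomial.coeff_eq_zero_of_natDegree_lt ((hq i).trans_le (not_lt.1 hb))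
  have hp0 : p i = 0 := by
    have h1 : (q i).comp (Polynomial.X + 1) = p i := by
      simp [q, Polynomial.comp_assoc]
    rw [← h1, hq0, Polynomial.zero_comp]
  have h1 := hrp i
  rwa [hp0, Polynomial.coe_zero, sub_zero] at h1

/-- The elements `h γ ^ a` with `h ∈ H` and `a < l ^ m` span the Iwasawa algebra over `ℤ_l⟦X⟧`. -/
theorem exists_sum_powerSeriesHom (x : iwasawaAlgebra l G) :
    ∃ r : H × Fin (l ^ m) → ℤ_[l]⟦X⟧, x = ∑ i, T.powerSeriesHom (r i) *
      groupElement l (i.1 * γ ^ (i.2 : ℕ)) := by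
  choose r hr using fun n => T.exists_sum_eval (x.1 (U n))
  have htr : ∀ n, transition l G (T.le_succ n) (x.1 (U (n + 1))) = x.1 (U n) := fun n =>
    x.2 _ _ _
  -- Uniqueness of the coefficients at level `n` modulo `omega l n` makes the choices at successive
  -- levels compatible, so they converge.
  have hdvd : ∀ i n, (omega l n : ℤ_[l]⟦X⟧) ∣ r (n + 1) i - r n i := fun i n => by
    refine T.omega_dvd_of_sum_eval_eq_zero (r := r (n + 1) - r n) ?_ i
    have h1 := htr n
    rw [hr (n + 1), hr n, map_sum] at h1
    simp only [Pi.sub_apply, map_sub, sub_mul, Finset.sum_sub_distrib]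
    rw [sub_eq_zero, ← h1]
    refine Finset.sum_congr rfl fun i _ => ?_
    rw [map_mul, T.transition_eval]
    congr 1
    exact ((groupElement l (i.1 * γ ^ (i.2 : ℕ))).2 _ _ (T.le_succ n)).symm
  choose f hf using fun i => exists_forall_omega_dvd_sub (hdvd i)
  refine ⟨f, Subtype.ext (funext fun V => ?_)⟩
  set x' := ∑ i, T.powerSeriesHom (f i) * groupElement l (i.1 * γ ^ (i.2 : ℕ)) with hx'
  obtain ⟨n, hn⟩ := T.exists_le V
  rw [← x.2 _ _ hn, ← x'.2 _ _ hn]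
  congr 1
  have h1 : x'.1 (U n) = ∑ i, T.eval (U n) (f i) *
      MonoidAlgebra.of ℤ_[l] _ (QuotientGroup.mk (i.1 * γ ^ (i.2 : ℕ))) := by
    rw [hx', AddSubmonoidClass.coe_finsetSum, Finset.sum_apply]
    rfl
  rw [h1, hr]
  refine Finset.sum_congr rfl fun i _ => ?_
  have h2 := T.eval_omega_dvd (hf i n)
  rw [map_sub, sub_eq_zero] at h2
  rw [h2]

theorem eq_zero_of_sum_powerSeriesHom_eq_zero {r : H × Fin (l ^ m) → ℤ_[l]⟦X⟧}
    (hr : ∑ i, T.powerSeriesHom (r i) * groupElement l (i.1 * γ ^ (i.2 : ℕ)) = 0)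
    (i : H × Fin (l ^ m)) : r i = 0 := by
  refine eq_zero_of_forall_omega_dvd fun n => T.omega_dvd_of_sum_eval_eq_zero ?_ i
  have h1 := congrFun (congrArg Subtype.val hr) (U n)
  rw [AddSubmonoidClass.coe_finsetSum, Finset.sum_apply] at h1
  exact h1

omit [Fintype H] in
theorem powerSeriesHom_mem_nonZeroDivisors [Finite H] {f : ℤ_[l]⟦X⟧} (hf : f ≠ 0) :
    T.powerSeriesHom f ∈ centralRegular (iwasawaAlgebra l G) := by
  have := Fintype.ofFinite H
  have key : ∀ x, T.powerSeriesHom f * x = 0 → x = 0 := by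
    intro x hx
    obtain ⟨r, rfl⟩ := T.exists_sum_powerSeriesHom x
    simp only [Finset.mul_sum, ← mul_assoc, ← map_mul] at hx
    refine Finset.sum_eq_zero fun i _ => ?_
    have h1 := T.eq_zero_of_sum_powerSeriesHom_eq_zero (r := fun i => f * r i) hx i
    rw [(mul_eq_zero.1 h1).resolve_left hf, map_zero, zero_mul]
  exact ⟨Submonoid.mem_center_iff.2 fun x => (T.commute_powerSeriesHom f x).eq.symm, key,
    fun x hx => key x ((T.commute_powerSeriesHom f x).eq.trans hx)⟩

end IsIwasawaTower

end GroupElements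

end Iwasawa

end

noncomputable section

namespace Iwasawa

/-! ### Denominators in the power series ring -/

section Integral

variable {Λ R ι : Type*} [CommRing Λ] [Ring R] [Finite ι] {φ : Λ →+* R}

theorem exists_monic_eval₂_eq_zero (hφ : ∀ f x, Commute (φ f) x) {g : ι → R}
    (hg : ∀ x, ∃ r : ι → Λ, x = ∑ᶠ i, φ (r i) * g i) (z : R) :
    ∃ p : Polynomial Λ, p.Monic ∧ p.eval₂ φ z = 0 := by
  have := Fintype.ofFinite ι
  let : Algebra Λ R := φ.toAlgebra' hφ
  have hfin : Module.Finite Λ R := by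
    refine ⟨⟨(Set.finite_range g).toFinset, eq_top_iff.2 fun x _ => ?_⟩⟩
    obtain ⟨r, rfl⟩ := hg x
    rw [Set.Finite.coe_toFinset, finsum_eq_sum_of_fintype]
    exact sum_mem fun i _ => Submodule.smul_mem (Submodule.span Λ (Set.range g)) (r i) (Submodule.subset_span ⟨i, rfl⟩)
  exact IsIntegral.of_finite Λ z

/-- In a monic equation of `s`, factors `s` can be cancelled until the constant term is nonzero;
that term is then a multiple of `s`. So denominators from `Λ` suffice. -/
theorem exists_mul_eq_of_mem_centralRegular [Nontrivial R] (hφ : ∀ f x, Commute (φ f) x) {g : ι → R}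
    (hg : ∀ x, ∃ r : ι → Λ, x = ∑ᶠ i, φ (r i) * g i) {s : R} (hs : s ∈ centralRegular R) :
    ∃ a ≠ 0, ∃ t, s * t = φ a := by
  obtain ⟨p, hp, hps⟩ := exists_monic_eval₂_eq_zero hφ hg s
  induction hn : p.natDegree generalizing p with
  | zero =>
    rw [hp.natDegree_eq_zero.1 hn] at hps
    simp at hps
  | succ n ih =>
    have hdiv : s * p.divX.eval₂ φ s = - φ (p.coeff 0) := by
      have h1 := congrArg (Polynomial.eval₂ φ s) p.divX_mul_X_add
      rw [Polynomial.eval₂_add, Polynomial.eval₂_mul_X, Polynomial.eval₂_C, hps] at h1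
      rw [Submonoid.mem_center_iff.1 hs.1 _] at h1
      exact eq_neg_of_add_eq_zero_left h1
    by_cases h0 : p.coeff 0 = 0
    · refine ih p.divX ?_ ?_ ?_
      · rw [Polynomial.Monic, Polynomial.leadingCoeff, Polynomial.natDegree_divX_eq_natDegree_tsub_one,
          Polynomial.coeff_divX, hn, Nat.add_sub_cancel, ← hn]
        exact hp
      · rw [h0, map_zero, neg_zero] at hdiv
        exact hs.2.1 _ hdiv
      · rw [Polynomial.natDegree_divX_eq_natDegree_tsub_one, hn, Nat.add_sub_cancel]
    · refine ⟨p.coeff 0, h0, -p.divX.eval₂ φ s, by rw [mul_neg, hdiv, neg_neg]⟩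

end Integral

/-! ### The power series ring inside the centre of D -/

section Component

variable {R : Type*} [Ring R] {e : TotalFractions R} (he : IsPrimitiveCentralIdempotent e)
  {D : Type*} [DivisionRing D] {n : ℕ} (f : Component he ≃+* Matrix (Fin n) (Fin n) D)

/-- The homomorphism `x ↦ ex` from `R` to the component. -/
def toComponent : R →+* Component he where
  toFun x := ⟨e * OreLocalization.numeratorRingHom x,
    (Subsemigroup.mem_corner_iff he.idem).2 ⟨by rw [← mul_assoc, he.idem.eq], by
      rw [mul_assoc, Subring.mem_center_iff.1 he.central, ← mul_assoc, he.idem.eq]⟩⟩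
  map_one' := Subtype.ext <| by
    change e * OreLocalization.numeratorRingHom (1 : R) = e
    rw [map_one, mul_one]
  map_zero' := Subtype.ext <| by
    change e * OreLocalization.numeratorRingHom (0 : R) = 0
    rw [map_zero, mul_zero]
  map_add' c d := Subtype.ext <| by
    change e * OreLocalization.numeratorRingHom (c + d) = e * _ + e * _
    rw [map_add, mul_add]
  map_mul' c d := Subtype.ext <| by
    change e * OreLocalization.numeratorRingHom (c * d) = e * _ * (e * _)
    rw [map_mul, ← mul_assoc (e * _) e, mul_assoc e _ e, Subring.mem_center_iff.1 he.central,
      ← mul_assoc e e, he.idem.eq, mul_assoc]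

include he in
theorem IsPrimitiveCentralIdempotent.mul_mul_mul (a b : TotalFractions R) :
    e * a * (e * b) = e * (a * b) := by
  rw [mul_assoc, ← mul_assoc a, Subring.mem_center_iff.1 he.central a, mul_assoc e a b, ← mul_assoc,
    he.idem.eq]

theorem isUnit_toComponent {s : R} (hs : s ∈ centralRegular R) : IsUnit (toComponent he s) := by
  obtain ⟨u, hu⟩ := OreLocalization.numerator_isUnit (⟨s, hs⟩ : centralRegular R)
  have hu' : (u : TotalFractions R) = OreLocalization.numeratorRingHom s := hu
  have hmem : e * ((u⁻¹ : (TotalFractions R)ˣ) : TotalFractions R) ∈ Subsemigroup.corner e :=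
    (Subsemigroup.mem_corner_iff he.idem).2 ⟨by rw [← mul_assoc, he.idem.eq], by
      rw [mul_assoc, Subring.mem_center_iff.1 he.central, ← mul_assoc, he.idem.eq]⟩
  refine ⟨⟨toComponent he s, ⟨_, hmem⟩, Subtype.ext ?_, Subtype.ext ?_⟩, rfl⟩
  · change e * OreLocalization.numeratorRingHom s * (e * ((u⁻¹ : (TotalFractions R)ˣ) : TotalFractions R)) = e
    rw [← hu', he.mul_mul_mul, Units.mul_inv, mul_one]
  · change e * ((u⁻¹ : (TotalFractions R)ˣ) : TotalFractions R) * (e * OreLocalization.numeratorRingHom s) = e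
    rw [← hu', he.mul_mul_mul, Units.inv_mul, mul_one]

theorem exists_mul_toComponent (z : Component he) :
    ∃ r, ∃ s ∈ centralRegular R, z * toComponent he s = toComponent he r := by
  obtain ⟨z, hz⟩ := z
  obtain ⟨r, s, h⟩ : ∃ (r : R) (s : centralRegular R), z = r /ₒ s := by
    induction z using OreLocalization.ind with
    | _ r s => exact ⟨r, s, rfl⟩
  refine ⟨r, s, s.2, Subtype.ext ?_⟩
  have h1 : z * OreLocalization.numeratorRingHom (s : R) = OreLocalization.numeratorRingHom r := by
    rw [numerator_comm ⟨(s : R), Subring.mem_center_iff.2 (Submonoid.mem_center_iff.1 s.2.1)⟩, h]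
    exact OreLocalization.mul_cancel (S := centralRegular R)
  change z * (e * OreLocalization.numeratorRingHom (s : R)) = e * OreLocalization.numeratorRingHom r
  rw [← h1, ← mul_assoc, ← mul_assoc, ((Subsemigroup.mem_corner_iff he.idem).1 hz).2,
    ((Subsemigroup.mem_corner_iff he.idem).1 hz).1]

include f in
theorem pos_of_component : 0 < n := by
  refine Nat.pos_of_ne_zero fun h => he.ne_zero ?_
  subst h
  have h1 : (1 : Component he) = 0 := f.injective (Subsingleton.elim _ _)
  exact congrArg Subtype.val h1

theorem centerToScalar_bijective (hn : 0 < n) : Function.Bijective (centerToScalar n D) := by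
  have : Nonempty (Fin n) := ⟨⟨0, hn⟩⟩
  refine ⟨fun z w h => Subtype.ext ?_, fun z => ?_⟩
  · exact Matrix.scalar_inj.1 (congrArg Subtype.val h)
  · obtain ⟨z, hz⟩ := z
    obtain ⟨d, hd, h⟩ := (Matrix.subringCenter_eq_scalar_map (R := D) (n := Fin n)).le hz
    exact ⟨⟨d, hd⟩, Subtype.ext h⟩

/-- A central Noetherian ring `Λ ⊆ R`, over which `R` is finite and torsion free, embeds into the
centre of the skew field `D`; the elements of `D` become fractions with denominators in `Λ`. -/
theorem exists_hom_center {Λ : Type*} [CommRing Λ] [Nontrivial R] {ι : Type*} [Finite ι]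
    {φ : Λ →+* R} (hφ : ∀ f x, Commute (φ f) x) (hreg : ∀ f, f ≠ 0 → φ f ∈ centralRegular R)
    {g : ι → R} (hg : ∀ x, ∃ r : ι → Λ, x = ∑ᶠ i, φ (r i) * g i) :
    ∃ θ : Λ →+* Subring.center D, Function.Injective θ ∧
      (∀ a, f (toComponent he (φ a)) = Matrix.scalar (Fin n) (θ a : D)) ∧
      (∀ z, z ∈ integralCentre he f ↔ θ.IsIntegralElem z) ∧
      ∀ M : Matrix (Fin n) (Fin n) D, ∃ a ≠ 0, ∃ r : R,
        M * f (toComponent he (φ a)) = f (toComponent he r) := by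
  have hn := pos_of_component he f
  have hc : ∀ a, φ a ∈ Subring.center R := fun a =>
    Subring.mem_center_iff.2 fun x => (hφ a x).eq.symm
  let φc : Λ →+* Subring.center R := φ.codRestrict _ hc
  let σ : Subring.center D →+* Subring.center (Component he) :=
    (Subring.centerCongr f.symm).toRingHom.comp (centerToScalar n D)
  let σe := RingEquiv.ofBijective σ
    ((Subring.centerCongr f.symm).bijective.comp (centerToScalar_bijective hn))
  let κ := (centerToComponent he).comp φc
  -- The embedding of `Λ` in `Z(A)`, transported along the isomorphism of `Z(D)` with `Z(A)` by
  -- scalar matrices.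
  let θ : Λ →+* Subring.center D := σe.symm.toRingHom.comp κ
  have hσθ : σ.comp θ = κ := RingHom.ext fun a => σe.apply_symm_apply _
  have hθ : ∀ a, f (toComponent he (φ a)) = Matrix.scalar (Fin n) (θ a : D) := fun a => by
    have h1 : f.symm (Matrix.scalar (Fin n) (θ a : D)) = toComponent he (φ a) :=
      congrArg Subtype.val (RingHom.congr_fun hσθ a)
    rw [← h1, RingEquiv.apply_symm_apply]
  have : Nontrivial (Component he) := ⟨⟨0, 1, fun h => he.ne_zero (congrArg Subtype.val h).symm⟩⟩
  refine ⟨θ, (injective_iff_map_eq_zero θ).2 fun a ha => ?_, hθ, fun z => ⟨fun hz => ?_, fun hz => ?_⟩,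
    fun M => ?_⟩
  · by_contra h0
    refine (isUnit_toComponent he (hreg a h0)).ne_zero (f.injective ?_)
    rw [hθ, ha, map_zero]
    exact map_zero _
  · let : Algebra Λ (Subring.center (Component he)) := κ.toAlgebra
    let : Algebra Λ (centerToComponent he).range :=
      ((centerToComponent he).rangeRestrict.comp φc).toAlgebra
    have : IsScalarTower Λ (centerToComponent he).range (Subring.center (Component he)) :=
      .of_algebraMap_eq fun a => rfl
    -- The centre of `R` is integral over `Λ`, so integrality over its image and over `Λ` agree.
    have hint : Algebra.IsIntegral Λ (centerToComponent he).range := ⟨fun c => by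
      obtain ⟨c, rfl⟩ := (centerToComponent he).rangeRestrict_surjective c
      obtain ⟨p, hp, hp0⟩ := exists_monic_eval₂_eq_zero hφ hg (c : R)
      refine ⟨p, hp, ?_⟩
      have h1 : p.eval₂ φc c = 0 := Subtype.ext <| by
        have := Polynomial.hom_eval₂ p φc (Subring.center R).subtype c
        exact this.trans hp0
      have h2 := Polynomial.hom_eval₂ p φc (centerToComponent he).rangeRestrict c
      rw [h1, map_zero] at h2
      exact h2.symm⟩
    have hz' : IsIntegral (centerToComponent he).range (σ z) := hz
    obtain ⟨p, hp, hp0⟩ := isIntegral_trans (R := Λ) _ hz'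
    refine ⟨p, hp, σe.injective ?_⟩
    have h2 := Polynomial.hom_eval₂ p θ σ z
    rw [hσθ] at h2
    rw [map_zero]
    exact h2.trans hp0
  · obtain ⟨p, hp, hp0⟩ := hz
    have h2 := Polynomial.hom_eval₂ p θ σ z
    rw [hp0, map_zero, hσθ] at h2
    change ((Subring.subtype (centerToComponent he).range)).IsIntegralElem (σ z)
    refine RingHom.IsIntegralElem.of_comp
      (f := (centerToComponent he).rangeRestrict.comp φc) ⟨p, hp, h2.symm⟩
  · obtain ⟨r, s, hs, h⟩ := exists_mul_toComponent he (f.symm M)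
    obtain ⟨a, ha, t, hst⟩ := exists_mul_eq_of_mem_centralRegular hφ hg hs
    refine ⟨a, ha, r * t, ?_⟩
    rw [← hst, map_mul, map_mul, map_mul, map_mul, ← mul_assoc, ← h, map_mul,
      RingEquiv.apply_symm_apply]

end Component

end Iwasawa

end

noncomputable section

namespace Iwasawa

open WithZero

/-! ### Corners spanned by ⟨γ⟩H -/

section Group

variable {l : ℕ} [hl : Fact l.Prime] {G : Type*} [Group G] {H : Subgroup G} [H.Normal] [Finite H]
  {γ : G} {m : ℕ}

omit [Finite H] in
theorem exists_mem_mul_eq_of_mk_eq {a b : G}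
    (h : (QuotientGroup.mk a : G ⧸ H) = QuotientGroup.mk b) : ∃ h ∈ H, a = h * b :=
  ⟨a / b, QuotientGroup.eq_iff_div_mem.1 h, by simp⟩

/-- The `l ^ m`-th power of `h γ ^ i` is a central element times an element of `H`, and the latter
dies after raising to the order of `H`. -/
theorem exists_pow_mem_center (hH : IsPGroup l H) (hγ : γ ^ l ^ m ∈ Subgroup.center G)
    (hgen : ∀ g : G, ∃ h ∈ H, ∃ i : ℤ, g = h * γ ^ i) (g : G) :
    ∃ k, g ^ l ^ k ∈ Subgroup.center G := by
  obtain ⟨c, hc⟩ := IsPGroup.iff_card.1 hH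
  obtain ⟨h, hh, i, rfl⟩ := hgen g
  obtain ⟨h', hh', he⟩ : ∃ h' ∈ H, (h * γ ^ i) ^ l ^ m = h' * (γ ^ l ^ m) ^ i := by
    refine exists_mem_mul_eq_of_mk_eq ?_
    rw [QuotientGroup.mk_pow, QuotientGroup.mk_mul, (QuotientGroup.eq_one_iff h).2 hh, one_mul,
      ← QuotientGroup.mk_pow]
    congr 1
    rw [← zpow_natCast, ← zpow_natCast, zpow_comm]
  refine ⟨m + c, ?_⟩
  have hcomm : Commute h' ((γ ^ l ^ m) ^ i) :=
    Subgroup.mem_center_iff.1 (Subgroup.zpow_mem _ hγ i) h'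
  have h1 : h' ^ l ^ c = 1 := by
    rw [← hc]
    exact congrArg Subtype.val (pow_card_eq_one' (x := (⟨h', hh'⟩ : H)))
  rw [pow_add, pow_mul, he, hcomm.mul_pow, h1, one_mul]
  exact Subgroup.pow_mem _ (Subgroup.zpow_mem _ hγ i) _

omit [Finite H] in
/-- A subgroup containing a power of the generator `γ` modulo `H` is itself generated by a
single element modulo `H`. -/
theorem exists_generator_of_subgroup (hgen : ∀ g : G, ∃ h ∈ H, ∃ i : ℤ, g = h * γ ^ i)
    {S : Subgroup G} (hS : γ ^ l ^ m ∈ S) :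
    ∃ x ∈ S, ∃ j, (∃ h ∈ H, x ^ l ^ j = h * γ ^ l ^ m) ∧
      ∀ s ∈ S, ∃ h ∈ H, ∃ i < l ^ j, ∃ d : ℤ, s = h * x ^ i * (γ ^ l ^ m) ^ d := by
  -- The exponents of `γ` occurring in `S` modulo `H` form a subgroup of `ℤ` containing `l ^ m`,
  -- hence generated by some `l ^ j`; the exponent returned below is `m - j`.
  let J : AddSubgroup ℤ := AddSubgroup.toSubgroup.symm ((S ⊔ H).comap (zpowersHom G γ))
  have hJ : ∀ i : ℤ, i ∈ J ↔ γ ^ i ∈ S ⊔ H := fun i => Iff.rfl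
  obtain ⟨a, ha⟩ := Int.subgroup_cyclic J
  have hmemJ : ∀ i, i ∈ J ↔ a ∣ i := fun i => by
    rw [ha, AddSubgroup.mem_closure_singleton]
    exact ⟨fun ⟨n, hn⟩ => ⟨n, by rw [← hn, smul_eq_mul, mul_comm]⟩,
      fun ⟨n, hn⟩ => ⟨n, by rw [hn, smul_eq_mul, mul_comm]⟩⟩
  have hm : a ∣ (l : ℤ) ^ m := by
    rw [← hmemJ, hJ, ← Nat.cast_pow, zpow_natCast]
    exact Subgroup.mem_sup_left hS
  have hm' : a.natAbs ∣ l ^ m := by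
    have := Int.natAbs_dvd_natAbs.2 hm
    rwa [Int.natAbs_pow, Int.natAbs_natCast] at this
  obtain ⟨j, hj, hja⟩ := (Nat.dvd_prime_pow hl.1).1 hm'
  have hmemJ' : ∀ i, i ∈ J ↔ ((l ^ j : ℕ) : ℤ) ∣ i := fun i => by
    rw [hmemJ, ← hja, Int.natAbs_dvd]
  obtain ⟨x, hx, h, hh, hxh⟩ := Subgroup.mem_sup_of_normal_right.1 ((hJ _).1 ((hmemJ' _).2 dvd_rfl))
  rw [zpow_natCast] at hxh
  have hxγ : (QuotientGroup.mk x : G ⧸ H) = QuotientGroup.mk γ ^ l ^ j := by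
    rw [← QuotientGroup.mk_pow, ← hxh, QuotientGroup.mk_mul, (QuotientGroup.eq_one_iff h).2 hh,
      mul_one]
  have hpow : l ^ j * l ^ (m - j) = l ^ m := by rw [← pow_add, Nat.add_sub_cancel' hj]
  refine ⟨x, hx, m - j, exists_mem_mul_eq_of_mk_eq ?_, fun s hs => ?_⟩
  · rw [QuotientGroup.mk_pow, hxγ, ← pow_mul, hpow, QuotientGroup.mk_pow]
  · obtain ⟨h', hh', c, rfl⟩ := hgen s
    have hc : c ∈ J := by
      rw [hJ]
      have h1 : γ ^ c = h'⁻¹ * (h' * γ ^ c) := by group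
      rw [h1]
      exact mul_mem (Subgroup.mem_sup_right (inv_mem hh')) (Subgroup.mem_sup_left hs)
    obtain ⟨c', rfl⟩ := (hmemJ' _).1 hc
    have hq : (0 : ℤ) < (l ^ (m - j) : ℕ) := by exact_mod_cast pow_pos hl.1.pos _
    obtain ⟨i, hi⟩ := Int.eq_ofNat_of_zero_le (Int.emod_nonneg c' hq.ne')
    have hi' : i < l ^ (m - j) := by
      have := Int.emod_lt_of_pos c' hq
      rw [hi] at this
      exact_mod_cast this
    have hcc : c' = i + (l ^ (m - j) : ℕ) * (c' / (l ^ (m - j) : ℕ)) := by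
      rw [← hi, Int.emod_add_mul_ediv]
    obtain ⟨h₁, hh₁, he⟩ := exists_mem_mul_eq_of_mk_eq (H := H)
      (a := h' * γ ^ (((l ^ j : ℕ) : ℤ) * c'))
      (b := x ^ i * (γ ^ l ^ m) ^ (c' / (l ^ (m - j) : ℕ))) (by
        rw [QuotientGroup.mk_mul, QuotientGroup.mk_mul, (QuotientGroup.eq_one_iff h').2 hh', one_mul,
          QuotientGroup.mk_pow, hxγ, QuotientGroup.mk_zpow, QuotientGroup.mk_zpow,
          QuotientGroup.mk_pow, ← pow_mul, ← zpow_natCast, ← zpow_natCast, ← zpow_mul, ← zpow_add]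
        congr 1
        conv_lhs => rw [hcc]
        rw [← hpow]
        push_cast
        ring)
    exact ⟨h₁, hh₁, i, hi', _, by rw [he, mul_assoc]⟩

end Group

theorem natCast_pow_mul_eq_smul {F B : Type*} [CommRing F] [Ring B] [Algebra F B] {l : ℕ} (n : ℕ)
    (b : B) : (l : B) ^ n * b = (l : F) ^ n • b := by
  rw [Algebra.smul_def, map_pow, map_natCast]

theorem aeval_int_eq {B : Type*} [Ring B] (i j : Algebra ℤ B) (x : B) (f : Polynomial ℤ) :
    @Polynomial.aeval ℤ B _ _ i x f = @Polynomial.aeval ℤ B _ _ j x f := by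
  rw [Subsingleton.elim i j]

/-- Let `A` be spanned over the fraction field of `Λ` by a group which is the product of a finite
normal `l`-subgroup and a cyclic group `⟨γ⟩`, where a power of `γ` acts as `1 + T`. Then some corner
of `A` is a skew field with a discrete valuation with commutative residue field. -/
theorem exists_corner_valuation {Λ : Type*} (A₀ : Type*) {F A : Type*} [CommRing Λ] [IsLocalRing Λ]
    [IsNoetherianRing Λ] {l : ℕ} [hlp : Fact l.Prime] (hl2 : l ≠ 2) {T : Λ}
    (hmax : IsLocalRing.maximalIdeal Λ = Ideal.span {(l : Λ), T})
    [hP : (Ideal.span {(l : Λ)}).IsPrime] (hT : T ∉ Ideal.span {(l : Λ)})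
    [CommRing A₀] [Algebra Λ A₀] [IsLocalization.AtPrime A₀ (Ideal.span {(l : Λ)})]
    [Field F] [CharZero F] [Algebra A₀ F]
    (hF : ∀ c : F, ∃ n : ℕ, ∃ a : A₀, (l : F) ^ n * c = algebraMap A₀ F a)
    [Ring A] [Nontrivial A] [Algebra F A] [FiniteDimensional F A] [Algebra A₀ A]
    [IsScalarTower A₀ F A] [Algebra Λ A] [IsScalarTower Λ A₀ A]
    {G : Type*} [Group G] (H : Subgroup G) [H.Normal] [Finite H] (hH : IsPGroup l H) {γ : G} {m : ℕ}
    (hγ : γ ^ l ^ m ∈ Subgroup.center G) (hgen : ∀ g : G, ∃ h ∈ H, ∃ i : ℤ, g = h * γ ^ i)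
    {ρ : G →* A} (hρ : Submodule.span F (Set.range ρ) = ⊤)
    (hργ : ρ (γ ^ l ^ m) = algebraMap Λ A (1 + T)) :
    ∃ (ε : A) (hε : IsIdempotentElem ε), ε ≠ 0 ∧ (∀ b : hε.Corner, b ≠ 0 → IsUnit b) ∧
      ∃ v : Valuation hε.Corner ℤᵐ⁰,
        (∃ t : Finset hε.Corner, ∀ b, v b ≤ 1 ↔ b ∈ Submodule.span A₀ (t : Set hε.Corner)) ∧
        v (l : hε.Corner) < 1 ∧ ∀ a b, v a ≤ 1 → v b ≤ 1 → v (a * b - b * a) < 1 := by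
  obtain ⟨ε, S, h, h₀, hh₀, hcyc, hζ⟩ := exists_isCornerPair_cyclic hρ hl2 H hH
    (exists_pow_mem_center hH hγ hgen)
  -- The element acts as a scalar from `Λ`, so it belongs to every stabilizer.
  have hγS : γ ^ l ^ m ∈ S := h.central _ fun a => by rw [hργ, Algebra.commutes]
  obtain ⟨x, hx, j, ⟨h₁, hh₁, hxj⟩, hS⟩ := exists_generator_of_subgroup (l := l) hgen hγS
  have hh₁S : h₁ ∈ S := by
    rw [← mul_inv_eq_iff_eq_mul] at hxj
    rw [← hxj]
    exact mul_mem (pow_mem hx _) (inv_mem hγS)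
  have hnt : Nontrivial h.idem.Corner :=
    ⟨⟨0, 1, fun h0 => h.ne_zero (congrArg Subtype.val h0).symm⟩⟩
  have hΛB : ∀ a : Λ, algebraMap Λ h.idem.Corner a =
      algebraMap A₀ h.idem.Corner (algebraMap Λ A₀ a) := fun a => Subtype.ext <| by
    rw [corner_coe_algebraMap, corner_coe_algebraMap, algebraMap_smul]
  have : IsScalarTower Λ A₀ h.idem.Corner := .of_algebraMap_eq hΛB
  have hFB : ∀ (a : A₀) (b : h.idem.Corner), a • b = algebraMap A₀ F a • b := fun a b =>
    Subtype.ext (algebraMap_smul F a b.1).symm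
  obtain ⟨k, hk⟩ := hH ⟨h₀, hh₀⟩
  have hfin : Finite (H.subgroupOf S) :=
    Finite.of_injective (fun s => (⟨s.1, s.2⟩ : H)) fun s t hst =>
      Subtype.ext (Subtype.ext (congrArg (fun z : H => (z : G)) hst))
  refine ⟨ε, h.idem, h.ne_zero, exists_valuation_of_span h.hom A₀ hl2 hmax hT (HS := H.subgroupOf S)
    inferInstance (h₀ := h₀) hh₀ (fun s hs => hcyc s hs) (k := k)
    (Subtype.ext (show (h₀ : G) ^ l ^ k = 1 from congrArg Subtype.val hk))
    (hζ.imp_right fun ⟨f, hf⟩ => ⟨f, hf.trans (congrArg _ (aeval_int_eq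
      (cornerAlgebra h.idem) _ (h.hom h₀) f))⟩)
    (x := ⟨x, hx⟩) (γ₀ := ⟨_, hγS⟩) (j := j) ?_ (fun s => ?_) ⟨⟨h₁, hh₁S⟩, hh₁, Subtype.ext hxj⟩ ?_ ?_⟩
  · refine Subtype.ext ?_
    rw [corner_coe_algebraMap]
    change ε * ρ (γ ^ l ^ m) = _
    rw [hργ, ← Algebra.commutes, Algebra.smul_def]
  · obtain ⟨h', hh', i, hi, d, he⟩ := hS s s.2
    have hh'S : h' ∈ S := by
      rw [mul_assoc, ← mul_inv_eq_iff_eq_mul] at he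
      rw [← he]
      exact mul_mem s.2 (inv_mem (mul_mem (pow_mem hx _) (zpow_mem hγS _)))
    exact ⟨⟨h', hh'S⟩, hh', i, hi, d, Subtype.ext he⟩
  · have h1 : IsUnit (l : F) := isUnit_iff_ne_zero.2 (Nat.cast_ne_zero.2 hlp.1.ne_zero)
    have h2 := h1.map (algebraMap F h.idem.Corner)
    rwa [map_natCast] at h2
  · intro b
    have hb : b ∈ Submodule.span F (Set.range h.hom) := by
      rw [h.span_hom]; exact Submodule.mem_top
    have hmul : ∀ (n : ℕ) (b : h.idem.Corner), (l : h.idem.Corner) ^ n * b = (l : F) ^ n • b :=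
      fun n b => natCast_pow_mul_eq_smul n b
    have hmul' : ∀ (n : ℕ) {b : h.idem.Corner}, b ∈ Submodule.span A₀ (Set.range h.hom) →
        (l : F) ^ n • b ∈ Submodule.span A₀ (Set.range h.hom) := fun n b hb => by
      have := Submodule.smul_mem _ ((l : A₀) ^ n) hb
      rwa [hFB, map_pow, map_natCast] at this
    simp only [hmul]
    induction hb using Submodule.span_induction with
    | mem b hb => exact ⟨0, by rw [pow_zero, one_smul]; exact Submodule.subset_span hb⟩
    | zero => exact ⟨0, by rw [smul_zero]; exact zero_mem _⟩
    | add a b _ _ iha ihb =>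
      obtain ⟨n, hn⟩ := iha
      obtain ⟨n', hn'⟩ := ihb
      refine ⟨n + n', ?_⟩
      rw [smul_add]
      refine add_mem ?_ ?_
      · rw [pow_add, mul_comm, mul_smul]
        exact hmul' _ hn
      · rw [pow_add, mul_smul]
        exact hmul' _ hn'
    | smul c b _ ihb =>
      obtain ⟨n, hn⟩ := ihb
      obtain ⟨n', a, ha⟩ := hF c
      refine ⟨n' + n, ?_⟩
      have h1 : (l : F) ^ (n' + n) • c • b = algebraMap A₀ F a • (l : F) ^ n • b := by
        rw [smul_smul, smul_smul, ← ha]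
        congr 1
        ring
      rw [h1, ← hFB]
      exact Submodule.smul_mem _ _ hn

end Iwasawa

end

noncomputable section

namespace Iwasawa

open WithZero

/-! ### Identification of the corner with D -/

section Matrix

/-- A nonzero entry of `ε` gives `a` and `b` with `b * a` a diagonal matrix unit. Then `a * b` is a
nonzero idempotent of a skew field, hence equal to `ε`, and `d ↦ a d b` is the isomorphism. -/
theorem exists_algEquiv_corner (A₀ : Type*) {D ι : Type*} [CommRing A₀] [DivisionRing D]
    [Algebra A₀ D] [Fintype ι] [DecidableEq ι] {ε : Matrix ι ι D} (hε : IsIdempotentElem ε)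
    (h0 : ε ≠ 0) (hdiv : ∀ b : hε.Corner, b ≠ 0 → IsUnit b) :
    Nonempty (D ≃ₐ[A₀] hε.Corner) := by
  obtain ⟨i, j, hij⟩ : ∃ i j, ε i j ≠ 0 := by
    by_contra! h
    exact h0 (Matrix.ext h)
  let s : D → Matrix ι ι D := Matrix.single i i
  have hs : ∀ d d', s d * s d' = s (d * d') := fun d d' => Matrix.single_mul_single_same ..
  let a : Matrix ι ι D := ε * Matrix.single j i (ε i j)⁻¹
  let b : Matrix ι ι D := s 1 * ε
  have hsM : ∀ M : Matrix ι ι D, s 1 * M * s 1 = s (M i i) := fun M => by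
    simp [s]
  have hεa : ε * a = a := by rw [← mul_assoc, hε.eq]
  have hbε : b * ε = b := by rw [mul_assoc, hε.eq]
  have has : a * s 1 = a := by
    rw [mul_assoc]
    congr 1
    simp [s]
  have hsb : s 1 * b = b := by rw [← mul_assoc, hs, mul_one]
  have hba : b * a = s 1 := by
    have h1 : b * a = s 1 * ε * Matrix.single j i (ε i j)⁻¹ := by
      rw [← mul_assoc, hbε]
    rw [h1, Matrix.single_mul_mul_single, one_mul, mul_inv_cancel₀ hij]
  clear_value a b
  have hmem : ∀ M, a * M * b ∈ Subsemigroup.corner ε := fun M =>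
    (Subsemigroup.mem_corner_iff hε).2
      ⟨by rw [← mul_assoc, ← mul_assoc, hεa], by rw [mul_assoc, hbε]⟩
  have hab : a * b = ε := by
    let u : hε.Corner := ⟨a * 1 * b, hmem 1⟩
    have hu : u * u = u := Subtype.ext <| by
      change a * 1 * b * (a * 1 * b) = a * 1 * b
      rw [mul_one, mul_assoc a b, ← mul_assoc b a b, hba, hsb]
    have hu0 : u ≠ 0 := fun h => by
      have h1 : a * 1 * b = 0 := congrArg Subtype.val h
      have h2 : s 1 = 0 := by
        have h3 : b * (a * 1 * b) * a = b * a * (b * a) := by simp only [mul_one, mul_assoc]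
        rw [hba, hs, h1, mul_zero, zero_mul, mul_one] at h3
        exact h3.symm
      have := congrFun (congrFun h2 i) i
      simp [s] at this
    have h1 : u = 1 := by
      obtain ⟨w, hw⟩ := hdiv u hu0
      rw [← hw] at hu ⊢
      exact w.isUnit.mul_left_cancel (hu.trans (mul_one _).symm)
    have h2 : a * 1 * b = ε := congrArg Subtype.val h1
    rwa [mul_one] at h2
  let Φ : D →ₗ[A₀] hε.Corner :=
    { toFun := fun d => ⟨a * s d * b, hmem _⟩
      map_add' := fun d d' => Subtype.ext <| by
        change a * s (d + d') * b = a * s d * b + a * s d' * b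
        rw [← add_mul, ← mul_add, ← Matrix.single_add]
      map_smul' := fun r d => Subtype.ext <| by
        change a * s (r • d) * b = r • (a * s d * b)
        rw [← smul_mul_assoc, ← mul_smul_comm, Matrix.smul_single] }
  have h1 : Φ 1 = 1 := Subtype.ext <| by
    change a * s 1 * b = ε
    rw [has, hab]
  have hmul : ∀ d d', Φ (d * d') = Φ d * Φ d' := fun d d' => Subtype.ext <| by
    change a * s (d * d') * b = a * s d * b * (a * s d' * b)
    have h2 : a * s d * b * (a * s d' * b) = a * (s d * (b * a) * s d') * b := by
      simp only [mul_assoc]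
    rw [h2, hba, hs, hs, mul_one]
  refine ⟨AlgEquiv.ofBijective (AlgHom.ofLinearMap Φ h1 hmul) ⟨?_, fun x => ?_⟩⟩
  · refine (injective_iff_map_eq_zero (AlgHom.ofLinearMap Φ h1 hmul)).2 fun d hd => ?_
    have h2 : a * s d * b = 0 := congrArg Subtype.val hd
    have h3 : s d = 0 := by
      have : s d = b * (a * s d * b) * a := by
        rw [mul_assoc b, mul_assoc (a * s d), hba, ← mul_assoc, ← mul_assoc, hba, hs, hs, one_mul,
          mul_one]
      rw [this, h2, mul_zero, zero_mul]
    have := congrFun (congrFun h3 i) i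
    simpa [s] using this
  · obtain ⟨hx1, hx2⟩ := (Subsemigroup.mem_corner_iff hε).1 x.2
    refine ⟨(b * x.1 * a) i i, Subtype.ext ?_⟩
    change a * s ((b * x.1 * a) i i) * b = x.1
    rw [← hsM]
    have h2 : a * (s 1 * (b * x.1 * a) * s 1) * b = a * s 1 * b * x.1 * (a * s 1 * b) := by
      simp only [mul_assoc]
    rw [h2, has, hab, hx1, hx2]

theorem exists_valuation_of_algEquiv {A₀ D B : Type*} [CommRing A₀] [Ring D] [Ring B] [Algebra A₀ D]
    [Algebra A₀ B] (φ : D ≃ₐ[A₀] B) {l : ℕ} {v : Valuation B ℤᵐ⁰}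
    (hv : ∃ t : Finset B, ∀ b, v b ≤ 1 ↔ b ∈ Submodule.span A₀ (t : Set B))
    (hl : v (l : B) < 1) (hcomm : ∀ a b, v a ≤ 1 → v b ≤ 1 → v (a * b - b * a) < 1) :
    ∃ v : Valuation D ℤᵐ⁰, (∃ t : Finset D, ∀ b, v b ≤ 1 ↔ b ∈ Submodule.span A₀ (t : Set D)) ∧
      v (l : D) < 1 ∧ ∀ a b, v a ≤ 1 → v b ≤ 1 → v (a * b - b * a) < 1 := by
  classical
  obtain ⟨t, ht⟩ := hv
  have hval : ∀ d, v.comap φ.toRingEquiv.toRingHom d = v (φ d) := fun d => rfl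
  refine ⟨v.comap φ.toRingEquiv.toRingHom, ⟨t.image φ.symm, fun d => ?_⟩, ?_, fun a b ha hb => ?_⟩
  · rw [hval, ht, Finset.coe_image]
    have h1 : Submodule.span A₀ (φ.symm '' (t : Set B)) =
        (Submodule.span A₀ (t : Set B)).map φ.symm.toLinearMap := by
      rw [Submodule.map_span]; rfl
    rw [h1]
    constructor
    · intro h
      exact ⟨φ d, h, φ.symm_apply_apply d⟩
    · rintro ⟨b, hb, rfl⟩
      have : φ (φ.symm.toLinearMap b) = b := φ.apply_symm_apply b
      rwa [this]
  · rw [hval, map_natCast]; exact hl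
  · rw [hval, map_sub, map_mul, map_mul]
    exact hcomm _ _ ha hb

end Matrix

/-! ### The valuation ring of the centre as R_𝔭 -/

section Localization

variable {K : Type*} [Field K]

theorem mem_ofPrime_iff {R : Subring K} {P : Ideal R} [P.IsPrime] {z : K} :
    z ∈ (LocalSubring.ofPrime R P).toSubring ↔ ∃ a b : R, b ∉ P ∧ z * b = a := by
  constructor
  · rintro ⟨x, rfl⟩
    obtain ⟨a, b, rfl⟩ := IsLocalization.exists_mk'_eq P.primeCompl x
    refine ⟨a, b, b.2, ?_⟩
    have h := IsLocalization.lift_mk'_spec (S := Localization.AtPrime P) (g := R.subtype)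
      (M := P.primeCompl) (hg := by simp [Ideal.primeCompl, not_imp_not]) a
      (IsLocalization.lift (M := P.primeCompl) (S := Localization.AtPrime P) (g := R.subtype)
        (by simp [Ideal.primeCompl, not_imp_not]) (IsLocalization.mk' _ a b)) b
    rw [mul_comm]
    exact (h.1 rfl).symm
  · rintro ⟨a, b, hb, hz⟩
    have hb0 : (b : K) ≠ 0 := fun h => hb (by
      have : b = 0 := Subtype.ext h
      rw [this]; exact zero_mem _)
    refine ⟨IsLocalization.mk' (Localization.AtPrime P) a (⟨b, hb⟩ : P.primeCompl), ?_⟩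
    refine (IsLocalization.lift_mk'_spec _ _ _ _).2 ?_
    change (a : K) = b * z
    rw [← hz, mul_comm]

/-- A discrete valuation ring of `K`, integral over the localization of `Λ` at a principal prime,
is the localization of the integral closure `R` of `Λ` at any prime ideal of height one above. -/
theorem toSubring_eq_ofPrime {Λ : Type*} [CommRing Λ] [IsIntegrallyClosed Λ] {p : Λ}
    [hP : (Ideal.span {p}).IsPrime] {θ : Λ →+* K} (hθ : Function.Injective θ) {R : Subring K}
    (hR : ∀ z, z ∈ R ↔ θ.IsIntegralElem z) {𝔭 : Ideal R} [h𝔭 : 𝔭.IsPrime] (hh : 𝔭.height = 1)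
    {pR : R} (hpR : (pR : K) = θ p) (hp𝔭 : pR ∈ 𝔭) (hp0 : p ≠ 0)
    {𝒪 : ValuationSubring K} {v : Valuation K ℤᵐ⁰} (hv : ∀ z, z ∈ 𝒪 ↔ v z ≤ 1)
    (hint : ∀ z, z ∈ 𝒪 → ∃ b, b ∉ Ideal.span {p} ∧ θ.IsIntegralElem (θ b * z)) :
    𝒪.toSubring = (LocalSubring.ofPrime R 𝔭).toSubring := by
  have hθR : ∀ a, θ a ∈ R := fun a => (hR _).2 (RingHom.isIntegralElem_map θ)
  let θR : Λ →+* R := θ.codRestrict R hθR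
  let _ : Algebra Λ R := θR.toAlgebra
  have hinj : Function.Injective (algebraMap Λ R) := fun a b h => hθ (congrArg Subtype.val h)
  have : FaithfulSMul Λ R := (faithfulSMul_iff_algebraMap_injective Λ R).2 hinj
  have : IsDomain Λ := hinj.isDomain
  have : Algebra.IsIntegral Λ R := ⟨fun z => by
    obtain ⟨q, hq, hq0⟩ := (hR z).1 z.2
    refine ⟨q, hq, Subtype.ext ?_⟩
    have h1 : R.subtype.comp (algebraMap Λ R) = θ := rfl
    have h2 := Polynomial.hom_eval₂ q (algebraMap Λ R) R.subtype z
    rw [h1] at h2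
    exact h2.trans hq0⟩
  -- If `𝔭` lay over a prime larger than `(p)`, going-down would give a prime strictly inside `𝔭`
  -- over `(p)`; having height zero it would vanish, yet it contains `p`.
  have hunder : 𝔭.comap (algebraMap Λ R) = Ideal.span {p} := by
    have hp1 : algebraMap Λ R p = pR := Subtype.ext hpR.symm
    have hle : Ideal.span {p} ≤ 𝔭.under Λ := by
      rw [Ideal.span_singleton_le_iff_mem, Ideal.under, Ideal.mem_comap, hp1]
      exact hp𝔭
    by_contra hne
    have hlt : Ideal.span {p} < 𝔭.under Λ := lt_of_le_of_ne hle (Ne.symm hne)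
    have : 𝔭.LiesOver (𝔭.under Λ) := ⟨rfl⟩
    obtain ⟨P, hP𝔭, hPp, hPo⟩ := Ideal.exists_ideal_lt_liesOver_of_lt 𝔭 hlt
    have hpP : pR ∈ P := by
      have := hPo.over ▸ Ideal.mem_span_singleton_self p
      rwa [Ideal.under, Ideal.mem_comap, hp1] at this
    have h1 : P.height = 0 := by
      have := Ideal.height_add_one_le_of_lt_of_isPrime hP𝔭
      rw [hh] at this
      generalize P.height = N at this ⊢
      cases N with
      | top => simp at this
      | coe N =>
        norm_cast at this ⊢
        omega
    rw [Ideal.height_eq_zero_iff_eq_bot] at h1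
    rw [h1] at hpP
    have h2 : pR = 0 := hpP
    rw [h2] at hpR
    exact hp0 (hθ (hpR.symm.trans (map_zero θ).symm))
  have hle : ∀ z, z ∈ 𝒪 → z ∈ (LocalSubring.ofPrime R 𝔭).toSubring := fun z hz => by
    obtain ⟨b, hb, hbz⟩ := hint z hz
    refine mem_ofPrime_iff.2 ⟨⟨_, (hR _).2 hbz⟩, algebraMap Λ R b, fun h => hb ?_, mul_comm _ _⟩
    rw [← hunder]
    exact h
  refine SetLike.ext fun z => ⟨hle z, fun hz => ?_⟩
  -- If `v z > 1`, then `p⁻¹` divided by a large power of `z` lies in `𝒪`, so `p⁻¹` lies in the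
  -- localization at `𝔭`, although `p ∈ 𝔭`.
  by_contra hz𝒪
  have hz1 : 1 < v z := by
    have := mt (hv z).2 hz𝒪
    exact not_le.1 this
  have hpK : (pR : K) ≠ 0 := by
    rw [hpR]
    exact fun h => hp0 (hθ (h.trans (map_zero θ).symm))
  have hz0 : z ≠ 0 := by
    rintro rfl
    rw [map_zero] at hz1
    exact not_lt_zero hz1
  obtain ⟨k, hk⟩ : ∃ k : ℕ, v (pR : K)⁻¹ ≤ v z ^ k := MulArchimedean.arch _ hz1
  have h1 : (pR : K)⁻¹ * (z ^ k)⁻¹ ∈ 𝒪 := by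
    rw [hv, map_mul, map_inv₀ v (z ^ k), map_pow]
    exact mul_inv_le_one_of_le₀ hk zero_le
  have h2 : (pR : K)⁻¹ ∈ (LocalSubring.ofPrime R 𝔭).toSubring := by
    have := mul_mem (hle _ h1) (pow_mem hz k)
    rwa [mul_assoc, inv_mul_cancel₀ (pow_ne_zero k hz0), mul_one] at this
  obtain ⟨a, b, hb, hab⟩ := mem_ofPrime_iff.1 h2
  refine hb ?_
  have h3 : b = pR * a := Subtype.ext <| by
    change (b : K) = pR * a
    rw [← hab, ← mul_assoc, mul_inv_cancel₀ hpK, one_mul]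
  rw [h3]
  exact Ideal.mul_mem_right _ _ hp𝔭

end Localization

end Iwasawa

end

noncomputable section

namespace Iwasawa

open WithZero

section Group

variable {G : Type*} [Group G] (H : Subgroup G) [H.Normal] (γ : G)

theorem exists_eq_mul_zpow_of_mem_sup {g : G} (hg : g ∈ Subgroup.zpowers γ ⊔ H) :
    ∃ h ∈ H, ∃ i : ℤ, g = h * γ ^ i := by
  rw [sup_comm] at hg
  obtain ⟨h, hh, x, ⟨i, rfl⟩, rfl⟩ := Subgroup.mem_sup_of_normal_left.1 hg
  exact ⟨h, hh, i, rfl⟩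

end Group

universe u

/-! ### Descent of the valuation to D -/

section Localization

/-- Multiplication by `z` preserves the valuation ring of `v`, a finitely generated faithful module.
-/
theorem isIntegral_of_mul_mem_span {A₀ D : Type*} [CommRing A₀] [DivisionRing D]
    [Algebra A₀ (Subring.center D)] [Algebra A₀ D] [IsScalarTower A₀ (Subring.center D) D]
    {v : Valuation D ℤᵐ⁰} {t : Finset D} (ht : ∀ d, v d ≤ 1 ↔ d ∈ Submodule.span A₀ (t : Set D))
    {z : Subring.center D} (hz : v (z : D) ≤ 1) : IsIntegral A₀ z := by
  refine isIntegral_of_smul_mem_submodule (M := D) (Submodule.span A₀ (t : Set D)) ?_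
    ⟨t, rfl⟩ z fun d hd => ?_
  · intro h
    have h1 : (1 : D) ∈ Submodule.span A₀ (t : Set D) := (ht 1).1 (by rw [map_one])
    rw [h] at h1
    exact one_ne_zero h1
  · rw [← ht] at hd ⊢
    change v ((z : D) * d) ≤ 1
    rw [map_mul]
    exact mul_le_one' hz hd

/-- If the matrix algebra `Mₙ(D)` is spanned over the fraction field of `Λ` by the image of a group
which is the product of a finite normal `l`-subgroup and a cyclic group `⟨γ⟩`, where a power of `γ`
acts as `1 + T`, then `D` has a discrete valuation with commutative residue field whose valuation
ring is finite over the localization of `Λ` at `l`. -/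
theorem exists_valuation_of_span_matrix {Λ : Type*} (A₀ : Type*) {F D : Type*} [CommRing Λ]
    [IsLocalRing Λ] [IsNoetherianRing Λ] {l : ℕ} [hlp : Fact l.Prime] (hl2 : l ≠ 2) {T : Λ}
    (hmax : IsLocalRing.maximalIdeal Λ = Ideal.span {(l : Λ), T})
    [hP : (Ideal.span {(l : Λ)}).IsPrime] (hT : T ∉ Ideal.span {(l : Λ)})
    [CommRing A₀] [Algebra Λ A₀] [IsLocalization.AtPrime A₀ (Ideal.span {(l : Λ)})]
    [Field F] [CharZero F] [Algebra A₀ F]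
    (hF : ∀ c : F, ∃ n : ℕ, ∃ a : A₀, (l : F) ^ n * c = algebraMap A₀ F a)
    [DivisionRing D] [Algebra F D] [Algebra A₀ D] [IsScalarTower A₀ F D] [Algebra Λ D]
    [IsScalarTower Λ A₀ D] [Algebra A₀ (Subring.center D)] [IsScalarTower A₀ (Subring.center D) D]
    [Algebra Λ (Subring.center D)] [IsScalarTower Λ A₀ (Subring.center D)]
    {n : ℕ} (hn : 0 < n) [FiniteDimensional F (Matrix (Fin n) (Fin n) D)]
    {G : Type*} [Group G] (H : Subgroup G) [H.Normal] [Finite H] (hH : IsPGroup l H) {γ : G} {m : ℕ}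
    (hγ : γ ^ l ^ m ∈ Subgroup.center G) (hgen : ∀ g : G, ∃ h ∈ H, ∃ i : ℤ, g = h * γ ^ i)
    {ρ : G →* Matrix (Fin n) (Fin n) D} (hρ : Submodule.span F (Set.range ρ) = ⊤)
    (hργ : ρ (γ ^ l ^ m) = algebraMap Λ (Matrix (Fin n) (Fin n) D) (1 + T)) :
    ∃ v : Valuation D ℤᵐ⁰, v (l : D) < 1 ∧
      (∀ a b, v a ≤ 1 → v b ≤ 1 → v (a * b - b * a) < 1) ∧
      (∃ t : Finset D, ∀ 𝒪 : ValuationSubring (Subring.center D),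
        (∀ z, z ∈ 𝒪 ↔ v (z : D) ≤ 1) → ∀ d, v d ≤ 1 ↔ d ∈ Submodule.span 𝒪 (t : Set D)) ∧
      (∀ a : Λ, v (algebraMap Λ (Subring.center D) a : D) ≤ 1) ∧
      ∀ z : Subring.center D, v (z : D) ≤ 1 →
        ∃ b ∉ Ideal.span {(l : Λ)}, IsIntegral Λ (b • z) := by
  have : Nonempty (Fin n) := ⟨⟨0, hn⟩⟩
  obtain ⟨ε, hε, h0, hdiv, v, hv, hvl, hcomm⟩ := exists_corner_valuation A₀ hl2 hmax hT hF H hH hγ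
    hgen hρ hργ
  obtain ⟨φ⟩ := exists_algEquiv_corner A₀ hε h0 hdiv
  obtain ⟨v, ⟨t, ht⟩, hvl, hcomm⟩ := exists_valuation_of_algEquiv φ hv hvl hcomm
  have hA₀ : ∀ a : A₀, v (algebraMap A₀ (Subring.center D) a : D) ≤ 1 := fun a => by
    have h1 : (algebraMap A₀ (Subring.center D) a : D) = a • (1 : D) := by
      rw [← algebraMap_smul (Subring.center D) a (1 : D), Subring.smul_def, smul_eq_mul, mul_one]
    rw [h1, ht]
    exact Submodule.smul_mem _ _ ((ht 1).1 (by rw [map_one]))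
  refine ⟨v, hvl, hcomm, ⟨t, fun 𝒪 h𝒪 d => ⟨fun hd => ?_, fun hd => ?_⟩⟩, fun a => ?_, fun z hz => ?_⟩
  · rw [ht] at hd
    induction hd using Submodule.span_induction with
    | mem d hd => exact Submodule.subset_span hd
    | zero => exact zero_mem _
    | add a b _ _ iha ihb => exact add_mem iha ihb
    | smul a d _ ih =>
      have h1 : a • d = (⟨_, (h𝒪 _).2 (hA₀ a)⟩ : 𝒪) • d :=
        (algebraMap_smul (Subring.center D) a d).symm
      rw [h1]
      exact Submodule.smul_mem _ _ ih
  · induction hd using Submodule.span_induction with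
    | mem d hd => exact (ht d).2 (Submodule.subset_span hd)
    | zero => rw [map_zero]; exact zero_le_one
    | add a b _ _ iha ihb => exact v.map_add_le iha ihb
    | smul a d _ ih =>
      change v (((a : Subring.center D) : D) * d) ≤ 1
      rw [map_mul]
      exact mul_le_one' ((h𝒪 _).1 a.2) ih
  · rw [IsScalarTower.algebraMap_apply Λ A₀ (Subring.center D)]
    exact hA₀ _
  · obtain ⟨b, hb⟩ := (isIntegral_of_mul_mem_span ht hz).exists_multiple_integral_of_isLocalization
      (Ideal.span {(l : Λ)}).primeCompl
    exact ⟨b, b.2, hb⟩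

theorem exists_valuation_of_ringHom_center {Λ : Type u} {D : Type*} [CommRing Λ]
    [IsDomain Λ] [IsLocalRing Λ] [IsNoetherianRing Λ] [CharZero Λ] {l : ℕ} [hlp : Fact l.Prime] (hl2 : l ≠ 2) {T : Λ}
    (hmax : IsLocalRing.maximalIdeal Λ = Ideal.span {(l : Λ), T})
    [hP : (Ideal.span {(l : Λ)}).IsPrime] (hT : T ∉ Ideal.span {(l : Λ)})
    [DivisionRing D] {θ : Λ →+* Subring.center D} (hθ : Function.Injective θ) {n : ℕ} (hn : 0 < n)
    {G : Type*} [Group G] (H : Subgroup G) [H.Normal] [Finite H] (hH : IsPGroup l H) {γ : G} {m : ℕ}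
    (hγ : γ ^ l ^ m ∈ Subgroup.center G) (hgen : ∀ g : G, ∃ h ∈ H, ∃ i : ℤ, g = h * γ ^ i)
    {ρ : G →* Matrix (Fin n) (Fin n) D} {ι : Type*} [Fintype ι] (g : ι → G)
    (hρ : ∀ M, ∃ a ≠ 0, ∃ r : ι → Λ, M * Matrix.scalar (Fin n) (θ a : D) =
      ∑ i, Matrix.scalar (Fin n) (θ (r i) : D) * ρ (g i))
    (hργ : ρ (γ ^ l ^ m) = Matrix.scalar (Fin n) (θ (1 + T) : D)) :
    ∃ v : Valuation D ℤᵐ⁰, v (l : D) < 1 ∧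
      (∀ a b, v a ≤ 1 → v b ≤ 1 → v (a * b - b * a) < 1) ∧
      (∃ t : Finset D, ∀ 𝒪 : ValuationSubring (Subring.center D),
        (∀ z, z ∈ 𝒪 ↔ v (z : D) ≤ 1) → ∀ d, v d ≤ 1 ↔ d ∈ Submodule.span 𝒪 (t : Set D)) ∧
      (∀ a : Λ, v (θ a : D) ≤ 1) ∧
      ∀ z : Subring.center D, v (z : D) ≤ 1 →
        ∃ b ∉ Ideal.span {(l : Λ)}, θ.IsIntegralElem (θ b * z) := by
  have hl0 : (l : Λ) ≠ 0 := Nat.cast_ne_zero.2 hlp.1.ne_zero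
  obtain ⟨A₀, _, _, _⟩ : ∃ (A₀ : Type u) (_ : CommRing A₀) (_ : Algebra Λ A₀),
      IsLocalization.AtPrime A₀ (Ideal.span {(l : Λ)}) :=
    ⟨Localization.AtPrime (Ideal.span {(l : Λ)}), inferInstance, inferInstance, inferInstance⟩
  have hunit : ∀ y : (Ideal.span {(l : Λ)}).primeCompl, IsUnit (θ y) := fun y =>
    isUnit_iff_ne_zero.2 fun h => y.2 (by
      rw [hθ (h.trans (map_zero θ).symm)]; exact zero_mem _)
  have hle : (Ideal.span {(l : Λ)}).primeCompl ≤ nonZeroDivisors Λ :=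
    Ideal.primeCompl_le_nonZeroDivisors _
  let _ : Algebra Λ (Subring.center D) := θ.toAlgebra
  let _ : Algebra A₀ (Subring.center D) := (IsLocalization.lift (S := A₀) hunit).toAlgebra
  have : IsScalarTower Λ A₀ (Subring.center D) := .of_algebraMap_eq fun a =>
    (IsLocalization.lift_eq hunit a).symm
  have hinj : Function.Injective (algebraMap A₀ (Subring.center D)) :=
    (IsLocalization.lift_injective_iff hunit).2 fun x y => by
      rw [(IsLocalization.injective A₀ hle).eq_iff, hθ.eq_iff]
  have : IsDomain A₀ := hinj.isDomain
  obtain ⟨F, _, _, _⟩ : ∃ (F : Type u) (_ : Field F) (_ : Algebra A₀ F), IsFractionRing A₀ F :=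
    ⟨FractionRing A₀, inferInstance, inferInstance, inferInstance⟩
  let _ : Algebra Λ F := ((algebraMap A₀ F).comp (algebraMap Λ A₀)).toAlgebra
  have : IsScalarTower Λ A₀ F := .of_algebraMap_eq fun _ => rfl
  let _ : Algebra F (Subring.center D) := (IsFractionRing.lift (K := F) hinj).toAlgebra
  have : IsScalarTower A₀ F (Subring.center D) := .of_algebraMap_eq fun a =>
    (IsFractionRing.lift_algebraMap hinj a).symm
  let _ : Algebra Λ D := Algebra.compHom D (algebraMap Λ (Subring.center D))
  let _ : Algebra A₀ D := Algebra.compHom D (algebraMap A₀ (Subring.center D))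
  let _ : Algebra F D := Algebra.compHom D (algebraMap F (Subring.center D))
  have hΛD : ∀ a : Λ, algebraMap Λ D a = θ a := fun _ => rfl
  have : IsScalarTower A₀ (Subring.center D) D := .of_algebraMap_eq fun _ => rfl
  have : IsScalarTower A₀ F D := .of_algebraMap_eq fun a =>
    congrArg Subtype.val (IsScalarTower.algebraMap_apply A₀ F (Subring.center D) a)
  have : IsScalarTower Λ A₀ D := .of_algebraMap_eq fun a =>
    congrArg Subtype.val (IsScalarTower.algebraMap_apply Λ A₀ (Subring.center D) a)
  have : IsScalarTower Λ F D := .of_algebraMap_eq fun a => by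
    rw [IsScalarTower.algebraMap_apply Λ A₀ F, ← IsScalarTower.algebraMap_apply A₀ F D,
      ← IsScalarTower.algebraMap_apply Λ A₀ D]
  have hΛF : Function.Injective (algebraMap Λ F) := by
    rw [IsScalarTower.algebraMap_eq Λ A₀ F]
    exact (IsFractionRing.injective A₀ F).comp (IsLocalization.injective A₀ hle)
  have : CharZero F := charZero_of_injective_algebraMap hΛF
  have hlirr : Irreducible (l : Λ) := ((Ideal.span_singleton_prime hl0).1 hP).irreducible
  -- Inverting `l` in the localization at `(l)` gives the whole fraction field: once the highest
  -- power of `l` is extracted, a denominator is a unit.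
  have hF : ∀ c : F, ∃ n : ℕ, ∃ a : A₀, (l : F) ^ n * c = algebraMap A₀ F a := fun c => by
    obtain ⟨x, y, hy, rfl⟩ := IsFractionRing.div_surjective (A := A₀) c
    obtain ⟨y, s, rfl⟩ := IsLocalization.exists_mk'_eq (Ideal.span {(l : Λ)}).primeCompl y
    have hy0 : y ≠ 0 := by
      rintro rfl
      rw [IsLocalization.mk'_zero] at hy
      exact zero_notMem_nonZeroDivisors hy
    obtain ⟨k, y', hy', rfl⟩ := WfDvdMonoid.max_power_factor hy0 hlirr
    rw [← Ideal.mem_span_singleton] at hy'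
    have hy'0 : algebraMap Λ F y' ≠ 0 := fun h => hy' (by
      rw [hΛF (h.trans (map_zero _).symm)]; exact zero_mem _)
    have hlF : (l : F) ≠ 0 := Nat.cast_ne_zero.2 hlp.1.ne_zero
    have hs0 : algebraMap Λ F s ≠ 0 := fun h => s.2 (by
      rw [hΛF (h.trans (map_zero _).symm)]; exact zero_mem _)
    refine ⟨k, x * IsLocalization.mk' A₀ (s : Λ) (⟨y', hy'⟩ : (Ideal.span {(l : Λ)}).primeCompl), ?_⟩
    have h1 : ∀ (a : Λ) (b : (Ideal.span {(l : Λ)}).primeCompl), algebraMap Λ F b ≠ 0 →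
        algebraMap A₀ F (IsLocalization.mk' A₀ a b) = algebraMap Λ F a / algebraMap Λ F b := by
      intro a b hb
      rw [eq_div_iff hb, IsScalarTower.algebraMap_apply Λ A₀ F, ← map_mul,
        IsLocalization.mk'_spec, ← IsScalarTower.algebraMap_apply]
    rw [map_mul, h1 _ _ hs0, h1 _ _ hy'0, map_mul, map_pow, map_natCast]
    field_simp
  have hsc : ∀ (a : Λ) (M : Matrix (Fin n) (Fin n) D),
      Matrix.scalar (Fin n) (θ a : D) * M = algebraMap Λ F a • M := fun a M => by
    rw [algebraMap_smul]
    refine Matrix.ext fun i j => ?_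
    rw [Matrix.scalar_apply, Matrix.diagonal_mul, Matrix.smul_apply, Algebra.smul_def, hΛD]
  have hspan : Submodule.span F (Set.range (ρ ∘ g)) = ⊤ := by
    refine Submodule.eq_top_iff'.2 fun M => ?_
    obtain ⟨a, ha, r, hr⟩ := hρ M
    have ha0 : algebraMap Λ F a ≠ 0 := fun h => ha (hΛF (h.trans (map_zero _).symm))
    have h1 : M * Matrix.scalar (Fin n) (θ a : D) = Matrix.scalar (Fin n) (θ a : D) * M :=
      (Matrix.scalar_commute _ (fun d => (Subring.mem_center_iff.1 (θ a).2 d).symm) M).eq.symm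
    rw [h1, hsc] at hr
    rw [← inv_smul_smul₀ ha0 M, hr]
    refine Submodule.smul_mem _ _ (sum_mem fun i _ => ?_)
    rw [hsc]
    exact Submodule.smul_mem _ _ (Submodule.subset_span ⟨i, rfl⟩)
  have : FiniteDimensional F (Matrix (Fin n) (Fin n) D) :=
    ⟨Submodule.fg_def.2 ⟨_, Set.finite_range _, hspan⟩⟩
  obtain ⟨v, hv1, hv2, hv3, hv4, hv5⟩ := exists_valuation_of_span_matrix A₀ hl2 hmax hT hF hn H hH hγ
    hgen (ρ := ρ) (top_unique (hspan.ge.trans (Submodule.span_mono (Set.range_comp_subset_range _ _))))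
    (by
      rw [hργ, Algebra.algebraMap_eq_smul_one, ← algebraMap_smul F, ← hsc, mul_one])
  refine ⟨v, hv1, hv2, hv3, hv4, fun z hz => ?_⟩
  obtain ⟨b, hb, hbz⟩ := hv5 z hz
  refine ⟨b, hb, ?_⟩
  rw [Algebra.smul_def] at hbz
  exact hbz

end Localization

end Iwasawa

end

noncomputable section

namespace Iwasawa

open PowerSeries WithZero

/-! ### Application to the components of 𝒬G -/

section Tower

variable {l : ℕ} [hl : Fact l.Prime] {G : Type*} [Group G] [TopologicalSpace G] {H : Subgroup G}
  {γ : G} {m : ℕ} {U : ℕ → OpenNormalSubgroup G}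

theorem IsIwasawaTower.exists_hom_center_of_component (T : IsIwasawaTower l H γ m U) [H.Normal]
    [Finite H] {e : QuotIwasawa l G} (he : IsPrimitiveCentralIdempotent e) {D : Type*}
    [DivisionRing D] {n : ℕ} (f : Component he ≃+* Matrix (Fin n) (Fin n) D) :
    ∃ θ : ℤ_[l]⟦X⟧ →+* Subring.center D, Function.Injective θ ∧
      (∀ a, f (toComponent he (T.powerSeriesHom a)) = Matrix.scalar (Fin n) (θ a : D)) ∧
      (∀ z, z ∈ integralCentre he f ↔ θ.IsIntegralElem z) ∧
      ∀ M : Matrix (Fin n) (Fin n) D, ∃ a ≠ 0, ∃ r : iwasawaAlgebra l G,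
        M * f (toComponent he (T.powerSeriesHom a)) = f (toComponent he r) := by
  have := Fintype.ofFinite H
  have hne : Nontrivial (iwasawaAlgebra l G) := by
    by_contra h
    rw [not_nontrivial_iff_subsingleton] at h
    have h1 : toComponent he 1 = toComponent he 0 := congrArg _ (Subsingleton.elim _ _)
    rw [map_one, map_zero] at h1
    exact he.ne_zero (congrArg Subtype.val h1)
  refine exists_hom_center he f (T.commute_powerSeriesHom) (fun a ha =>
    T.powerSeriesHom_mem_nonZeroDivisors ha)
    (g := fun i : H × Fin (l ^ m) => groupElement l ((i.1 : G) * γ ^ (i.2 : ℕ))) fun x => ?_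
  obtain ⟨r, hr⟩ := T.exists_sum_powerSeriesHom x
  exact ⟨r, by rw [finsum_eq_sum_of_fintype]; exact hr⟩

theorem IsIwasawaTower.exists_valuation_of_component (T : IsIwasawaTower l H γ m U) (hl2 : l ≠ 2)
    [H.Normal] [Finite H] (hH : IsPGroup l H) {e : QuotIwasawa l G}
    (he : IsPrimitiveCentralIdempotent e) {D : Type*} [DivisionRing D] {n : ℕ}
    (f : Component he ≃+* Matrix (Fin n) (Fin n) D) :
    ∃ θ : ℤ_[l]⟦X⟧ →+* Subring.center D, Function.Injective θ ∧
      (∀ z, z ∈ integralCentre he f ↔ θ.IsIntegralElem z) ∧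
      ∃ v : Valuation D ℤᵐ⁰, v (l : D) < 1 ∧
        (∀ a b, v a ≤ 1 → v b ≤ 1 → v (a * b - b * a) < 1) ∧
        (∃ t : Finset D, ∀ 𝒪 : ValuationSubring (Subring.center D),
          (∀ z, z ∈ 𝒪 ↔ v (z : D) ≤ 1) → ∀ d, v d ≤ 1 ↔ d ∈ Submodule.span 𝒪 (t : Set D)) ∧
        (∀ a, v (θ a : D) ≤ 1) ∧
        ∀ z : Subring.center D, v (z : D) ≤ 1 →
          ∃ b ∉ Ideal.span {(l : ℤ_[l]⟦X⟧)}, θ.IsIntegralElem (θ b * z) := by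
  have := Fintype.ofFinite H
  obtain ⟨θ, hθ, hθf, hint, hM⟩ := T.exists_hom_center_of_component he f
  refine ⟨θ, hθ, hint, ?_⟩
  have hC : CharZero ℤ_[l]⟦X⟧ := charZero_of_injective_ringHom (f := PowerSeries.C (R := ℤ_[l]))
    PowerSeries.C_injective
  -- The abstract group generated by `γ` and `H` replaces `G`: it contains the basis `h γ ^ a`, and
  -- each of its elements is exactly an element of `H` times a power of `γ`.
  let S := Subgroup.zpowers γ ⊔ H
  have hγS : γ ∈ S := Subgroup.mem_sup_left (Subgroup.mem_zpowers γ)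
  have hHS : ∀ h : H, (h : G) ∈ S := fun h => Subgroup.mem_sup_right h.2
  obtain ⟨F, hF⟩ : ∃ F : iwasawaAlgebra l G →+* Matrix (Fin n) (Fin n) D,
      ∀ x, F x = f (toComponent he x) :=
    ⟨(f : Component he →+* Matrix (Fin n) (Fin n) D).comp (toComponent he), fun _ => rfl⟩
  simp only [← hF] at hθf hM
  let π : G →* Matrix (Fin n) (Fin n) D := (F : iwasawaAlgebra l G →* _).comp (groupElement l)
  have hfin : Finite (H.subgroupOf S) :=
    Finite.of_injective (fun s => (⟨s.1, s.2⟩ : H)) fun s t hst =>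
      Subtype.ext (Subtype.ext (congrArg (fun z : H => (z : G)) hst))
  refine exists_valuation_of_ringHom_center hl2
    maximalIdeal_powerSeries X_notMem_span_natCast hθ (pos_of_component he f) (G := S)
    (H.subgroupOf S) (hH.comap_of_injective S.subtype Subtype.val_injective)
    (γ := ⟨γ, hγS⟩) (m := m) (Subgroup.mem_center_iff.2 fun g => Subtype.ext
      (Subgroup.mem_center_iff.1 T.central g.1)) (fun g => ?_) (ρ := π.comp S.subtype)
    (ι := H × Fin (l ^ m))
    (fun i => ⟨(i.1 : G) * γ ^ (i.2 : ℕ), mul_mem (hHS _) (_root_.pow_mem hγS _)⟩) (fun M => ?_) ?_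
  · obtain ⟨h, hh, i, he⟩ := exists_eq_mul_zpow_of_mem_sup H γ g.2
    exact ⟨⟨h, hHS ⟨h, hh⟩⟩, hh, i, Subtype.ext he⟩
  · obtain ⟨a, ha, r, hr⟩ := hM M
    obtain ⟨c, hc⟩ := T.exists_sum_powerSeriesHom r
    refine ⟨a, ha, c, ?_⟩
    rw [← hθf, hr, hc, map_sum]
    refine Finset.sum_congr rfl fun i _ => ?_
    rw [map_mul, hθf]
    rfl
  · change F (groupElement l (γ ^ l ^ m)) = _
    rw [← hθf, map_add, map_one, T.powerSeriesHom_X, add_sub_cancel]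

end Tower

end Iwasawa

end

theorem proposition3 {l : ℕ} [Fact l.Prime] (hl : l ≠ 2)
    {G : Type*} [Group G] [TopologicalSpace G] [IsTopologicalGroup G] [CompactSpace G] [T2Space G]
    [TotallyDisconnectedSpace G]
    (H : Subgroup G) [H.Normal] [Finite H] (hH : IsPGroup l H)
    (hΓ : Nonempty ((G ⧸ H) ≃ₜ* Multiplicative ℤ_[l]))
    {e : Iwasawa.QuotIwasawa l G} (he : Iwasawa.IsPrimitiveCentralIdempotent e)
    {D : Type*} [DivisionRing D] {n : ℕ}
    (f : Iwasawa.Component he ≃+* Matrix (Fin n) (Fin n) D)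
    (𝔭 : Ideal (Iwasawa.integralCentre he f)) [𝔭.IsPrime] (h𝔭 : 𝔭.height = 1)
    (hl𝔭 : (l : Iwasawa.integralCentre he f) ∈ 𝔭) :
    ∃ 𝒪 : ValuationSubring (Subring.center D),
      𝒪.toSubring = (LocalSubring.ofPrime (Iwasawa.integralCentre he f) 𝔭).toSubring ∧
      Iwasawa.IsSkewField (Iwasawa.SkewCompletion 𝒪) ∧
      (∃ s : ℕ, Iwasawa.IsSchurIndex D s ∧
        Iwasawa.IsSchurIndex (Iwasawa.SkewCompletion 𝒪) s) ∧
      ∃ w : Valuation (Iwasawa.SkewCompletion 𝒪) 𝒪.ValueGroup,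
        (∀ d : Iwasawa.SkewCompletion 𝒪,
          w d = Valued.v (Algebra.norm (Iwasawa.CentreCompletion 𝒪) d)) ∧
        (w.comap (algebraMap (Iwasawa.CentreCompletion 𝒪) (Iwasawa.SkewCompletion 𝒪))).IsEquiv
          Valued.v ∧
        IsField (Iwasawa.ResidueRing w) := by
  obtain ⟨E⟩ := hΓ
  obtain ⟨γ, m, U, T⟩ := Iwasawa.exists_isIwasawaTower H hH E
  obtain ⟨θ, hθ, hR, v, hvl, hcomm, ⟨t, ht⟩, -, hint⟩ := T.exists_valuation_of_component hl hH he f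
  have hl0 : (l : PowerSeries ℤ_[l]) ≠ 0 := fun h => by
    have h1 := congrArg PowerSeries.constantCoeff h
    rw [map_natCast, map_zero] at h1
    exact Nat.cast_ne_zero.2 (Fact.out : l.Prime).ne_zero h1
  -- The valuation ring is obtained by restricting `v` to the centre and only afterwards identified
  -- with the localization at `𝔭`.
  let vZ : Valuation (Subring.center D) (WithZero (Multiplicative ℤ)) := v.comap (Subring.center D).subtype
  have h𝒪 : ∀ z, z ∈ vZ.valuationSubring ↔ v (z : D) ≤ 1 := fun z => Iff.rfl
  obtain ⟨hfin, hskew, hw⟩ := Iwasawa.isSkewField_skewCompletion vZ.valuationSubring h𝒪 (ht _ h𝒪)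
    (p := (l : Subring.center D))
    (fun h => hl0 (hθ (by rw [map_natCast, map_zero, h]))) hvl hcomm
  refine ⟨vZ.valuationSubring, ?_, hskew, Iwasawa.exists_isSchurIndex _, hw⟩
  exact Iwasawa.toSubring_eq_ofPrime (p := (l : PowerSeries ℤ_[l])) hθ hR h𝔭
    (by rw [map_natCast]; rfl) hl𝔭 hl0 (v := vZ) h𝒪 fun z hz => hint z ((h𝒪 z).1 hz)
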